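/- **Setting.** Let $L>0$, $d\in\mathbb N$, $\mathbb T^d=\mathbb R^d/(L\mathbb Z)^d$, and consider the stochastic neural field equation $$\tau\,\partial_t\rho=-\partial_s\Big[\big(\Phi(W*\bar\rho+B)-s\big)\rho\Big]+\sigma\,\partial_s^2\rho,\qquad x\in\mathbb T^d,\ s\ge 0,\qquad \bar\rho(x,t)=\int_0^\infty s\,\rho(x,s,t)\,ds,$$ with $\tau,\sigma>0$, no-flux condition at $s=0$ and $\int_0^\infty\rho(x,s,t)\,ds=L^{-d}$ for all $x$. Put $\kappa=1/\sigma$ and $W_0=\int_{\mathbb T^d}W$. *Assumptions.* $W\in L^2_S(\mathbb T^d)$, the space of $L^2$ functions that are even in each coordinate; $\Phi\in C^2(\mathbb R)$, $\Phi''\ge 0$, $\Phi$ is (strictly) increasing on $[0,\infty)$ and $\Phi\equiv0$ on $(-\infty,0]$; $B>0$ and $W_0<0$. Let $L^2_{ex}(\mathbb T^d)\subset L^2_S(\mathbb T^d)$ be the subspace of functions that are invariant (a.e.) under permutations of the coordinates. *Fourier modes.* For $k\in\mathbb N^d$ let $\Theta(k)=\prod_i\sqrt{2-\delta_{k_i,0}}$,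 $\omega_k(x)=\frac{\Theta(k)}{L^{d/2}}\prod_{i}\cos(2\pi k_ix_i/L)$ and $\tilde W(k)=\int_{\mathbb T^d}W\omega_k$. *Stationary states.* The activity averages of stationary states are the zeros of $$\bar{\mathcal G}(\bar\rho,\kappa)=\bar\rho-\frac{\int_0^\infty s\,e^{-\kappa(s-\Phi(W*\bar\rho+B))^2/2}ds}{L^d\int_0^\infty e^{-\kappa(s-\Phi(W*\bar\rho+B))^2/2}ds}.$$ For every $\kappa>0$ there is exactly one constant zero, denoted $\bar\rho_\infty^\kappa$, and the limit $\rho^*=\lim_{\kappa\to\infty}\bar\rho^\kappa_\infty$ exists. Write $\Phi_0=\Phi(W_0\bar\rho_\infty^\kappa+B)$, $\Phi_0'=\Phi'(W_0\bar\rho_\infty^\kappa+B)$ and $\rho_\infty^\kappa(s)=e^{-\kappa(s-\Phi_0)^2/2}\big/\big(L^d\int_0^\infty e^{-\kappa(s'-\Phi_0)^2/2}ds'\big)$. *Bifurcation points.* $(\bar\rho_\infty^{\kappa_0},\kappa_0)$ is a bifurcation point in $X\subset L^2(\mathbb T^d)$ if a $C^1$ curve $z\mapsto(r(z),\kappa(z))\in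 X\times(0,\infty)$, $|z|<\delta$, of zeros of $\bar{\mathcal G}$ passes through it at $z=0$, with $r(z)$ non-constant for $z\ne0$, and all zeros of $\bar{\mathcal G}$ in $X\times(0,\infty)$ in a neighbourhood of this point lie on that curve or on the homogeneous branch $\{(\bar\rho_\infty^\kappa,\kappa)\}$. *Linear stability.* The linearised equation at $\rho_\infty^\kappa$ is $$\tau\,\partial_tu=-\partial_sJ,\qquad J=(\Phi_0-s)u+\Phi_0'\,(W*\bar u)\,\rho^\kappa_\infty-\sigma\,\partial_su,\qquad J|_{s=0}=0,$$ with $\bar u(x)=\int_0^\infty s\,u(x,s)\,ds$ and $\int_0^\infty u(x,s)\,ds=0$ for a.e. $x$. Its solutions are understood as functions $u\in C([0,\infty);H_\kappa)$, differentiable in $H_\kappa$ for $t>0$, in the Hilbert space $H_\kappa=L^2(\mathbb T^d\times\mathbb R_+;\,(\rho_\infty^\kappa)^{-1}dx\,ds)$, whose norm controls that of $L^2(\mathbb T^d\times\mathbb R_+)$; for each $t>0$ one requires $J\in H_\kappa$, with $\partial_su$ a weak derivative and with the equation and no-flux condition in weak form. $\rho^\kappa_\infty$ is linearly asymptotically stable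 if there is $C$ with $\|u(t)\|\le C\|u(0)\|$ for all $t\ge0$ and all solutions $u$, and $u(t)\to0$ as $t\to\infty$ for all solutions $u$. **Corollary (characterisation of the first bifurcation).** Let $k^*\in\mathbb N^d$ be such that $$\frac{\tilde W(k^*)}{\Theta(k^*)}=\max_{k\in\mathbb N^d}\frac{\tilde W(k)}{\Theta(k)}\qquad\text{and}\qquad\frac{\tilde W(k^*)}{\Theta(k^*)}>\frac{L^{d/2}}{\Phi'(W_0\rho^*+B)},$$ and such that for every $k\in\mathbb N^d\setminus\{k^*\}$ either $\frac{\tilde W(k)}{\Theta(k)}\neq\frac{\tilde W(k^*)}{\Theta(k^*)}$, or $W\in L^2_{ex}(\mathbb T^d)$ and $k$ is a permutation of $k^*$. Then there is a unique $\kappa^*>0$ such that, at $\kappa=\kappa^*$, $$\frac{\tilde W(k^*)}{\Theta(k^*)}=\frac{1}{L^{d/2}\,\Phi_0'\left(\frac1{L^d}-L^d\bar\rho_\infty^{\kappa}\big(\bar\rho_\infty^{\kappa}-\frac{\Phi_0}{L^d}\big)\kappa\right)},$$ and $(\bar\rho_\infty^{\kappa^*},\kappa^*)$ is the first bifurcation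 point: it is a bifurcation point in $L^2_S(\mathbb T^d)$ if $\frac{\tilde W(k)}{\Theta(k)}\ne\frac{\tilde W(k^*)}{\Theta(k^*)}$ for all $k\neq k^*$, and in $L^2_{ex}(\mathbb T^d)$ if $W\in L^2_{ex}(\mathbb T^d)$; and for every $\kappa\in(0,\kappa^*)$, all zeros of $\bar{\mathcal G}$ in $L^2_S(\mathbb T^d)\times(0,\infty)$ close to $(\bar\rho_\infty^\kappa,\kappa)$ are homogeneous. Moreover linear stability is lost at $\kappa^*$: $\kappa^*$ is the smallest $\kappa>0$ for which $\rho_\infty^\kappa$ is not linearly asymptotically stable. -/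

import Mathlib

open MeasureTheory Filter Topology

noncomputable section

namespace NeuralField

/-- The torus `ℝ^d / (Lℤ)^d`, with the product of the Lebesgue measures of the circles of
length `L` (total mass `L ^ d`). -/
abbrev Torus (d : ℕ) (L : ℝ) : Type := Fin d → AddCircle L

/-- The data of the stochastic neural field equation
`τ ∂ₜρ = -∂ₛ[(Φ(∫ W(x-y) ρ̄(y,t) dy + B) - s) ρ] + σ ∂ₛ²ρ`, with `ρ = ρ(x,s,t)`, `x` in the torus,
`s ≥ 0`, and `ρ̄(x,t) = ∫ s ρ(x,s,t) ds`. The noise level `σ = 1/κ` is kept apart. -/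
structure Model (d : ℕ) (L : ℝ) where
  /-- connectivity kernel -/
  W : Torus d L → ℝ
  /-- modulation function -/
  Φ : ℝ → ℝ
  /-- external input -/
  B : ℝ
  /-- relaxation time -/
  τ : ℝ

section Spaces

variable {d : ℕ} {L : ℝ} [Fact (0 < L)]

/-- Coordinate-wise even functions (almost everywhere). -/
def CoordEven (u : Torus d L → ℝ) : Prop :=
  ∀ i : Fin d, ∀ᵐ x : Torus d L, u (Function.update x i (-x i)) = u x

/-- Functions invariant under permutations of the coordinates (almost everywhere). -/
def Exchangeable (u : Torus d L → ℝ) : Prop :=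
  ∀ ζ : Equiv.Perm (Fin d), ∀ᵐ x : Torus d L, u (x ∘ ζ) = u x

variable (d L) in
/-- Real `L²` functions on the torus. -/
abbrev L2 : Type := Lp ℝ 2 (volume : Measure (Torus d L))

variable (d L) in
/-- `L²_S`: coordinate-wise even `L²` functions. -/
def L2S : Set (L2 d L) := {u | CoordEven (u : Torus d L → ℝ)}

variable (d L) in
/-- `L²_ex`: the exchangeable functions in `L²_S`. -/
def L2ex : Set (L2 d L) :=
  {u | CoordEven (u : Torus d L → ℝ) ∧ Exchangeable (u : Torus d L → ℝ)}

/-- `(W ∗ g)(x) = ∫ W(x-y) g(y) dy`. -/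
def conv (W g : Torus d L → ℝ) (x : Torus d L) : ℝ := ∫ y, W (x - y) * g y

/-- `Θ(k) = ∏ᵢ √(2 - δ_{kᵢ,0})`. -/
def Theta (k : Fin d → ℕ) : ℝ := ∏ i, √(2 - if k i = 0 then 1 else 0)

/-- The basis function
`ω_k(x) = Θ(k) / L^{d/2} ∏ᵢ cos(2π kᵢ xᵢ / L)`; the cosine is the real part of the character
`fourier kᵢ` of the circle, see `re_fourier_coe`. -/
def omega (k : Fin d → ℕ) (x : Torus d L) : ℝ :=
  Theta k / L ^ ((d : ℝ) / 2) * ∏ i, (fourier (k i : ℤ) (x i)).re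

theorem re_fourier_coe {L : ℝ} (n : ℕ) (t : ℝ) :
    (fourier (n : ℤ) (t : AddCircle L)).re = Real.cos (2 * Real.pi * n / L * t) := by
  rw [fourier_coe_apply]
  have : (2 * (Real.pi : ℂ) * Complex.I * ((n : ℤ) : ℂ) * (t : ℂ) / (L : ℂ))
      = ((2 * Real.pi * n / L * t : ℝ) : ℂ) * Complex.I := by
    push_cast; ring
  rw [this, Complex.exp_ofReal_mul_I_re]

/-- The Fourier mode `W̃(k) = ∫ W ω_k`. -/
def mode (W : Torus d L → ℝ) (k : Fin d → ℕ) : ℝ := ∫ x, W x * omega k x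

end Spaces

namespace Model

variable {d : ℕ} {L : ℝ} [Fact (0 < L)] (m : Model d L)

/-- `W₀ = ∫ W`. -/
def W0 : ℝ := ∫ x, m.W x

/-- Mean activity of the density `exp(-κ(s-φ)²/2) / Z` on `s > 0`, where
`Z = L^d ∫ exp(-κ(s-φ)²/2) ds`. -/
def gaussMean (d : ℕ) (L κ φ : ℝ) : ℝ :=
  (∫ s in Set.Ioi (0 : ℝ), s * Real.exp (-κ * (s - φ) ^ 2 / 2)) /
    (L ^ d * ∫ s in Set.Ioi (0 : ℝ), Real.exp (-κ * (s - φ) ^ 2 / 2))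

/-- The functional whose zeros are the activity averages of the stationary states:
`G(r, κ)(x) = r(x) - Z⁻¹ ∫ s exp(-κ(s - Φ(W∗r(x) + B))²/2) ds`. -/
def G (r : Torus d L → ℝ) (κ : ℝ) (x : Torus d L) : ℝ :=
  r x - gaussMean d L κ (m.Φ (conv m.W r x + m.B))

/-- `r` is (almost everywhere) a zero of `G(·, κ)`. -/
def IsZero (r : L2 d L) (κ : ℝ) : Prop :=
  ∀ᵐ x : Torus d L, m.G r κ x = 0

/-- The real number `y` is the activity average of a spatially homogeneous stationary state. -/
def IsHomMean (κ y : ℝ) : Prop := ∀ x : Torus d L, m.G (fun _ => y) κ x = 0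

/-- The activity average `ρ̄_∞^κ` of the spatially homogeneous stationary state. -/
def rhoBar (κ : ℝ) : ℝ := Classical.epsilon fun y => m.IsHomMean κ y

/-- `ρ* = lim_{κ → ∞} ρ̄_∞^κ`. -/
def rhoStar : ℝ := limUnder atTop m.rhoBar

/-- `Φ₀ = Φ(W₀ ρ̄_∞^κ + B)`. -/
def Phi0 (κ : ℝ) : ℝ := m.Φ (m.W0 * m.rhoBar κ + m.B)

/-- `Φ₀' = Φ'(W₀ ρ̄_∞^κ + B)`. -/
def dPhi0 (κ : ℝ) : ℝ := deriv m.Φ (m.W0 * m.rhoBar κ + m.B)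

/-- The bifurcation equation at `κ` for the mode `k`. -/
def BifurcationEq (k : Fin d → ℕ) (κ : ℝ) : Prop :=
  mode m.W k / Theta k =
    1 / (L ^ ((d : ℝ) / 2) * m.dPhi0 κ *
      (1 / L ^ d - L ^ d * m.rhoBar κ * (m.rhoBar κ - m.Phi0 κ / L ^ d) * κ))

/-- The constant function `ρ̄_∞^κ` as an element of `L²`. -/
def homState (κ : ℝ) : L2 d L := Lp.const 2 volume (m.rhoBar κ)

/-- `(ρ̄_∞^κ₀, κ₀)` is a bifurcation point of `G = 0` in the space `X`: it is the intersection of the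
homogeneous branch with a `C¹` curve of solutions in `X` that are not homogeneous away from this
point, and these two curves contain all the solutions in `X × (0, ∞)` close to it. -/
def IsBifurcationPoint (X : Set (L2 d L)) (κ₀ : ℝ) : Prop :=
  0 < κ₀ ∧
  ∃ δ > 0, ∃ r : ℝ → L2 d L, ∃ k : ℝ → ℝ,
    ContDiffOn ℝ 1 r (Set.Ioo (-δ) δ) ∧ ContDiffOn ℝ 1 k (Set.Ioo (-δ) δ) ∧
    r 0 = m.homState κ₀ ∧ k 0 = κ₀ ∧
    (∀ z ∈ Set.Ioo (-δ) δ, r z ∈ X ∧ 0 < k z ∧ m.IsZero (r z) (k z)) ∧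
    (∀ z ∈ Set.Ioo (-δ) δ, z ≠ 0 → ∀ c : ℝ, r z ≠ Lp.const 2 volume c) ∧
    ∃ ε > 0, ∀ q ∈ X, ∀ κ > 0, ‖q - m.homState κ₀‖ < ε → |κ - κ₀| < ε → m.IsZero q κ →
      q = m.homState κ ∨ ∃ z ∈ Set.Ioo (-δ) δ, q = r z ∧ κ = k z

/-- No solution in `X` branches off the homogeneous branch at `κ₀`: all solutions in
`X × (0, ∞)` close to `(ρ̄_∞^κ₀, κ₀)` are homogeneous. -/
def IsLocallyHomogeneous (X : Set (L2 d L)) (κ₀ : ℝ) : Prop :=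
  ∃ ε > 0, ∀ q ∈ X, ∀ κ > 0, ‖q - m.homState κ₀‖ < ε → |κ - κ₀| < ε → m.IsZero q κ →
    q = m.homState κ

/-! ### Linear stability of the homogeneous stationary state -/

/-- The homogeneous stationary density `ρ_∞^κ(s) = exp(-κ(s-Φ₀)²/2) / Z`. -/
def rhoInf (κ s : ℝ) : ℝ :=
  Real.exp (-κ * (s - m.Phi0 κ) ^ 2 / 2) /
    (L ^ d * ∫ s' in Set.Ioi (0 : ℝ), Real.exp (-κ * (s' - m.Phi0 κ) ^ 2 / 2))

variable (d L) in
/-- Lebesgue measure on `(torus) × (0, ∞)`. -/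
def phaseMeasure : Measure (Torus d L × ℝ) :=
  (volume : Measure (Torus d L × ℝ)).restrict (Set.univ ×ˢ Set.Ioi 0)

/-- The measure `ρ_∞^κ(s)⁻¹ dx ds` on `(torus) × (0, ∞)`. -/
def weightMeasure (κ : ℝ) : Measure (Torus d L × ℝ) :=
  (phaseMeasure d L).withDensity fun p => ENNReal.ofReal (m.rhoInf κ p.2)⁻¹

/-- The Hilbert space of perturbations `u` with `∬ u² / ρ_∞^κ dx ds < ∞`. As `ρ_∞^κ` is bounded, its
norm controls that of `L²((torus) × (0, ∞))`. -/
abbrev Pert (κ : ℝ) : Type := Lp ℝ 2 (m.weightMeasure κ)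

/-- `ū(x) = ∫ s u(x,s) ds`. -/
def activity (u : Torus d L × ℝ → ℝ) (x : Torus d L) : ℝ :=
  ∫ s in Set.Ioi (0 : ℝ), s * u (x, s)

/-- `p` is the weak derivative `∂ₛu` on `(torus) × (0, ∞)`. -/
def IsWeakDeriv (u p : Torus d L × ℝ → ℝ) : Prop :=
  ∀ χ : C(Torus d L, ℝ), ∀ η : ℝ → ℝ, ContDiff ℝ (⊤ : ℕ∞) η → HasCompactSupport η →
    tsupport η ⊆ Set.Ioi 0 →
    ∫ q, u q * (χ q.1 * deriv η q.2) ∂(phaseMeasure d L) =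
      -∫ q, p q * (χ q.1 * η q.2) ∂(phaseMeasure d L)

/-- The linearisation at `ρ_∞^κ` of the flux `(Φ(W∗ρ̄ + B) - s) ρ - σ ∂ₛρ`, `σ = 1/κ`, in the
direction `u`, with `p = ∂ₛu`: `(Φ₀ - s) u + Φ₀' (W∗ū) ρ_∞^κ - σ p`. -/
def linFlux (κ : ℝ) (u p : Torus d L × ℝ → ℝ) (q : Torus d L × ℝ) : ℝ :=
  (m.Phi0 κ - q.2) * u q + m.dPhi0 κ * conv m.W (activity u) q.1 * m.rhoInf κ q.2 - 1 / κ * p q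

/-- `u` is in the domain of the linearised operator and is mapped to `f`, that is
`τ f = -∂ₛ J` with `J` the linearised flux of `u` and with the no-flux condition `J = 0` at `s = 0`.
The equation and the boundary condition are both contained in the weak form, whose test functions
need not vanish at `s = 0`. -/
def IsLinearImage (κ : ℝ) (u f : Torus d L × ℝ → ℝ) : Prop :=
  ∃ p : Torus d L × ℝ → ℝ, IsWeakDeriv u p ∧
    MemLp (m.linFlux κ u p) 2 (m.weightMeasure κ) ∧
    ∀ χ : C(Torus d L, ℝ), ∀ η : ℝ → ℝ, ContDiff ℝ (⊤ : ℕ∞) η → HasCompactSupport η →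
      m.τ * ∫ q, f q * (χ q.1 * η q.2) ∂(phaseMeasure d L) =
        ∫ q, m.linFlux κ u p q * (χ q.1 * deriv η q.2) ∂(phaseMeasure d L)

/-- `u` solves the linearised evolution equation on `[0, ∞)`. The perturbations have zero mass at
each `x` since all densities satisfy `∫ ρ(x,s,t) ds = 1 / L^d`. -/
structure IsLinearSolution (κ : ℝ) (u : ℝ → m.Pert κ) : Prop where
  continuousOn : ContinuousOn u (Set.Ici 0)
  mass_zero : ∀ t ≥ 0, ∀ᵐ x : Torus d L, ∫ s in Set.Ioi (0 : ℝ), u t (x, s) = 0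
  evolution : ∀ t > 0, ∃ f : m.Pert κ, HasDerivAt u f t ∧ m.IsLinearImage κ (u t) f

/-- Linear asymptotic stability of `ρ_∞^κ`: solutions of the linearised equation are bounded in terms
of their initial value, and tend to zero. -/
def IsLinearlyAsymptoticallyStable (κ : ℝ) : Prop :=
  (∃ C : ℝ, ∀ u : ℝ → m.Pert κ, m.IsLinearSolution κ u → ∀ t ≥ 0, ‖u t‖ ≤ C * ‖u 0‖) ∧
  ∀ u : ℝ → m.Pert κ, m.IsLinearSolution κ u → Tendsto u atTop (𝓝 0)

end Model

end NeuralField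

end

/-! Everything is governed by one scalar function. Write `θ = log κ`, and let `response (θ, u)` be
the mean of the truncated Gaussian under the synaptic input `u`. A constant zero solves `y =
response (θ, W₀ y)`; the response is nondecreasing in `u` and `W₀ < 0`, so there is exactly one, and
it is `C¹` in `θ` by the implicit function theorem. The linearisation of the zero problem on this
branch is `1 - gain θ · (W∗)`, where `gain` is `∂_u response` along the branch. Since `W` is even in
each coordinate, `W∗` multiplies the mode of frequency `n` by the real number `eigen W |n| = L^{d/2}
W̃/Θ`. The bifurcation equation is therefore `gain θ · μ = 1`, with `μ = eigen W k*` the largest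
eigenvalue.

Monotonicity of the gain. Up to the factor `L^{-d}`, the gain is `Φ'` times the variance of a unit
Gaussian centred at `√κ Φ` and conditioned to be positive. As `κ` grows the homogeneous activity
falls (`deriv_branch_neg`), the inhibition weakens, and `Φ'`, `Φ` and `√κ` do not decrease; the
truncated variance increases with the centre because of `truncSkew_pos`. So the gain is
nondecreasing, and strictly increasing wherever it is positive. It vanishes for strong noise and
tends to `Φ'(W₀ρ* + B)/L^d`. This yields a unique `κ*`, with `gain · μ < 1` before it.

Bifurcation. Put `r = ρ̄ + z w` with `⟨w, e⟩ = 1`, where `e` is the normalised top eigenvector, and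
divide by the amplitude `z`. The new equation `w = F(z, w, θ)` is `C¹`, because `W∗` maps `L²` into
continuous functions, on which superposition operators are smooth; at `z = 0` it reads `w = gain θ ·
W∗w`. The implicit function theorem solves for `(w, θ)`: the derivative is invertible since `μ` is
simple in the symmetric space, the rest of the spectrum lies below a gap, and `gain' ≠ 0`.
Conversely, a small zero almost solves the linear equation, so its part orthogonal to `e` is
relatively small; it is either trivial or, once rescaled, close to `e`, hence on the curve. Below
`κ*` the linearisation is coercive and only the trivial solution remains.

Stability. Pairing a perturbation with a Fourier mode of eigenvalue `λ` gives a function `v(s)` that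
solves a one-dimensional Fokker–Planck equation with a rank-one term. The energy `‖v‖² - κ Φ₀' λ (∫
s v)²` has derivative `-(2κ/τ)‖J‖²`. Cauchy–Schwarz against the variance bounds the energy below by
`(1 - gain · μ)‖v‖²`, and Hardy's inequality bounds its square by a constant times `‖v‖²‖J‖²`;
exponential decay follows with constants that do not depend on the mode, and Parseval sums the
modes. At `κ*` the profile `(s - M) ρ_∞(s) ω_{k*}(x)`, with `M` the mean, has zero flux and is a
stationary solution, so stability fails there. -/

noncomputable section

namespace NeuralField

/-! ### The Gaussian distribution function and the truncated Gaussian -/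

/-- `∫_{-∞}^z exp(-t²/2) dt`. -/
def gaussCdf (z : ℝ) : ℝ := ∫ t in Set.Iic z, Real.exp (-t ^ 2 / 2)

theorem integrable_exp_neg_sq_half : Integrable fun t : ℝ => Real.exp (-t ^ 2 / 2) := by
  refine (integrable_exp_neg_mul_sq (b := 1 / 2) (by norm_num)).congr (ae_of_all _ fun t => ?_)
  simp only; congr 1; ring

theorem hasDerivAt_gaussCdf (z : ℝ) : HasDerivAt gaussCdf (Real.exp (-z ^ 2 / 2)) z := by
  have hI : ∀ x, IntegrableOn (fun t : ℝ => Real.exp (-t ^ 2 / 2)) (Set.Iic x) :=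
    fun x => integrable_exp_neg_sq_half.integrableOn
  have h1 : gaussCdf = fun x => gaussCdf 0 + ∫ t in (0 : ℝ)..x, Real.exp (-t ^ 2 / 2) := by
    funext x
    rw [← intervalIntegral.integral_Iic_sub_Iic (hI 0) (hI x)]
    simp [gaussCdf]
  rw [h1]
  have hc : Continuous fun t : ℝ => Real.exp (-t ^ 2 / 2) := by fun_prop
  exact (hc.integral_hasStrictDerivAt 0 z).hasDerivAt.const_add _

theorem gaussCdf_pos (z : ℝ) : 0 < gaussCdf z := by
  unfold gaussCdf
  rw [integral_pos_iff_support_of_nonneg (fun t => (Real.exp_pos _).le)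
    integrable_exp_neg_sq_half.integrableOn]
  have : Function.support (fun t : ℝ => Real.exp (-t ^ 2 / 2)) = Set.univ := by
    ext t; simp [(Real.exp_pos _).ne']
  rw [this]; simp

theorem tendsto_gaussCdf_atBot : Tendsto gaussCdf atBot (𝓝 0) := by
  have h := integrable_exp_neg_sq_half
  have h2 : ∀ x, gaussCdf x = gaussCdf 0 - ∫ t in x..0, Real.exp (-t ^ 2 / 2) := by
    intro x
    rw [← intervalIntegral.integral_Iic_sub_Iic h.integrableOn h.integrableOn]
    simp [gaussCdf]
  have h3 := (intervalIntegral_tendsto_integral_Iic (0 : ℝ) h.integrableOn tendsto_id).const_sub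
    (gaussCdf 0)
  refine (h3.congr fun x => (h2 x).symm).trans ?_
  simp [gaussCdf]

theorem contDiff_gaussCdf {n : WithTop ℕ∞} (hn : n ≤ (⊤ : ℕ∞)) : ContDiff ℝ n gaussCdf := by
  have h : ContDiff ℝ (⊤ : ℕ∞) gaussCdf := by
    rw [contDiff_infty_iff_deriv]
    refine ⟨fun z => (hasDerivAt_gaussCdf z).differentiableAt, ?_⟩
    have : deriv gaussCdf = fun z => Real.exp (-z ^ 2 / 2) :=
      funext fun z => (hasDerivAt_gaussCdf z).deriv
    rw [this]; fun_prop
  exact h.of_le hn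

section Moments

variable {κ : ℝ} (hκ : 0 < κ) (φ : ℝ)

/-- The unnormalised Gaussian weight `exp(-κ(s-φ)²/2)`. -/
def gaussWeight (κ φ s : ℝ) : ℝ := Real.exp (-κ * (s - φ) ^ 2 / 2)

theorem gaussWeight_pos (κ φ s : ℝ) : 0 < gaussWeight κ φ s := Real.exp_pos _

theorem hasDerivAt_gaussWeight (κ φ s : ℝ) :
    HasDerivAt (gaussWeight κ φ) (-κ * (s - φ) * gaussWeight κ φ s) s := by
  have h : HasDerivAt (fun s : ℝ => -κ * (s - φ) ^ 2 / 2) (-κ * (s - φ)) s := by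
    have := ((((hasDerivAt_id s).sub_const φ).pow 2).const_mul (-κ)).div_const 2
    refine HasDerivAt.congr_deriv this ?_
    simp; ring
  have := h.exp
  unfold gaussWeight
  refine HasDerivAt.congr_deriv this ?_; ring

include hκ in
theorem tendsto_gaussWeight : Tendsto (gaussWeight κ φ) atTop (𝓝 0) := by
  unfold gaussWeight
  refine Real.tendsto_exp_atBot.comp ?_
  have h1 : Tendsto (fun s : ℝ => (s - φ) ^ 2) atTop atTop :=
    (tendsto_pow_atTop two_ne_zero).comp (tendsto_atTop_add_const_right _ (-φ) tendsto_id)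
  have := h1.const_mul_atTop_of_neg (show -κ / 2 < 0 by linarith)
  refine this.congr fun s => by ring

include hκ in
theorem tendsto_mul_gaussWeight : Tendsto (fun s => s * gaussWeight κ φ s) atTop (𝓝 0) := by
  have h1 : Tendsto (fun t : ℝ => t * Real.exp (-(κ / 2) * t)) atTop (𝓝 0) := by
    have := Real.tendsto_pow_mul_exp_neg_atTop_nhds_zero 1
    have h2 := (this.comp ((tendsto_id (α := ℝ)).const_mul_atTop
      (show 0 < κ / 2 by linarith))).const_mul (2 / κ)
    rw [mul_zero] at h2
    refine h2.congr fun t => ?_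
    simp only [Function.comp, id, pow_one, neg_mul]
    field_simp
  have h3 : Tendsto (fun t : ℝ => t * Real.exp (-κ * t ^ 2 / 2)) atTop (𝓝 0) := by
    refine squeeze_zero' ?_ ?_ h1
    · filter_upwards [eventually_ge_atTop 0] with t ht using mul_nonneg ht (Real.exp_pos _).le
    · filter_upwards [eventually_ge_atTop 1] with t ht
      refine mul_le_mul_of_nonneg_left (Real.exp_le_exp.2 ?_) (by linarith)
      nlinarith [mul_nonneg hκ.le (mul_nonneg (by linarith : (0:ℝ) ≤ t) (sub_nonneg.2 ht))]
  have h4 := h3.comp (tendsto_atTop_add_const_right _ (-φ) (tendsto_id (α := ℝ)))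
  have h5 := h4.add ((tendsto_gaussWeight hκ φ).const_mul φ)
  rw [mul_zero, add_zero] at h5
  refine h5.congr fun s => ?_
  simp only [Function.comp, id, gaussWeight, ← sub_eq_add_neg]
  ring

/-- Antiderivative of the Gaussian weight vanishing at infinity. -/
def gaussPrim (κ φ s : ℝ) : ℝ := -(gaussCdf (√κ * (φ - s)) / √κ)

include hκ in
theorem hasDerivAt_gaussPrim (s : ℝ) :
    HasDerivAt (gaussPrim κ φ) (gaussWeight κ φ s) s := by
  have h0 : HasDerivAt (fun s : ℝ => √κ * (φ - s)) (-√κ) s := by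
    simpa using ((hasDerivAt_id s).const_sub φ).const_mul (√κ)
  have h1 := (((hasDerivAt_gaussCdf (√κ * (φ - s))).comp s h0).div_const (√κ)).neg
  have hs : √κ ≠ 0 := (Real.sqrt_pos.2 hκ).ne'
  refine HasDerivAt.congr_deriv h1 ?_
  rw [mul_neg, neg_div, neg_neg, mul_div_assoc, div_self hs, mul_one, gaussWeight, mul_pow,
    Real.sq_sqrt hκ.le]
  congr 1; ring

include hκ in
theorem tendsto_gaussPrim : Tendsto (gaussPrim κ φ) atTop (𝓝 0) := by
  have hs : 0 < √κ := Real.sqrt_pos.2 hκ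
  have h1 : Tendsto (fun s : ℝ => √κ * (φ - s)) atTop atBot :=
    (tendsto_atBot_add_const_left _ φ tendsto_neg_atTop_atBot).const_mul_atBot hs
  have := ((tendsto_gaussCdf_atBot.comp h1).div_const (√κ)).neg
  rw [neg_zero.symm, ← zero_div (√κ)]
  exact this

/-- The zeroth moment of the Gaussian weight on the half line. -/
def moment0 (κ φ : ℝ) : ℝ := gaussCdf (√κ * φ) / √κ

/-- The first moment of the Gaussian weight on the half line. -/
def moment1 (κ φ : ℝ) : ℝ := gaussWeight κ φ 0 / κ + φ * moment0 κ φ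

/-- The second moment of the Gaussian weight on the half line. -/
def moment2 (κ φ : ℝ) : ℝ := moment0 κ φ / κ + φ * moment1 κ φ

include hκ in
theorem moment0_pos : 0 < moment0 κ φ :=
  div_pos (gaussCdf_pos _) (Real.sqrt_pos.2 hκ)

include hκ in
theorem integrableOn_gaussWeight : IntegrableOn (gaussWeight κ φ) (Set.Ioi 0) :=
  integrableOn_Ioi_deriv_of_nonneg' (fun s _ => hasDerivAt_gaussPrim hκ φ s)
    (fun _ _ => (gaussWeight_pos _ _ _).le) (tendsto_gaussPrim hκ φ)

include hκ in
theorem integral_gaussWeight : ∫ s in Set.Ioi (0 : ℝ), gaussWeight κ φ s = moment0 κ φ := by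
  rw [integral_Ioi_of_hasDerivAt_of_tendsto' (fun s _ => hasDerivAt_gaussPrim hκ φ s)
    (integrableOn_gaussWeight hκ φ) (tendsto_gaussPrim hκ φ)]
  simp [gaussPrim, moment0]

/-- The weight satisfies `w' = -κ(s - φ)w`, hence `s w = -(w/κ)' + φ w`. Primitives of successive
moments are built from each other in this way, and their values at `0` give the recursions that
define `moment1` and `moment2`. -/
theorem hasDerivAt_gaussPrim1 (hκ : 0 < κ) (s : ℝ) :
    HasDerivAt (fun s => -(gaussWeight κ φ s / κ) + φ * gaussPrim κ φ s)
      (s * gaussWeight κ φ s) s := by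
  have := (((hasDerivAt_gaussWeight κ φ s).div_const κ).neg).add
    ((hasDerivAt_gaussPrim hκ φ s).const_mul φ)
  refine HasDerivAt.congr_deriv this ?_
  field_simp; ring

theorem tendsto_gaussPrim1 (hκ : 0 < κ) :
    Tendsto (fun s => -(gaussWeight κ φ s / κ) + φ * gaussPrim κ φ s) atTop (𝓝 0) := by
  simpa using ((tendsto_gaussWeight hκ φ).div_const κ).neg.add
    ((tendsto_gaussPrim hκ φ).const_mul φ)

include hκ in
theorem integrableOn_mul_gaussWeight :
    IntegrableOn (fun s => s * gaussWeight κ φ s) (Set.Ioi 0) :=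
  integrableOn_Ioi_deriv_of_nonneg' (fun s _ => hasDerivAt_gaussPrim1 φ hκ s)
    (fun _ hs => mul_nonneg (le_of_lt hs) (gaussWeight_pos _ _ _).le) (tendsto_gaussPrim1 φ hκ)

include hκ in
theorem integral_mul_gaussWeight :
    ∫ s in Set.Ioi (0 : ℝ), s * gaussWeight κ φ s = moment1 κ φ := by
  rw [integral_Ioi_of_hasDerivAt_of_tendsto' (fun s _ => hasDerivAt_gaussPrim1 φ hκ s)
    (integrableOn_mul_gaussWeight hκ φ) (tendsto_gaussPrim1 φ hκ)]
  simp [gaussPrim, moment0, moment1]; ring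

theorem hasDerivAt_gaussPrim2 (hκ : 0 < κ) (s : ℝ) :
    HasDerivAt (fun s => -(s * gaussWeight κ φ s / κ) + gaussPrim κ φ s / κ +
      φ * (-(gaussWeight κ φ s / κ) + φ * gaussPrim κ φ s))
      (s ^ 2 * gaussWeight κ φ s) s := by
  have := (((((hasDerivAt_id s).mul (hasDerivAt_gaussWeight κ φ s)).div_const κ).neg).add
    ((hasDerivAt_gaussPrim hκ φ s).div_const κ)).add
    ((hasDerivAt_gaussPrim1 φ hκ s).const_mul φ)
  refine HasDerivAt.congr_deriv this ?_
  simp; field_simp; ring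

theorem tendsto_gaussPrim2 (hκ : 0 < κ) :
    Tendsto (fun s => -(s * gaussWeight κ φ s / κ) + gaussPrim κ φ s / κ +
      φ * (-(gaussWeight κ φ s / κ) + φ * gaussPrim κ φ s)) atTop (𝓝 0) := by
  simpa using (((tendsto_mul_gaussWeight hκ φ).div_const κ).neg.add
    ((tendsto_gaussPrim hκ φ).div_const κ)).add ((tendsto_gaussPrim1 φ hκ).const_mul φ)

include hκ in
theorem integrableOn_sq_mul_gaussWeight :
    IntegrableOn (fun s => s ^ 2 * gaussWeight κ φ s) (Set.Ioi 0) :=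
  integrableOn_Ioi_deriv_of_nonneg' (fun s _ => hasDerivAt_gaussPrim2 φ hκ s)
    (fun s _ => mul_nonneg (sq_nonneg s) (gaussWeight_pos _ _ _).le) (tendsto_gaussPrim2 φ hκ)

include hκ in
theorem integral_sq_mul_gaussWeight :
    ∫ s in Set.Ioi (0 : ℝ), s ^ 2 * gaussWeight κ φ s = moment2 κ φ := by
  rw [integral_Ioi_of_hasDerivAt_of_tendsto' (fun s _ => hasDerivAt_gaussPrim2 φ hκ s)
    (integrableOn_sq_mul_gaussWeight hκ φ) (tendsto_gaussPrim2 φ hκ)]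
  simp [gaussPrim, moment0, moment1, moment2]; ring

end Moments

/-! ### The mean of the standard Gaussian truncated to the half line -/

/-- The inverse Mills ratio. -/
def mills (z : ℝ) : ℝ := Real.exp (-z ^ 2 / 2) / gaussCdf z

/-- The mean of `N(z, 1)` conditioned to be positive. -/
def truncMean (z : ℝ) : ℝ := z + mills z

/-- The variance of `N(z, 1)` conditioned to be positive. -/
def truncVar (z : ℝ) : ℝ := 1 - truncMean z * (truncMean z - z)

theorem mills_pos (z : ℝ) : 0 < mills z := div_pos (Real.exp_pos _) (gaussCdf_pos z)

theorem hasDerivAt_exp_neg_sq_half (z : ℝ) :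
    HasDerivAt (fun z : ℝ => Real.exp (-z ^ 2 / 2)) (-z * Real.exp (-z ^ 2 / 2)) z := by
  have h : HasDerivAt (fun z : ℝ => -z ^ 2 / 2) (-z) z := by
    refine HasDerivAt.congr_deriv ((((hasDerivAt_id z).pow 2).neg).div_const 2) ?_
    simp; ring
  refine h.exp.congr_deriv ?_; ring

theorem hasDerivAt_mills (z : ℝ) : HasDerivAt mills (-(truncMean z * mills z)) z := by
  have h := (hasDerivAt_exp_neg_sq_half z).div (hasDerivAt_gaussCdf z) (gaussCdf_pos z).ne'
  have hz := (gaussCdf_pos z).ne'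
  refine HasDerivAt.congr_deriv h ?_
  simp only [truncMean, mills]
  field_simp; ring

/-- The conditioned Gaussians form an exponential family with parameter `z`, so the derivative of
the mean is the variance. -/
theorem hasDerivAt_truncMean (z : ℝ) : HasDerivAt truncMean (truncVar z) z := by
  have h := (hasDerivAt_id z).add (hasDerivAt_mills z)
  refine HasDerivAt.congr_deriv h ?_
  simp [truncVar, truncMean]; ring

theorem contDiff_truncMean {n : WithTop ℕ∞} (hn : n ≤ (⊤ : ℕ∞)) : ContDiff ℝ n truncMean := by
  have h1 : ContDiff ℝ n fun z : ℝ => Real.exp (-z ^ 2 / 2) := by fun_prop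
  exact contDiff_id.add (h1.div (contDiff_gaussCdf hn) fun z => (gaussCdf_pos z).ne')

/-- Up to a positive factor, the derivative of `truncVar`. -/
def truncSkew (z : ℝ) : ℝ := 2 * truncMean z ^ 2 - truncMean z * z - 1

theorem hasDerivAt_truncVar (z : ℝ) : HasDerivAt truncVar (mills z * truncSkew z) z := by
  have hm := hasDerivAt_truncMean z
  have h := (hm.mul (hm.sub (hasDerivAt_id z))).const_sub 1
  refine HasDerivAt.congr_deriv h ?_
  simp only [truncSkew, truncVar, truncMean, id, Pi.sub_apply]; ring

/-- The derivative is arranged as a linear equation for `truncSkew` with source `2 truncMean³`, so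
that an integrating factor decides the sign. -/
theorem hasDerivAt_truncSkew (z : ℝ) : HasDerivAt truncSkew
    (2 * truncMean z ^ 3 - (3 * truncMean z - z) * truncSkew z) z := by
  have hm := hasDerivAt_truncMean z
  have h := (((hm.pow 2).const_mul 2).sub (hm.mul (hasDerivAt_id z))).sub_const 1
  refine HasDerivAt.congr_deriv h ?_
  simp [truncVar, truncSkew]; ring

theorem gaussCdf_zero : gaussCdf 0 = √(2 * Real.pi) / 2 := by
  have h := integral_gaussian_Ioi (1 / 2)
  have h2 : ∫ t in Set.Iic (0 : ℝ), Real.exp (-t ^ 2 / 2) =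
      ∫ t in Set.Ioi (0 : ℝ), Real.exp (-(1 / 2) * t ^ 2) := by
    have := integral_comp_neg_Ioi (0 : ℝ) (fun t : ℝ => Real.exp (-t ^ 2 / 2))
    rw [neg_zero] at this
    rw [← this]
    congr 1; funext t; congr 1; ring
  rw [gaussCdf, h2, h]
  congr 2; ring

theorem truncMean_pos_of_nonneg {z : ℝ} (hz : 0 ≤ z) : 0 < truncMean z :=
  add_pos_of_nonneg_of_pos hz (mills_pos z)

theorem truncSkew_zero_pos : 0 < truncSkew 0 := by
  have h : truncMean 0 ^ 2 = 2 / Real.pi := by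
    simp only [truncMean, mills, gaussCdf_zero]
    have hp := Real.pi_pos
    rw [zero_add, div_pow, div_pow, Real.sq_sqrt (by positivity)]
    simp
    field_simp
  rw [truncSkew, h]
  have := Real.pi_lt_four
  have hp := Real.pi_pos
  have : 1 < 4 / Real.pi := by rw [lt_div_iff₀ hp]; linarith
  ring_nf at this ⊢
  linarith

/-- The logarithmic derivative of `gaussCdf³ · exp(z²)` is `3 mills + 2z = 3 truncMean - z`, so this
product is an integrating factor for the equation of `hasDerivAt_truncSkew`. On `z ≥ 0` the
remaining source is positive, and at `0` the value is `4/π - 1 > 0`. -/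
theorem truncSkew_pos {z : ℝ} (hz : 0 ≤ z) : 0 < truncSkew z := by
  have hE : ∀ z : ℝ, HasDerivAt (fun z : ℝ => Real.exp (z ^ 2)) (2 * z * Real.exp (z ^ 2)) z := by
    intro z
    refine ((hasDerivAt_id z).pow 2).exp.congr_deriv ?_
    simp; ring
  have hd : ∀ z, HasDerivAt (fun z => gaussCdf z ^ 3 * Real.exp (z ^ 2) * truncSkew z)
      (gaussCdf z ^ 3 * Real.exp (z ^ 2) * (2 * truncMean z ^ 3)) z := by
    intro z
    have h := (((hasDerivAt_gaussCdf z).pow 3).mul (hE z)).mul (hasDerivAt_truncSkew z)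
    refine HasDerivAt.congr_deriv h ?_
    have hz : Real.exp (-z ^ 2 / 2) = gaussCdf z * mills z := by
      rw [mills]; field_simp [(gaussCdf_pos z).ne']
    simp only [hz]
    simp only [truncMean, Pi.mul_apply, Pi.pow_apply]
    push_cast
    ring
  have hmono : MonotoneOn (fun z => gaussCdf z ^ 3 * Real.exp (z ^ 2) * truncSkew z)
      (Set.Ici 0) := by
    refine monotoneOn_of_deriv_nonneg (convex_Ici 0)
      (fun z _ => (hd z).continuousAt.continuousWithinAt)
      (fun z _ => (hd z).differentiableAt.differentiableWithinAt) fun z hz => ?_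
    rw [interior_Ici] at hz
    rw [(hd z).deriv]
    have h1 := gaussCdf_pos z
    have h2 := truncMean_pos_of_nonneg (le_of_lt hz)
    positivity
  have h0 := hmono (Set.mem_Ici.2 le_rfl) (Set.mem_Ici.2 hz) hz
  have h1 : 0 < gaussCdf 0 ^ 3 * Real.exp (0 ^ 2) * truncSkew 0 := by
    have := gaussCdf_pos 0
    have := truncSkew_zero_pos
    positivity
  have h2 := lt_of_lt_of_le h1 h0
  have h3 : 0 < gaussCdf z ^ 3 * Real.exp (z ^ 2) := by
    have := gaussCdf_pos z
    positivity
  exact pos_of_mul_pos_right h2 h3.le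

theorem truncVar_strictMonoOn : StrictMonoOn truncVar (Set.Ici 0) := by
  refine strictMonoOn_of_deriv_pos (convex_Ici 0)
    (fun z _ => (hasDerivAt_truncVar z).continuousAt.continuousWithinAt) fun z hz => ?_
  rw [interior_Ici] at hz
  rw [(hasDerivAt_truncVar z).deriv]
  exact mul_pos (mills_pos z) (truncSkew_pos (le_of_lt hz))

theorem truncVar_pos_of_nonneg {z : ℝ} (hz : 0 ≤ z) : 0 < truncVar z := by
  have h0 : 0 < truncVar 0 := by
    have h : truncMean 0 ^ 2 = 2 / Real.pi := by
      simp only [truncMean, mills, gaussCdf_zero]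
      have hp := Real.pi_pos
      rw [zero_add, div_pow, div_pow, Real.sq_sqrt (by positivity)]
      simp
      field_simp
    have h3 := Real.pi_gt_three
    have : 2 / Real.pi < 1 := by rw [div_lt_one (by positivity)]; linarith
    rw [truncVar, sub_zero, ← sq, h]; linarith
  exact h0.trans_le (truncVar_strictMonoOn.monotoneOn (Set.mem_Ici.2 le_rfl) hz hz)

theorem truncVar_le_one {z : ℝ} (hz : 0 ≤ z) : truncVar z ≤ 1 := by
  have h1 := truncMean_pos_of_nonneg hz
  have h2 := mills_pos z
  have : truncVar z = 1 - truncMean z * mills z := by simp [truncVar, truncMean]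
  rw [this]; nlinarith

theorem mills_le {z : ℝ} (hz : 0 ≤ z) : mills z ≤ mills 0 := by
  have : AntitoneOn mills (Set.Ici 0) := by
    refine antitoneOn_of_deriv_nonpos (convex_Ici 0)
      (fun z _ => (hasDerivAt_mills z).continuousAt.continuousWithinAt)
      (fun z _ => (hasDerivAt_mills z).differentiableAt.differentiableWithinAt) fun z hz => ?_
    rw [interior_Ici] at hz
    rw [(hasDerivAt_mills z).deriv]
    have h1 := truncMean_pos_of_nonneg (le_of_lt hz)
    have h2 := mills_pos z
    have := mul_pos h1 h2
    linarith
  exact this (Set.mem_Ici.2 le_rfl) hz hz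

/-- Since `gaussCdf` is bounded below on `z ≥ 0`, `mills` inherits Gaussian decay there; hence both
correction terms in `truncVar = 1 - z mills - mills²` vanish in the limit. -/
theorem tendsto_truncVar_atTop : Tendsto truncVar atTop (𝓝 1) := by
  have hs : Tendsto (fun z : ℝ => Real.exp (-z ^ 2 / 2)) atTop (𝓝 0) := by
    refine (tendsto_gaussWeight one_pos 0).congr fun z => ?_
    simp [gaussWeight]
  have hs1 : Tendsto (fun z : ℝ => z * Real.exp (-z ^ 2 / 2)) atTop (𝓝 0) := by
    refine (tendsto_mul_gaussWeight one_pos 0).congr fun z => ?_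
    simp [gaussWeight]
  have hmono : Monotone gaussCdf := monotone_of_deriv_nonneg
    (fun z => (hasDerivAt_gaussCdf z).differentiableAt)
    fun z => by rw [(hasDerivAt_gaussCdf z).deriv]; positivity
  have h0 := gaussCdf_pos 0
  have key : ∀ z : ℝ, 0 ≤ z → mills z ≤ Real.exp (-z ^ 2 / 2) / gaussCdf 0 := fun z hz =>
    div_le_div_of_nonneg_left (Real.exp_pos _).le h0 (hmono hz)
  have h1 : Tendsto mills atTop (𝓝 0) := by
    refine squeeze_zero' (Eventually.of_forall fun z => (mills_pos z).le) ?_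
      (by simpa using hs.div_const (gaussCdf 0))
    filter_upwards [eventually_ge_atTop 0] with z hz using key z hz
  have h2 : Tendsto (fun z => z * mills z) atTop (𝓝 0) := by
    refine squeeze_zero' ?_ ?_ (by simpa using hs1.div_const (gaussCdf 0))
    · filter_upwards [eventually_ge_atTop 0] with z hz using mul_nonneg hz (mills_pos z).le
    · filter_upwards [eventually_ge_atTop 0] with z hz
      rw [mul_div_assoc]
      exact mul_le_mul_of_nonneg_left (key z hz) hz
  have h3 := (h2.add (h1.mul h1)).const_sub 1
  simp only [mul_zero, add_zero, sub_zero] at h3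
  refine h3.congr fun z => ?_
  simp only [truncVar, truncMean]; ring

theorem truncMean_monotoneOn : MonotoneOn truncMean (Set.Ici 0) := by
  refine monotoneOn_of_deriv_nonneg (convex_Ici 0)
    (fun z _ => (hasDerivAt_truncMean z).continuousAt.continuousWithinAt)
    (fun z _ => (hasDerivAt_truncMean z).differentiableAt.differentiableWithinAt) fun z hz => ?_
  rw [interior_Ici] at hz
  rw [(hasDerivAt_truncMean z).deriv]
  exact (truncVar_pos_of_nonneg (le_of_lt hz)).le

/-- Rescaling `s` by `√κ` turns the weight into a unit-variance Gaussian centred at `√κ φ`. -/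
theorem moment1_div_moment0 {κ : ℝ} (hκ : 0 < κ) (φ : ℝ) :
    moment1 κ φ / moment0 κ φ = truncMean (√κ * φ) / √κ := by
  have hs : 0 < √κ := Real.sqrt_pos.2 hκ
  have h0 := gaussCdf_pos (√κ * φ)
  have hw : gaussWeight κ φ 0 = Real.exp (-(√κ * φ) ^ 2 / 2) := by
    rw [gaussWeight, mul_pow, Real.sq_sqrt hκ.le]; congr 1; ring
  rw [moment1, hw, moment0, truncMean, mills]
  have hk : κ = √κ * √κ := (Real.mul_self_sqrt hκ.le).symm
  rw [div_eq_iff (by positivity)]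
  conv_lhs => rw [hk]
  rw [Real.sqrt_mul_self (Real.sqrt_nonneg κ)]
  field_simp
  ring

theorem gaussMean_eq {κ : ℝ} (hκ : 0 < κ) (d : ℕ) (L φ : ℝ) :
    Model.gaussMean d L κ φ = truncMean (√κ * φ) / √κ / L ^ d := by
  rw [← moment1_div_moment0 hκ φ]
  unfold Model.gaussMean
  have h0 := integral_gaussWeight hκ φ
  have h1 := integral_mul_gaussWeight hκ φ
  unfold gaussWeight at h0 h1
  rw [h0, h1, div_div, mul_comm]

end NeuralField

/-! ### The homogeneous branch and the monotonicity of its gain. -/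

namespace NeuralField

theorem _root_.ContinuousLinearMap.IsInvertible.of_bijective {E F : Type*}
    [NormedAddCommGroup E] [NormedSpace ℝ E] [CompleteSpace E]
    [NormedAddCommGroup F] [NormedSpace ℝ F] [CompleteSpace F] (f : E →L[ℝ] F)
    (hf : Function.Bijective f) : f.IsInvertible :=
  ⟨ContinuousLinearEquiv.ofBijective f (LinearMap.ker_eq_bot.2 hf.1)
    (LinearMap.range_eq_top.2 hf.2), by ext; simp⟩

namespace Model

variable {d : ℕ} {L : ℝ} [hL : Fact (0 < L)] {m : Model d L}

/-- The standing assumptions on the modulation function, the input and the mean of the kernel. -/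
structure Admissible (m : Model d L) : Prop where
  contDiff : ContDiff ℝ 2 m.Φ
  convex : ∀ x, 0 ≤ deriv (deriv m.Φ) x
  strictMono : StrictMonoOn m.Φ (Set.Ici 0)
  zero : ∀ x ≤ 0, m.Φ x = 0
  B_pos : 0 < m.B
  W0_neg : m.W0 < 0

/-- The mean activity at inverse noise level `exp p.1` under the synaptic input `p.2`. -/
def response (m : Model d L) (p : ℝ × ℝ) : ℝ :=
  truncMean (Real.exp (p.1 / 2) * m.Φ (p.2 + m.B)) / Real.exp (p.1 / 2) / L ^ d

/-- The derivative of `response` in the synaptic input. -/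
def responseDeriv (m : Model d L) (p : ℝ × ℝ) : ℝ :=
  deriv m.Φ (p.2 + m.B) * truncVar (Real.exp (p.1 / 2) * m.Φ (p.2 + m.B)) / L ^ d

theorem sqrt_exp (θ : ℝ) : √(Real.exp θ) = Real.exp (θ / 2) := by
  rw [Real.exp_half]

omit hL in
theorem response_eq (θ u : ℝ) :
    m.response (θ, u) = gaussMean d L (Real.exp θ) (m.Φ (u + m.B)) := by
  rw [gaussMean_eq (Real.exp_pos θ), sqrt_exp, response]

instance : Measure.IsNegInvariant (volume : Measure (Torus d L)) :=
  Measure.IsAddHaarMeasure.isNegInvariant_of_regular _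

theorem conv_const (W : Torus d L → ℝ) (y : ℝ) (x : Torus d L) :
    conv W (fun _ => y) x = (∫ x, W x) * y := by
  unfold conv
  rw [integral_mul_const]
  congr 1
  exact integral_sub_left_eq_self W volume x

theorem isHomMean_iff {θ y : ℝ} :
    m.IsHomMean (Real.exp θ) y ↔ y = m.response (θ, m.W0 * y) := by
  have : ∀ x, m.G (fun _ => y) (Real.exp θ) x = y - m.response (θ, m.W0 * y) := by
    intro x
    rw [G, conv_const, response_eq]; rfl
  simp only [IsHomMean, this, sub_eq_zero]
  exact ⟨fun h => h 0, fun h _ => h⟩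

namespace Admissible

variable (hm : m.Admissible)
include hm

theorem hasDerivAt_Φ (x : ℝ) : HasDerivAt m.Φ (deriv m.Φ x) x :=
  (hm.contDiff.differentiable (by norm_num) x).hasDerivAt

theorem contDiff_deriv : ContDiff ℝ 1 (deriv m.Φ) := by
  have h : ContDiff ℝ (1 + 1) m.Φ := by rw [one_add_one_eq_two]; exact hm.contDiff
  exact (contDiff_succ_iff_deriv.1 h).2.2

theorem monotone_deriv : Monotone (deriv m.Φ) :=
  monotone_of_deriv_nonneg (hm.contDiff_deriv.differentiable one_ne_zero) hm.convex

theorem deriv_eq_zero {x : ℝ} (hx : x ≤ 0) : deriv m.Φ x = 0 := by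
  have h1 : HasDerivWithinAt m.Φ (deriv m.Φ x) (Set.Iic x) x := (hm.hasDerivAt_Φ x).hasDerivWithinAt
  have h2 : HasDerivWithinAt m.Φ 0 (Set.Iic x) x :=
    (hasDerivWithinAt_const x (Set.Iic x) (0 : ℝ)).congr
      (fun y hy => hm.zero y (le_trans hy hx)) (hm.zero x hx)
  exact (uniqueDiffOn_Iic x x Set.self_mem_Iic).eq_deriv _ h1 h2

theorem deriv_nonneg (x : ℝ) : 0 ≤ deriv m.Φ x := by
  rcases le_total x 0 with h | h
  · rw [hm.deriv_eq_zero h]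
  · rw [← hm.deriv_eq_zero le_rfl]; exact hm.monotone_deriv h

theorem Φ_pos {x : ℝ} (hx : 0 < x) : 0 < m.Φ x := by
  rw [← hm.zero 0 le_rfl]
  exact hm.strictMono (Set.mem_Ici.2 le_rfl) (Set.mem_Ici.2 hx.le) hx

theorem Φ_nonneg (x : ℝ) : 0 ≤ m.Φ x := by
  rcases le_or_gt x 0 with h | h
  · rw [hm.zero x h]
  · exact (hm.Φ_pos h).le

/-- By the mean value theorem the slope `Φ(x)/x > 0` is attained as `Φ'(c)` with `c < x`, and `Φ'`
is nondecreasing. -/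
theorem deriv_pos {x : ℝ} (hx : 0 < x) : 0 < deriv m.Φ x := by
  refine lt_of_le_of_ne (hm.deriv_nonneg x) fun h => ?_
  obtain ⟨c, hc, hc'⟩ := exists_deriv_eq_slope m.Φ hx hm.contDiff.continuous.continuousOn
    (hm.contDiff.differentiable (by norm_num)).differentiableOn
  have h1 := hm.monotone_deriv hc.2.le
  rw [hc', hm.zero 0 le_rfl, ← h, sub_zero, sub_zero] at h1
  exact absurd h1 (not_le.2 (div_pos (hm.Φ_pos hx) hx))

theorem pos_of_deriv_ne_zero {x : ℝ} (h : deriv m.Φ x ≠ 0) : 0 < x := by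
  by_contra hx
  exact h (hm.deriv_eq_zero (not_lt.1 hx))

theorem contDiff_response : ContDiff ℝ 2 m.response := by
  have h1 : ContDiff ℝ 2 fun p : ℝ × ℝ => Real.exp (p.1 / 2) := by fun_prop
  have h2 : ContDiff ℝ 2 fun p : ℝ × ℝ => m.Φ (p.2 + m.B) :=
    hm.contDiff.comp (contDiff_snd.add contDiff_const)
  exact (((contDiff_truncMean (WithTop.coe_le_coe.2 (le_top (a := (2 : ℕ∞))))).comp (h1.mul h2)).div h1
    fun p => (Real.exp_pos _).ne').div_const _

theorem hasDerivAt_response (θ u : ℝ) :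
    HasDerivAt (fun u => m.response (θ, u)) (m.responseDeriv (θ, u)) u := by
  have h1 : HasDerivAt (fun u => m.Φ (u + m.B)) (deriv m.Φ (u + m.B)) u :=
    (hm.hasDerivAt_Φ (u + m.B)).comp_add_const u m.B
  have h2 := (((hasDerivAt_truncMean _).comp u (h1.const_mul (Real.exp (θ / 2)))).div_const
    (Real.exp (θ / 2))).div_const (L ^ d)
  refine h2.congr_deriv ?_
  have := (Real.exp_pos (θ / 2)).ne'
  simp only [responseDeriv]
  field_simp

omit hL hm in
theorem hasDerivAt_response_fst (m : Model d L) (θ u : ℝ) :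
    HasDerivAt (fun θ => m.response (θ, u))
      ((Real.exp (θ / 2) * m.Φ (u + m.B) * truncVar (Real.exp (θ / 2) * m.Φ (u + m.B)) -
        truncMean (Real.exp (θ / 2) * m.Φ (u + m.B))) / (2 * Real.exp (θ / 2)) / L ^ d) θ := by
  have h0 : HasDerivAt (fun θ : ℝ => Real.exp (θ / 2)) (Real.exp (θ / 2) * (1 / 2)) θ :=
    ((hasDerivAt_id θ).div_const 2).exp
  have h2 := (((hasDerivAt_truncMean _).comp θ (h0.mul_const (m.Φ (u + m.B)))).div h0
    (Real.exp_pos _).ne').div_const (L ^ d)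
  refine h2.congr_deriv ?_
  have := (Real.exp_pos (θ / 2)).ne'
  simp only [Function.comp]
  congr 1
  field_simp

theorem contDiff_responseDeriv : ContDiff ℝ 1 m.responseDeriv := by
  have h1 : ContDiff ℝ 1 fun p : ℝ × ℝ => Real.exp (p.1 / 2) := by fun_prop
  have h2 : ContDiff ℝ 1 fun p : ℝ × ℝ => m.Φ (p.2 + m.B) :=
    (hm.contDiff.of_le (by norm_num)).comp (contDiff_snd.add contDiff_const)
  have h3 : ContDiff ℝ 1 fun p : ℝ × ℝ => deriv m.Φ (p.2 + m.B) :=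
    hm.contDiff_deriv.comp (contDiff_snd.add contDiff_const)
  have h4 : ContDiff ℝ 1 truncVar := by
    have := contDiff_truncMean (n := 1) (by exact_mod_cast le_top)
    exact contDiff_const.sub (this.mul (this.sub contDiff_id))
  exact (h3.mul (h4.comp (h1.mul h2))).div_const _

theorem responseDeriv_nonneg (p : ℝ × ℝ) : 0 ≤ m.responseDeriv p :=
  div_nonneg (mul_nonneg (hm.deriv_nonneg _) (truncVar_pos_of_nonneg
    (mul_nonneg (Real.exp_pos _).le (hm.Φ_nonneg _))).le) (pow_pos hL.out d).le

theorem monotone_response (θ : ℝ) : Monotone fun u => m.response (θ, u) :=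
  monotone_of_deriv_nonneg (fun u => (hm.hasDerivAt_response θ u).differentiableAt)
    fun u => by rw [(hm.hasDerivAt_response θ u).deriv]; exact hm.responseDeriv_nonneg _

theorem response_pos (p : ℝ × ℝ) : 0 < m.response p :=
  div_pos (div_pos (truncMean_pos_of_nonneg (mul_nonneg (Real.exp_pos _).le (hm.Φ_nonneg _)))
    (Real.exp_pos _)) (pow_pos hL.out d)

/-- Because the response is nondecreasing and `W₀ < 0`, `y ↦ y - response (θ, W₀ y)` is strictly
increasing. It is negative at `0` and nonnegative at `response (θ, 0)`, where the input has dropped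
to `W₀ · response (θ, 0) ≤ 0`. -/
theorem existsUnique_fixed (θ : ℝ) :
    ∃! y : ℝ, y = m.response (θ, m.W0 * y) := by
  have hmono := hm.monotone_response θ
  have hc : Continuous fun y => y - m.response (θ, m.W0 * y) :=
    continuous_id.sub (hm.contDiff_response.continuous.comp (by fun_prop))
  have hW := hm.W0_neg
  have hb : 0 ≤ m.response (θ, 0) := (hm.response_pos _).le
  obtain ⟨y, -, hy⟩ := intermediate_value_Icc hb hc.continuousOn
    (show (0 : ℝ) ∈ Set.Icc _ _ by
      constructor
      · simp only [mul_zero, zero_sub]; linarith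
      · have := hmono (show m.W0 * m.response (θ, 0) ≤ 0 by nlinarith)
        simp only at this
        linarith)
  refine ⟨y, sub_eq_zero.1 hy, ?_⟩
  have key : ∀ a b : ℝ, a = m.response (θ, m.W0 * a) → b = m.response (θ, m.W0 * b) → a ≤ b := by
    intro a b ha hb
    by_contra hab
    have := hmono (show m.W0 * a ≤ m.W0 * b by nlinarith)
    simp only at this
    rw [← ha, ← hb] at this
    exact hab this
  exact fun z hz => le_antisymm (key z y hz (sub_eq_zero.1 hy)) (key y z (sub_eq_zero.1 hy) hz)

theorem existsUnique_isHomMean {κ : ℝ} (hκ : 0 < κ) :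
    ∃! y : ℝ, m.IsHomMean κ y := by
  rw [← Real.exp_log hκ]
  simp only [isHomMean_iff]
  exact hm.existsUnique_fixed _

end Admissible

/-- The homogeneous branch, parametrised by `log κ`. -/
def branch (m : Model d L) (θ : ℝ) : ℝ := m.rhoBar (Real.exp θ)

/-- The synaptic input `W₀ ρ̄` along the homogeneous branch. -/
def inputAt (m : Model d L) (θ : ℝ) : ℝ := m.W0 * m.branch θ

/-- The gain `∂_u response` along the homogeneous branch. -/
def gain (m : Model d L) (θ : ℝ) : ℝ := m.responseDeriv (θ, m.inputAt θ)

namespace Admissible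

variable (hm : m.Admissible)
include hm

theorem branch_eq (θ : ℝ) : m.branch θ = m.response (θ, m.inputAt θ) := by
  have h := Classical.epsilon_spec (hm.existsUnique_isHomMean (Real.exp_pos θ)).exists
  exact isHomMean_iff.1 h

theorem eq_branch {θ y : ℝ} (hy : y = m.response (θ, m.W0 * y)) : y = m.branch θ :=
  (hm.existsUnique_fixed θ).unique hy (hm.branch_eq θ)

theorem branch_pos (θ : ℝ) : 0 < m.branch θ := by
  rw [hm.branch_eq]; exact hm.response_pos _

/-- The partial derivative in `y` of the fixed point equation is `1 - W₀ ∂_u response ≥ 1`, so the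
implicit function theorem applies. Uniqueness of the fixed point identifies the implicit function
with the branch, which is itself defined only by a choice. -/
theorem contDiff_branch : ContDiff ℝ 1 m.branch := by
  have hF : ContDiff ℝ 1 fun p : ℝ × ℝ => p.2 - m.response (p.1, m.W0 * p.2) :=
    contDiff_snd.sub ((hm.contDiff_response.of_le (by norm_num)).comp
      (contDiff_fst.prodMk (contDiff_const.mul contDiff_snd)))
  set F := fun p : ℝ × ℝ => p.2 - m.response (p.1, m.W0 * p.2) with hFdef
  refine contDiff_iff_contDiffAt.2 fun θ => ?_
  set u : ℝ × ℝ := (θ, m.branch θ) with hu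
  have hd : ((fderiv ℝ F u).comp (.inr ℝ ℝ ℝ)) 1 =
      1 - m.responseDeriv (θ, m.inputAt θ) * m.W0 := by
    have h1 : HasDerivAt (fun y : ℝ => ((θ, y) : ℝ × ℝ)) (0, 1) (m.branch θ) :=
      (hasDerivAt_const _ _).prodMk (hasDerivAt_id _)
    have h2 := ((hF.differentiable one_ne_zero u).hasFDerivAt.comp_hasDerivAt _ h1)
    have h3 : HasDerivAt (fun y : ℝ => y - m.response (θ, m.W0 * y))
        (1 - m.responseDeriv (θ, m.inputAt θ) * m.W0) (m.branch θ) :=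
      (hasDerivAt_id _).sub (HasDerivAt.comp (m.branch θ) (hm.hasDerivAt_response θ (m.inputAt θ))
        (by simpa using (hasDerivAt_id (m.branch θ)).const_mul m.W0))
    exact h2.unique h3
  have hpos : 0 < 1 - m.responseDeriv (θ, m.inputAt θ) * m.W0 := by
    have := mul_nonneg (hm.responseDeriv_nonneg (θ, m.inputAt θ)) (neg_nonneg.2 hm.W0_neg.le)
    linarith
  have hinv : ((fderiv ℝ F u).comp (.inr ℝ ℝ ℝ)).IsInvertible := by
    refine .of_bijective _ ?_
    have hlin : ∀ t : ℝ, ((fderiv ℝ F u).comp (.inr ℝ ℝ ℝ)) t =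
        t * (1 - m.responseDeriv (θ, m.inputAt θ) * m.W0) := by
      intro t
      rw [← hd, ← smul_eq_mul, ← map_smul, smul_eq_mul, mul_one]
    constructor
    · intro s t hst
      rw [hlin, hlin] at hst
      exact mul_right_cancel₀ hpos.ne' hst
    · intro t
      exact ⟨t / (1 - m.responseDeriv (θ, m.inputAt θ) * m.W0), by rw [hlin]; field_simp⟩
  have hFu : F u = 0 := sub_eq_zero.2 (hm.branch_eq θ)
  have hev := (hF.contDiffAt (x := u)).eventually_apply_implicitFunction one_ne_zero hinv
  refine ((hF.contDiffAt (x := u)).contDiffAt_implicitFunction one_ne_zero hinv).congr_of_eventuallyEq ?_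
  filter_upwards [hev] with x hx
  rw [hFu] at hx
  exact (hm.eq_branch (sub_eq_zero.1 hx)).symm

theorem contDiff_inputAt : ContDiff ℝ 1 m.inputAt := contDiff_const.mul hm.contDiff_branch

theorem contDiff_gain : ContDiff ℝ 1 m.gain :=
  hm.contDiff_responseDeriv.comp (contDiff_id.prodMk hm.contDiff_inputAt)

/-- Implicit differentiation gives `b' = ∂_θ response + W₀ (∂_u response) b'`. The first term is
negative, since `z truncVar z ≤ z < truncMean z`; were `b' ≥ 0`, the second would be nonpositive, a
contradiction. -/
theorem deriv_branch_neg (θ : ℝ) : deriv m.branch θ < 0 := by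
  have hb : HasDerivAt m.branch (deriv m.branch θ) θ :=
    (hm.contDiff_branch.differentiable one_ne_zero θ).hasDerivAt
  have hi : HasDerivAt m.inputAt (m.W0 * deriv m.branch θ) θ := hb.const_mul m.W0
  set u : ℝ × ℝ := (θ, m.inputAt θ) with hu
  have hR := (hm.contDiff_response.differentiable (by norm_num) u).hasFDerivAt
  have hc1 : HasDerivAt (fun x : ℝ => ((x, m.inputAt x) : ℝ × ℝ))
      (1, m.W0 * deriv m.branch θ) θ := (hasDerivAt_id θ).prodMk hi
  have hc2 : HasDerivAt (fun x : ℝ => ((x, m.inputAt θ) : ℝ × ℝ)) (1, 0) θ :=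
    (hasDerivAt_id θ).prodMk (hasDerivAt_const θ (m.inputAt θ))
  have hc3 : HasDerivAt (fun x : ℝ => ((θ, x) : ℝ × ℝ)) (0, 1) (m.inputAt θ) :=
    (hasDerivAt_const (m.inputAt θ) θ).prodMk (hasDerivAt_id _)
  have h1 : HasDerivAt (fun θ => m.response (θ, m.inputAt θ))
      (fderiv ℝ m.response u (1, m.W0 * deriv m.branch θ)) θ :=
    HasFDerivAt.comp_hasDerivAt (l := m.response) (l' := fderiv ℝ m.response u) θ hR hc1
  have h2 : fderiv ℝ m.response u (1, 0) = _ :=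
    (HasFDerivAt.comp_hasDerivAt (l := m.response) (l' := fderiv ℝ m.response u) θ hR hc2).unique (hasDerivAt_response_fst m θ (m.inputAt θ))
  have h3 : fderiv ℝ m.response u (0, 1) = m.responseDeriv u :=
    (HasFDerivAt.comp_hasDerivAt (l := m.response) (l' := fderiv ℝ m.response u) (m.inputAt θ) hR hc3).unique
      (hm.hasDerivAt_response θ (m.inputAt θ))
  have h4 : deriv m.branch θ = fderiv ℝ m.response u (1, m.W0 * deriv m.branch θ) := by
    refine hb.unique ?_
    have : m.branch = fun θ => m.response (θ, m.inputAt θ) := funext hm.branch_eq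
    rw [this] at hb ⊢
    exact h1.congr_deriv (by rw [← this])
  have h5 : ((1 : ℝ), m.W0 * deriv m.branch θ) =
      (1, 0) + (m.W0 * deriv m.branch θ) • ((0 : ℝ), (1 : ℝ)) := by simp
  rw [h5, map_add, map_smul, h2, h3, smul_eq_mul] at h4
  set z := Real.exp (θ / 2) * m.Φ (m.inputAt θ + m.B) with hz
  have hz0 : 0 ≤ z := mul_nonneg (Real.exp_pos _).le (hm.Φ_nonneg _)
  have hneg : (z * truncVar z - truncMean z) / (2 * Real.exp (θ / 2)) / L ^ d < 0 := by
    refine div_neg_of_neg_of_pos (div_neg_of_neg_of_pos ?_ (by positivity)) (pow_pos hL.out d)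
    have h1 := truncVar_le_one hz0
    have h2 := mills_pos z
    rw [truncMean]; nlinarith
  have hr := hm.responseDeriv_nonneg u
  have hW := hm.W0_neg
  by_contra hcon
  have : m.W0 * deriv m.branch θ * m.responseDeriv u ≤ 0 :=
    mul_nonpos_of_nonpos_of_nonneg (by nlinarith) hr
  linarith

theorem gain_nonneg (θ : ℝ) : 0 ≤ m.gain θ := hm.responseDeriv_nonneg _

/-- A positive gain forces the total input to be positive, so `Φ` and `Φ'` are positive there.
Convexity makes the term with `Φ''` merely nonnegative; strictness comes from the variance factor,
whose argument `e^{θ/2} Φ` grows. -/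
theorem deriv_gain_pos {θ : ℝ} (h : 0 < m.gain θ) : 0 < deriv m.gain θ := by
  have hb : HasDerivAt m.inputAt (m.W0 * deriv m.branch θ) θ :=
    (hm.contDiff_branch.differentiable one_ne_zero θ).hasDerivAt.const_mul m.W0
  have hU : HasDerivAt (fun θ => m.inputAt θ + m.B) (m.W0 * deriv m.branch θ) θ :=
    hb.add_const _
  have hb' := mul_pos_of_neg_of_neg hm.W0_neg (hm.deriv_branch_neg θ)
  have h0 : HasDerivAt (fun θ : ℝ => Real.exp (θ / 2)) (Real.exp (θ / 2) * (1 / 2)) θ :=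
    ((hasDerivAt_id θ).div_const 2).exp
  have hd : deriv m.Φ (m.inputAt θ + m.B) ≠ 0 := by
    intro h0
    simp [gain, responseDeriv, h0] at h
  have hUpos := hm.pos_of_deriv_ne_zero hd
  have hdpos := hm.deriv_pos hUpos
  have hΦpos := hm.Φ_pos hUpos
  have h1 := (hm.contDiff_deriv.differentiable one_ne_zero _).hasDerivAt.comp θ hU
  have h2 := (hm.hasDerivAt_Φ _).comp θ hU
  have h3 := (hasDerivAt_truncVar _).comp θ (h0.mul h2)
  have h4 := (h1.mul h3).div_const (L ^ d)
  have h5 : m.gain = fun θ => deriv m.Φ (m.inputAt θ + m.B) *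
    truncVar (Real.exp (θ / 2) * m.Φ (m.inputAt θ + m.B)) / L ^ d := rfl
  rw [h5]
  refine lt_of_lt_of_eq ?_ (HasDerivAt.deriv h4).symm
  refine div_pos ?_ (pow_pos hL.out d)
  simp only [Function.comp, Pi.mul_apply]
  have hz : 0 ≤ Real.exp (θ / 2) * m.Φ (m.inputAt θ + m.B) := by positivity
  have hv := truncVar_pos_of_nonneg hz
  have hs := truncSkew_pos hz
  have hmi := mills_pos (Real.exp (θ / 2) * m.Φ (m.inputAt θ + m.B))
  have hc := hm.convex (m.inputAt θ + m.B)
  positivity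

/-- At a zero of the gain, nonnegativity makes the point a minimum, so the derivative vanishes
there. -/
theorem deriv_gain_nonneg (θ : ℝ) : 0 ≤ deriv m.gain θ := by
  rcases (hm.gain_nonneg θ).eq_or_lt with h | h
  · have : IsLocalMin m.gain θ := Eventually.of_forall fun x => by rw [← h]; exact hm.gain_nonneg x
    rw [this.deriv_eq_zero]
  · exact (hm.deriv_gain_pos h).le

theorem monotone_gain : Monotone m.gain :=
  monotone_of_deriv_nonneg (hm.contDiff_gain.differentiable one_ne_zero) hm.deriv_gain_nonneg

/-- The gain is zero for strong noise, so strictness can only hold where it is positive. Equal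
values at the two ends would make it constant and positive in between, against `deriv_gain_pos`. -/
theorem gain_lt {θ₁ θ₂ : ℝ} (h : θ₁ < θ₂) (h2 : 0 < m.gain θ₂) : m.gain θ₁ < m.gain θ₂ := by
  refine lt_of_le_of_ne (hm.monotone_gain h.le) fun he => ?_
  have hconst : ∀ x ∈ Set.Ioo θ₁ θ₂, m.gain x = m.gain θ₂ := fun x hx =>
    le_antisymm (hm.monotone_gain hx.2.le) (he ▸ hm.monotone_gain hx.1.le)
  obtain ⟨x, hx⟩ := exists_between h
  have h3 := hm.deriv_gain_pos ((hconst x hx).symm ▸ h2)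
  have h4 : m.gain =ᶠ[𝓝 x] fun _ => m.gain θ₂ := by
    filter_upwards [Ioo_mem_nhds hx.1 hx.2] with y hy using hconst y hy
  rw [h4.deriv_eq] at h3
  simp at h3

theorem antitone_branch : Antitone m.branch :=
  antitone_of_deriv_nonpos (hm.contDiff_branch.differentiable one_ne_zero)
    fun θ => (hm.deriv_branch_neg θ).le

theorem tendsto_rhoBar : Tendsto m.rhoBar atTop (𝓝 m.rhoStar) := by
  have h1 : ∃ l, Tendsto m.branch atTop (𝓝 l) :=
    ⟨_, tendsto_atTop_ciInf hm.antitone_branch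
      ⟨0, by rintro _ ⟨θ, rfl⟩; exact (hm.branch_pos θ).le⟩⟩
  obtain ⟨l, hl⟩ := h1
  have h2 : Tendsto m.rhoBar atTop (𝓝 l) := by
    refine (hl.comp Real.tendsto_log_atTop).congr' ?_
    filter_upwards [eventually_gt_atTop 0] with κ hκ
    simp [branch, Real.exp_log hκ]
  exact tendsto_nhds_limUnder ⟨l, h2⟩

theorem tendsto_branch : Tendsto m.branch atTop (𝓝 m.rhoStar) :=
  hm.tendsto_rhoBar.comp Real.tendsto_exp_atTop

omit hL hm in
theorem tendsto_exp_half : Tendsto (fun θ : ℝ => Real.exp (θ / 2)) atTop atTop :=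
  Real.tendsto_exp_atTop.comp (tendsto_id.atTop_div_const (by norm_num))

/-- On the branch `truncMean z = z + mills z` with `z = √κ Φ ≥ 0`. Since `mills` is bounded on `z ≥
0`, the correction `mills z / √κ` disappears as `κ → ∞` and the noiseless fixed point equation
remains. -/
theorem rhoStar_eq : m.rhoStar = m.Φ (m.W0 * m.rhoStar + m.B) / L ^ d := by
  have h1 : Tendsto (fun θ => m.Φ (m.inputAt θ + m.B)) atTop
      (𝓝 (m.Φ (m.W0 * m.rhoStar + m.B))) :=
    (hm.contDiff.continuous.tendsto _).comp ((hm.tendsto_branch.const_mul m.W0).add_const m.B)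
  have h2 : Tendsto (fun θ => mills (Real.exp (θ / 2) * m.Φ (m.inputAt θ + m.B)) /
      Real.exp (θ / 2)) atTop (𝓝 0) := by
    have h3 : Tendsto (fun θ : ℝ => mills 0 / Real.exp (θ / 2)) atTop (𝓝 0) :=
      tendsto_exp_half.const_div_atTop _
    refine squeeze_zero (fun θ => ?_) (fun θ => ?_) h3
    · exact div_nonneg (mills_pos _).le (Real.exp_pos _).le
    · exact div_le_div_of_nonneg_right (mills_le (mul_nonneg (Real.exp_pos _).le (hm.Φ_nonneg _)))
        (Real.exp_pos _).le
  have h4 := (h1.add h2).div_const (L ^ d)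
  rw [add_zero] at h4
  refine tendsto_nhds_unique hm.tendsto_branch (h4.congr fun θ => ?_)
  rw [hm.branch_eq, response, truncMean]
  have := (Real.exp_pos (θ / 2)).ne'
  congr 1
  field_simp

/-- A nonpositive limiting input would give `Φ = 0`, hence `ρ* = 0`, and the input would be `B > 0`
after all. -/
theorem inputStar_pos : 0 < m.W0 * m.rhoStar + m.B := by
  by_contra h
  have h1 := hm.rhoStar_eq
  rw [hm.zero _ (not_lt.1 h), zero_div] at h1
  rw [h1, mul_zero, zero_add] at h
  exact h hm.B_pos

theorem tendsto_gain : Tendsto m.gain atTop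
    (𝓝 (deriv m.Φ (m.W0 * m.rhoStar + m.B) / L ^ d)) := by
  have h0 : Tendsto (fun θ => m.inputAt θ + m.B) atTop (𝓝 (m.W0 * m.rhoStar + m.B)) :=
    (hm.tendsto_branch.const_mul m.W0).add_const m.B
  have h1 := (hm.contDiff.continuous.tendsto _).comp h0
  have h2 := (hm.contDiff_deriv.continuous.tendsto _).comp h0
  have h3 := tendsto_truncVar_atTop.comp
    (tendsto_exp_half.atTop_mul_pos (hm.Φ_pos hm.inputStar_pos) h1)
  have h4 := (h2.mul h3).div_const (L ^ d)
  rw [mul_one] at h4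
  exact h4

/-- Strong noise alone creates activity: `ρ̄ ≥ truncMean 0 / (√κ L^d)`, which is unbounded as `κ →
0`. The inhibition `W₀ρ̄` then outweighs `B`, and `Φ'` vanishes on nonpositive inputs. -/
theorem exists_gain_eq_zero : ∃ θ, m.gain θ = 0 := by
  have hLd := pow_pos hL.out d
  have hW := hm.W0_neg
  have h1 : Tendsto (fun θ : ℝ => Real.exp (θ / 2)) atBot (𝓝 0) :=
    Real.tendsto_exp_atBot.comp (tendsto_id.atBot_div_const (by norm_num))
  have h0 : 0 < truncMean 0 := truncMean_pos_of_nonneg le_rfl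
  -- Any `e^{θ/2}` below this constant makes `-W₀` times the lower bound on the activity at least
  -- `B`.
  have hc : 0 < truncMean 0 * (-m.W0) / m.B / L ^ d :=
    div_pos (div_pos (mul_pos h0 (by linarith)) hm.B_pos) hLd
  obtain ⟨θ, hθ⟩ := (h1.eventually (gt_mem_nhds hc)).exists
  refine ⟨θ, ?_⟩
  have h2 : truncMean 0 / Real.exp (θ / 2) / L ^ d ≤ m.branch θ := by
    rw [hm.branch_eq, response]
    refine div_le_div_of_nonneg_right (div_le_div_of_nonneg_right ?_ (Real.exp_pos _).le) hLd.le
    have : 0 ≤ Real.exp (θ / 2) * m.Φ (m.inputAt θ + m.B) :=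
      mul_nonneg (Real.exp_pos _).le (hm.Φ_nonneg _)
    exact truncMean_monotoneOn (Set.mem_Ici.2 le_rfl) this this
  have h3 : m.B ≤ -m.W0 * (truncMean 0 / Real.exp (θ / 2) / L ^ d) := by
    have he := Real.exp_pos (θ / 2)
    have hB := hm.B_pos
    rw [lt_div_iff₀ hLd, lt_div_iff₀ hB] at hθ
    rw [div_div, mul_div_assoc', le_div_iff₀ (by positivity)]
    linarith
  have h4 : m.inputAt θ + m.B ≤ 0 := by
    have := mul_le_mul_of_nonneg_left h2 (show 0 ≤ -m.W0 by linarith)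
    rw [inputAt]; linarith
  rw [gain, responseDeriv, hm.deriv_eq_zero h4]
  simp

/-- The gain reaches every level below its limit. -/
theorem exists_gain_eq {c : ℝ} (hc : 0 ≤ c)
    (h : c < deriv m.Φ (m.W0 * m.rhoStar + m.B) / L ^ d) : ∃ θ, m.gain θ = c := by
  obtain ⟨θ₀, h0⟩ := hm.exists_gain_eq_zero
  obtain ⟨θ₁, h1⟩ := (hm.tendsto_gain.eventually (lt_mem_nhds h)).exists
  obtain ⟨θ, hθ⟩ := mem_range_of_exists_le_of_exists_ge hm.contDiff_gain.continuous
    ⟨θ₀, h0.le.trans hc⟩ ⟨θ₁, h1.le⟩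
  exact ⟨θ, hθ⟩

/-- The branch equation reads `truncMean z = L^d ρ̄ √κ`; inserting it into `truncVar z = 1 -
truncMean z (truncMean z - z)` produces the bracket of the bifurcation equation. -/
theorem gain_eq_bifurcation (θ : ℝ) :
    m.gain θ = m.dPhi0 (Real.exp θ) * (1 / L ^ d - L ^ d * m.rhoBar (Real.exp θ) *
      (m.rhoBar (Real.exp θ) - m.Phi0 (Real.exp θ) / L ^ d) * Real.exp θ) := by
  have h1 := hm.branch_eq θ
  have hLd := (pow_pos hL.out d).ne'
  have he := (Real.exp_pos (θ / 2)).ne'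
  have he2 : Real.exp θ = Real.exp (θ / 2) * Real.exp (θ / 2) := by
    rw [← Real.exp_add, add_halves]
  rw [response] at h1
  simp only [branch] at h1
  rw [gain, responseDeriv, dPhi0, Phi0, truncVar]
  simp only [inputAt, branch] at h1 ⊢
  set z := Real.exp (θ / 2) * m.Φ (m.W0 * m.rhoBar (Real.exp θ) + m.B) with hz
  have h2 : truncMean z = m.rhoBar (Real.exp θ) * L ^ d * Real.exp (θ / 2) := by
    rw [h1]; field_simp
  rw [h2]
  have he3 : Real.exp θ = Real.exp (θ / 2) ^ 2 := by rw [he2, sq]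
  generalize m.rhoBar (Real.exp θ) = y at *
  rw [hz, he3]
  field_simp

end Admissible

end Model
end NeuralField

namespace NeuralField

open ComplexConjugate

variable {d : ℕ} {L : ℝ}

/-! ### Fourier series on the torus -/

/-- The character `∏ᵢ exp(2πi nᵢ xᵢ / L)` of the torus. -/
def char (n : Fin d → ℤ) : C(Torus d L, ℂ) where
  toFun x := ∏ i, fourier (n i) (x i)
  continuous_toFun := by fun_prop

theorem char_apply (n : Fin d → ℤ) (x : Torus d L) : char n x = ∏ i, fourier (n i) (x i) := rfl

theorem char_neg (n : Fin d → ℤ) (x : Torus d L) : char (-n) x = conj (char n x) := by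
  simp only [char_apply, Pi.neg_apply, fourier_neg, map_prod]

theorem char_add (n k : Fin d → ℤ) (x : Torus d L) : char (n + k) x = char n x * char k x := by
  simp only [char_apply, Pi.add_apply, fourier_add, ← Finset.prod_mul_distrib]

theorem char_zero (x : Torus d L) : char (0 : Fin d → ℤ) x = 1 := by
  simp [char_apply]

theorem char_add_apply (n : Fin d → ℤ) (x y : Torus d L) :
    char n (x + y) = char n x * char n y := by
  simp only [char_apply, Pi.add_apply, ← Finset.prod_mul_distrib]
  refine Finset.prod_congr rfl fun i _ => ?_
  simp [fourier_apply, smul_add, AddCircle.toCircle_add]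

theorem norm_char (n : Fin d → ℤ) (x : Torus d L) : ‖char n x‖ = 1 := by
  rw [char_apply, norm_prod]
  exact Finset.prod_eq_one fun i _ => by rw [fourier_apply]; exact Circle.norm_coe _

/-- The star subalgebra generated by the characters. -/
def charSubalgebra (d : ℕ) (L : ℝ) : StarSubalgebra ℂ C(Torus d L, ℂ) where
  toSubalgebra := Algebra.adjoin ℂ (Set.range char)
  star_mem' := by
    change Algebra.adjoin ℂ (Set.range char) ≤ star (Algebra.adjoin ℂ (Set.range char))
    refine Algebra.adjoin_le ?_
    rintro _ ⟨n, rfl⟩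
    refine Algebra.subset_adjoin ⟨-n, ?_⟩
    ext1 x
    simp only [char_neg, starRingEnd_apply, ContinuousMap.star_apply]

theorem charSubalgebra_coe :
    (charSubalgebra d L).toSubalgebra.toSubmodule = Submodule.span ℂ (Set.range char) := by
  apply Algebra.adjoin_eq_span_of_subset
  refine .trans (fun x ↦ Submonoid.closure_induction (fun _ ↦ id) ⟨0, ?_⟩ ?_) Submodule.subset_span
  · ext z; exact char_zero z
  · rintro _ _ _ _ ⟨m, rfl⟩ ⟨n, rfl⟩
    exact ⟨m + n, by ext z; exact char_add m n z⟩

variable [hL : Fact (0 < L)]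

theorem charSubalgebra_separatesPoints : (charSubalgebra d L).SeparatesPoints := by
  intro x y hxy
  rw [Ne, funext_iff, not_forall] at hxy
  obtain ⟨i, hi⟩ := hxy
  refine ⟨_, ⟨char (Pi.single i 1), Algebra.subset_adjoin ⟨Pi.single i 1, rfl⟩, rfl⟩, ?_⟩
  have h : ∀ z : Torus d L, char (Pi.single i 1) z = fourier 1 (z i) := by
    intro z
    rw [char_apply, Finset.prod_eq_single i]
    · simp
    · intro j _ hj; simp [Pi.single_eq_of_ne hj]
    · simp
  dsimp only
  rw [h, h, fourier_one, fourier_one]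
  exact fun hh => hi (AddCircle.injective_toCircle hL.out.ne' (Circle.ext hh))

theorem span_char_closure_eq_top :
    (Submodule.span ℂ (Set.range (char (d := d) (L := L)))).topologicalClosure = ⊤ := by
  rw [← charSubalgebra_coe]
  exact congr_arg (Subalgebra.toSubmodule <| StarSubalgebra.toSubalgebra ·)
    (ContinuousMap.starSubalgebra_topologicalClosure_eq_top_of_separatesPoints _
      charSubalgebra_separatesPoints)

theorem integral_fourier (n : ℤ) (hn : n ≠ 0) : ∫ x : AddCircle L, fourier n x = 0 :=
  integral_eq_zero_of_add_right_eq_neg (μ := volume) (fourier_add_half_inv_index hn hL.out)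

theorem integral_char (n : Fin d → ℤ) :
    ∫ x : Torus d L, char n x = if n = 0 then (L : ℂ) ^ d else 0 := by
  split_ifs with h
  · subst h
    simp only [char_zero]
    have : volume.real (Set.univ : Set (Torus d L)) = L ^ d := by
      rw [Measure.real, ← Set.pi_univ, volume_pi_pi]
      simp [ENNReal.toReal_ofReal hL.out.le]
    rw [integral_const, this]; simp
  · obtain ⟨i, hi⟩ := Function.ne_iff.mp h
    simp only [char_apply]
    rw [integral_fintype_prod_volume_eq_prod (fun (i : Fin d) (y : AddCircle L) =>
      (fourier (n i) y : ℂ))]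
    exact Finset.prod_eq_zero (Finset.mem_univ i) (integral_fourier _ hi)

/-- The normalised characters in `L²`. -/
def charLp (n : Fin d → ℤ) : Lp ℂ 2 (volume : Measure (Torus d L)) :=
  (((L ^ d : ℝ) ^ (-(1 / 2) : ℝ) : ℝ) : ℂ) • ContinuousMap.toLp (E := ℂ) 2 volume ℂ (char n)

theorem normSq_normalisation : ((L ^ d : ℝ) ^ (-(1 / 2) : ℝ)) * ((L ^ d : ℝ) ^ (-(1 / 2) : ℝ)) =
    (L ^ d)⁻¹ := by
  have h := pow_pos hL.out d
  rw [← Real.rpow_add h]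
  norm_num
  rw [Real.rpow_neg_one]

theorem orthonormal_charLp : Orthonormal ℂ (charLp (d := d) (L := L)) := by
  rw [orthonormal_iff_ite]
  intro m n
  have hLd : ((L : ℂ) ^ d) ≠ 0 := pow_ne_zero _ (by exact_mod_cast hL.out.ne')
  rw [charLp, charLp, inner_smul_left, inner_smul_right, ContinuousMap.inner_toLp]
  simp only [← char_neg, ← char_add]
  rw [integral_char, Complex.conj_ofReal, ← mul_assoc, ← Complex.ofReal_mul, normSq_normalisation]
  have : n + -m = 0 ↔ m = n := by rw [add_neg_eq_zero]; exact eq_comm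
  simp only [this]
  split_ifs
  · push_cast; exact inv_mul_cancel₀ hLd
  · simp

theorem span_charLp_closure_eq_top :
    (Submodule.span ℂ (Set.range (charLp (d := d) (L := L)))).topologicalClosure = ⊤ := by
  have h : (Submodule.span ℂ (Set.range fun n : Fin d → ℤ =>
      ContinuousMap.toLp (E := ℂ) 2 (volume : Measure (Torus d L)) ℂ (char n))).topologicalClosure
      = ⊤ := by
    simpa only [Submodule.map_span, ContinuousLinearMap.coe_coe, ← Set.range_comp,
      Function.comp_def] using
      (ContinuousMap.toLp_denseRange ℂ (volume : Measure (Torus d L)) ℂ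
        (by simp : (2 : ENNReal) ≠ ⊤)).topologicalClosure_map_submodule span_char_closure_eq_top
  rw [← top_le_iff, ← h]
  refine Submodule.topologicalClosure_mono (Submodule.span_le.2 ?_)
  rintro _ ⟨n, rfl⟩
  have hc : (((L ^ d : ℝ) ^ (-(1 / 2) : ℝ) : ℝ) : ℂ) ≠ 0 := by
    have := Real.rpow_pos_of_pos (pow_pos hL.out d) (-(1 / 2))
    exact_mod_cast this.ne'
  have : ContinuousMap.toLp (E := ℂ) 2 (volume : Measure (Torus d L)) ℂ (char n) =
      (((L ^ d : ℝ) ^ (-(1 / 2) : ℝ) : ℝ) : ℂ)⁻¹ • charLp n := by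
    rw [charLp, smul_smul, inv_mul_cancel₀ hc, one_smul]
  simp only [this]
  exact Submodule.smul_mem _ _ (Submodule.subset_span ⟨n, rfl⟩)

/-- The Hilbert basis of normalised characters. -/
def charBasis (d : ℕ) (L : ℝ) [Fact (0 < L)] :
    HilbertBasis (Fin d → ℤ) ℂ (Lp ℂ 2 (volume : Measure (Torus d L))) :=
  HilbertBasis.mk orthonormal_charLp span_charLp_closure_eq_top.ge

/-- The Fourier coefficient `∫ g(x) exp(-2πi n·x / L) dx`. -/
def coeff (g : Torus d L → ℝ) (n : Fin d → ℤ) : ℂ := ∫ x, (g x : ℂ) * char (-n) x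

theorem coeff_congr {f g : Torus d L → ℝ} (h : f =ᵐ[volume] g) (n : Fin d → ℤ) :
    coeff f n = coeff g n :=
  integral_congr_ae (by filter_upwards [h] with x hx; rw [hx])

/-- **Parseval's identity**. -/
theorem hasSum_coeff (f g : L2 d L) :
    HasSum (fun n => conj (coeff f n) * coeff g n) ((L ^ d * inner ℝ f g : ℝ) : ℂ) := by
  set F : Lp ℂ 2 (volume : Measure (Torus d L)) := Complex.ofRealCLM.compLp f
  set G : Lp ℂ 2 (volume : Measure (Torus d L)) := Complex.ofRealCLM.compLp g
  have hF : ∀ᵐ x, F x = (f x : ℂ) := Complex.ofRealCLM.coeFn_compLp f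
  have hG : ∀ᵐ x, G x = (g x : ℂ) := Complex.ofRealCLM.coeFn_compLp g
  have hFG : inner ℂ F G = ((inner ℝ f g : ℝ) : ℂ) := by
    rw [L2.inner_def, L2.inner_def, ← integral_complex_ofReal]
    refine integral_congr_ae ?_
    filter_upwards [hF, hG] with x hx hy
    rw [hx, hy]; simp
  have hcoef : ∀ (g : L2 d L) (G : Lp ℂ 2 (volume : Measure (Torus d L)))
      (_ : ∀ᵐ x, G x = (g x : ℂ)) (n : Fin d → ℤ), inner ℂ (charLp n) G =
      (((L ^ d : ℝ) ^ (-(1 / 2) : ℝ) : ℝ) : ℂ) * coeff g n := by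
    intro g G hG n
    rw [charLp, inner_smul_left, Complex.conj_ofReal, L2.inner_def, coeff]
    congr 1
    refine integral_congr_ae ?_
    filter_upwards [hG, ContinuousMap.coeFn_toLp (p := 2) (𝕜 := ℂ) volume (char n)] with x hx hy
    rw [hx, hy, char_neg]; simp
  have h := (charBasis d L).hasSum_inner_mul_inner F G
  have hb : ∀ n, (charBasis d L) n = charLp n := fun n => by
    rw [charBasis, HilbertBasis.coe_mk]
  simp only [hb] at h
  rw [hFG] at h
  have h2 := h.mul_left ((L : ℂ) ^ d)
  have hLd : ((L : ℂ) ^ d) ≠ 0 := pow_ne_zero _ (by exact_mod_cast hL.out.ne')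
  push_cast
  refine h2.congr_fun fun n => ?_
  rw [← inner_conj_symm, hcoef f F hF, hcoef g G hG, map_mul, Complex.conj_ofReal]
  have hn := congrArg (fun r : ℝ => (r : ℂ)) (normSq_normalisation (d := d) (L := L))
  push_cast at hn ⊢
  calc _ = (L : ℂ) ^ d * ((L : ℂ) ^ d)⁻¹ * (conj (coeff f n) * coeff g n) := by
        rw [mul_inv_cancel₀ hLd, one_mul]
    _ = _ := by rw [← hn]; ring

/-! ### Symmetries of the coefficients -/

theorem measurePreserving_flip (j : Fin d) :
    MeasurePreserving (fun x : Torus d L => Function.update x j (-x j)) volume volume := by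
  have h := volume_preserving_pi (α' := fun _ : Fin d => AddCircle L)
    (β' := fun _ : Fin d => AddCircle L)
    (f := fun i => if i = j then (fun y => -y) else id) (fun i => by
      split_ifs
      · exact Measure.measurePreserving_neg volume
      · exact MeasurePreserving.id volume)
  have e : (fun x : Torus d L => Function.update x j (-x j)) =
      fun a i => (if i = j then fun y => -y else id) (a i) := by
    funext x i
    by_cases hi : i = j
    · subst hi; simp
    · simp [hi]
  rw [e]; exact h

theorem measurePreserving_perm (ζ : Equiv.Perm (Fin d)) :
    MeasurePreserving (fun x : Torus d L => x ∘ ζ) volume volume := by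
  have h := volume_measurePreserving_piCongrLeft (fun _ : Fin d => AddCircle L) ζ.symm
  have e : (fun x : Torus d L => x ∘ ζ) =
      MeasurableEquiv.piCongrLeft (fun _ : Fin d => AddCircle L) ζ.symm := by
    funext x i
    simp [MeasurableEquiv.coe_piCongrLeft, Equiv.piCongrLeft_apply]
  rw [e]; exact h

theorem Theta_pos (k : Fin d → ℕ) : 0 < Theta k :=
  Finset.prod_pos fun i _ => Real.sqrt_pos.2 (by split_ifs <;> norm_num)

omit hL in
theorem continuous_omega (k : Fin d → ℕ) : Continuous (omega (L := L) k) := by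
  unfold omega
  refine continuous_const.mul (continuous_finsetProd _ fun i _ => ?_)
  exact Complex.continuous_re.comp ((fourier (k i : ℤ)).continuous.comp (continuous_apply i))

omit hL in
theorem re_fourier_natAbs (n : ℤ) (y : AddCircle L) :
    (fourier (n.natAbs : ℤ) y).re = (fourier n y).re := by
  rcases Int.natAbs_eq n with h | h
  · rw [← h]
  · conv_rhs => rw [h, fourier_neg, Complex.conj_re]

/-- Evenness permits replacing the exponential in each coordinate by its real part without changing
the integral. This is done one coordinate at a time: `P s` carries cosines in the coordinates of `s`
and exponentials elsewhere. -/
theorem coeff_eq_mode {g : Torus d L → ℝ} (hg : Integrable g) (heven : CoordEven g)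
    (n : Fin d → ℤ) :
    coeff g n = ((L ^ ((d : ℝ) / 2) * (mode g (fun i => (n i).natAbs) /
      Theta fun i => (n i).natAbs) : ℝ) : ℂ) := by
  classical
  set P : Finset (Fin d) → Torus d L → ℂ := fun s x =>
    ∏ i, if i ∈ s then ((fourier ((-n) i) (x i)).re : ℂ) else fourier ((-n) i) (x i) with hP
  have hPc : ∀ s, Continuous (P s) := by
    intro s
    refine continuous_finsetProd _ fun i _ => ?_
    have h1 : Continuous fun x : Torus d L => (fourier ((-n) i) (x i) : ℂ) :=
      (fourier ((-n) i)).continuous.comp (continuous_apply i)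
    split_ifs
    · exact Complex.continuous_ofReal.comp (Complex.continuous_re.comp h1)
    · exact h1
  have hint : ∀ s, Integrable fun x => (g x : ℂ) * P s x := by
    intro s
    obtain ⟨C, hC⟩ := isCompact_univ.exists_bound_of_continuousOn (hPc s).continuousOn
    exact hg.ofReal.mul_bdd (c := C) (hPc s).aestronglyMeasurable
      (ae_of_all _ fun x => hC x (Set.mem_univ x))
  have key : ∀ s, ∫ x, (g x : ℂ) * P s x = coeff g n := by
    intro s
    induction s using Finset.induction_on with
    | empty => simp [hP, coeff, char_apply]
    | insert j s hj ih =>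
      -- The cosine is the average of the exponential and its reflection.
      have hsplit : ∀ x, P (insert j s) x =
          (P s x + P s (Function.update x j (-x j))) / 2 := by
        intro x
        simp only [hP]
        rw [← Finset.mul_prod_erase _ _ (Finset.mem_univ j),
          ← Finset.mul_prod_erase _ _ (Finset.mem_univ j),
          ← Finset.mul_prod_erase _ (fun i => if i ∈ s then
            ((fourier ((-n) i) (Function.update x j (-x j) i)).re : ℂ)
            else fourier ((-n) i) (Function.update x j (-x j) i)) (Finset.mem_univ j)]
        have h1 : ∀ i ∈ Finset.univ.erase j, (if i ∈ s then
            ((fourier ((-n) i) (Function.update x j (-x j) i)).re : ℂ)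
            else fourier ((-n) i) (Function.update x j (-x j) i)) =
            if i ∈ s then ((fourier ((-n) i) (x i)).re : ℂ) else fourier ((-n) i) (x i) := by
          intro i hi
          rw [Function.update_of_ne (Finset.ne_of_mem_erase hi)]
        have h2 : ∀ i ∈ Finset.univ.erase j, (if i ∈ insert j s then
            ((fourier ((-n) i) (x i)).re : ℂ) else fourier ((-n) i) (x i)) =
            if i ∈ s then ((fourier ((-n) i) (x i)).re : ℂ) else fourier ((-n) i) (x i) := by
          intro i hi
          simp [Finset.mem_insert, Finset.ne_of_mem_erase hi]
        rw [Finset.prod_congr rfl h1, Finset.prod_congr rfl h2]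
        simp only [Finset.mem_insert_self, if_true, hj, if_false, Function.update_self]
        rw [Complex.re_eq_add_conj, ← fourier_neg]
        have : (fourier ((-n) j) (-x j) : ℂ) = fourier (-(-n) j) (x j) := by
          simp [fourier_apply]
        rw [this]; ring
      -- The reflection of the coordinate `j` preserves both the measure and `g`.
      have hflip : ∫ x, (g x : ℂ) * P s (Function.update x j (-x j)) = ∫ x, (g x : ℂ) * P s x := by
        have hm := measurePreserving_flip (L := L) j
        conv_rhs => rw [← hm.map_eq]
        rw [integral_map hm.measurable.aemeasurable
          (by rw [hm.map_eq]; exact (hint s).aestronglyMeasurable)]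
        refine integral_congr_ae ?_
        filter_upwards [heven j] with x hx
        rw [hx]
      have hint2 : Integrable fun x => (g x : ℂ) * P s (Function.update x j (-x j)) := by
        have hc : Continuous fun x => P s (Function.update x j (-x j)) :=
          (hPc s).comp (continuous_id.update j (continuous_apply j).neg)
        obtain ⟨C, hC⟩ := isCompact_univ.exists_bound_of_continuousOn hc.continuousOn
        exact hg.ofReal.mul_bdd (c := C) hc.aestronglyMeasurable
          (ae_of_all _ fun x => hC x (Set.mem_univ x))
      calc ∫ x, (g x : ℂ) * P (insert j s) x
          = ∫ x, ((g x : ℂ) * P s x + (g x : ℂ) * P s (Function.update x j (-x j))) / 2 := by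
            congr 1; funext x; rw [hsplit]; ring
        _ = coeff g n := by
            rw [integral_div, integral_add (hint s) hint2, hflip, ih]; ring
  rw [← key Finset.univ, mode, ← integral_div, ← integral_const_mul, ← integral_complex_ofReal]
  congr 1; funext x
  simp only [hP, Finset.mem_univ, if_true, omega]
  have hT := (Theta_pos fun i => (n i).natAbs).ne'
  have hLp : L ^ ((d : ℝ) / 2) ≠ 0 := (Real.rpow_pos_of_pos hL.out _).ne'
  have hprod : ∏ i, (fourier ((n i).natAbs : ℤ) (x i)).re = ∏ i, (fourier ((-n) i) (x i)).re := by
    refine Finset.prod_congr rfl fun i _ => ?_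
    rw [re_fourier_natAbs, Pi.neg_apply, fourier_neg, Complex.conj_re]
  rw [hprod, ← Complex.ofReal_prod, ← Complex.ofReal_mul]
  congr 1
  field_simp

theorem mode_perm {g : Torus d L → ℝ} (hg : AEStronglyMeasurable g volume)
    (hex : Exchangeable g) (k : Fin d → ℕ)
    (ζ : Equiv.Perm (Fin d)) : mode g (k ∘ ζ) = mode g k := by
  have hT : Theta (k ∘ ζ) = Theta k :=
    Equiv.prod_comp ζ (fun i => √(2 - if k i = 0 then (1 : ℝ) else 0))
  have ho : ∀ x : Torus d L, omega (k ∘ ζ) (x ∘ ζ) = omega k x := by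
    intro x
    simp only [omega, hT]
    congr 1
    exact Equiv.prod_comp ζ (fun i => (fourier (k i : ℤ) (x i)).re)
  have hm := measurePreserving_perm (L := L) ζ
  have hmeas : AEStronglyMeasurable (fun x => g x * omega (k ∘ ζ) x) volume :=
    hg.mul (continuous_omega _).aestronglyMeasurable
  rw [mode, mode, ← hm.map_eq, integral_map hm.measurable.aemeasurable (by rwa [hm.map_eq]),
    hm.map_eq]
  refine integral_congr_ae ?_
  filter_upwards [hex ζ] with x hx
  rw [hx, ho]

theorem Theta_perm (k : Fin d → ℕ) (ζ : Equiv.Perm (Fin d)) : Theta (k ∘ ζ) = Theta k :=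
  Equiv.prod_comp ζ (fun i => √(2 - if k i = 0 then (1 : ℝ) else 0))

end NeuralField

namespace NeuralField

open ComplexConjugate

variable {d : ℕ} {L : ℝ} [hL : Fact (0 < L)]

/-! ### Convolution with a square-integrable kernel -/

variable {W : Torus d L → ℝ} (hW : MemLp W 2 volume)

/-- The translated and reflected kernel `y ↦ W(x-y)` in `L²`. -/
def convVec (x : Torus d L) : L2 d L :=
  Lp.compMeasurePreserving (fun y => x - y) (Measure.measurePreserving_sub_left volume x) (hW.toLp W)

/-- This is the continuity of translations in `L²`. It makes `W∗g` a continuous function for every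
`g` in `L²`, which later gives smoothness of the superposition operators. -/
theorem continuous_convVec : Continuous (convVec hW) := by
  let g : C(Torus d L, C(Torus d L, Torus d L)) :=
    (ContinuousMap.mk (fun a : Torus d L × Torus d L ↦ a.1 - a.2) continuous_sub).curry
  exact (continuous_const (y := hW.toLp W)).compMeasurePreservingLp (g := g) g.continuous
    (fun x => Measure.measurePreserving_sub_left volume x) (by simp)

theorem norm_convVec (x : Torus d L) : ‖convVec hW x‖ = ‖hW.toLp W‖ :=
  Lp.norm_compMeasurePreserving _ _

theorem coeFn_convVec (x : Torus d L) : convVec hW x =ᵐ[volume] fun y => W (x - y) := by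
  have h1 := Lp.coeFn_compMeasurePreserving (hW.toLp W) (Measure.measurePreserving_sub_left volume x)
  have h2 := (Measure.measurePreserving_sub_left (volume : Measure (Torus d L)) x).quasiMeasurePreserving.ae
    hW.coeFn_toLp
  filter_upwards [h1, h2] with y hy hy2
  rw [convVec, hy, Function.comp, hy2]

/-- Convolution with `W` as an operator from `L²` to continuous functions. -/
def convC : L2 d L →L[ℝ] C(Torus d L, ℝ) :=
  LinearMap.mkContinuous
    { toFun := fun g => ⟨fun x => inner ℝ (convVec hW x) g,
        (continuous_convVec hW).inner continuous_const⟩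
      map_add' := fun f g => by ext x; exact inner_add_right (convVec hW x) f g
      map_smul' := fun c g => by ext x; exact inner_smul_right (convVec hW x) g c }
    ‖hW.toLp W‖ fun g => by
      rw [ContinuousMap.norm_le _ (by positivity)]
      intro x
      calc _ ≤ ‖convVec hW x‖ * ‖g‖ := norm_inner_le_norm _ _
        _ = _ := by rw [norm_convVec]

theorem convC_apply (g : L2 d L) (x : Torus d L) : convC hW g x = conv W g x := by
  change inner ℝ (convVec hW x) g = _
  rw [L2.inner_def, conv]
  refine integral_congr_ae ?_
  filter_upwards [coeFn_convVec hW x] with y hy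
  rw [hy]; simp [mul_comm]

omit hL in
theorem conv_congr [Fact (0 < L)] (W : Torus d L → ℝ) {f g : Torus d L → ℝ}
    (h : f =ᵐ[volume] g) (x : Torus d L) : conv W f x = conv W g x :=
  integral_congr_ae (by filter_upwards [h] with y hy; rw [hy])

/-- Continuous functions as elements of `L²`. -/
abbrev toL2 : C(Torus d L, ℝ) →L[ℝ] L2 d L := ContinuousMap.toLp (E := ℝ) 2 volume ℝ

theorem coeFn_toL2 (f : C(Torus d L, ℝ)) : toL2 f =ᵐ[volume] f := ContinuousMap.coeFn_toLp _ f

/-- Convolution with `W` as an operator on `L²`. -/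
def convL : L2 d L →L[ℝ] L2 d L := toL2.comp (convC hW)

theorem coeFn_convL (g : L2 d L) : convL hW g =ᵐ[volume] conv W g := by
  filter_upwards [coeFn_toL2 (convC hW g)] with x hx
  rw [convL, ContinuousLinearMap.comp_apply, hx, convC_apply]

/-- As characters are multiplicative, twisting `W` and `g` by the same character twists their
convolution; the integral of a convolution is the product of the integrals. -/
theorem coeff_convL (g : L2 d L) (n : Fin d → ℤ) :
    coeff (convL hW g) n = coeff W n * coeff g n := by
  have hWi : Integrable W := hW.integrable (by norm_num)
  have hgi : Integrable g := (Lp.memLp g).integrable (by norm_num)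
  have hb : ∀ f : Torus d L → ℝ, Integrable f → Integrable fun x => (f x : ℂ) * char (-n) x :=
    fun f hf => hf.ofReal.mul_bdd (c := 1) (char (-n)).continuous.aestronglyMeasurable
      (ae_of_all _ fun x => (norm_char _ _).le)
  have h := integral_convolution (L := ContinuousLinearMap.mul ℝ ℂ) (μ := volume) (ν := volume)
    (hb _ hgi) (hb _ hWi)
  rw [coeff_congr (coeFn_convL hW g), mul_comm]
  refine Eq.trans ?_ h
  rw [coeff]
  congr 1; funext x
  rw [convolution, conv, ← integral_complex_ofReal, ← integral_mul_const]
  congr 1; funext y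
  have : char (-n) x = char (-n) (x - y) * char (-n) y := by
    rw [← char_add_apply, sub_add_cancel]
  rw [this]; push_cast
  simp; ring

theorem integrable_of_L2 (g : L2 d L) : Integrable g := (Lp.memLp g).integrable (by norm_num)

theorem eq_of_coeff_eq {f g : L2 d L} (h : ∀ n, coeff f n = coeff g n) : f = g := by
  have hsub : ∀ n, coeff (f - g : L2 d L) n = 0 := by
    intro n
    have hc : ∀ f : L2 d L, Integrable fun x => (f x : ℂ) * char (-n) x :=
      fun f => (integrable_of_L2 f).ofReal.mul_bdd (c := 1)
        (char (-n)).continuous.aestronglyMeasurable (ae_of_all _ fun x => (norm_char _ _).le)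
    rw [coeff_congr (Lp.coeFn_sub f g), ← sub_eq_zero.2 (h n), coeff, coeff, coeff,
      ← integral_sub (hc f) (hc g)]
    congr 1; funext x
    simp [sub_mul]
  have h1 := hasSum_coeff (f - g) (f - g)
  simp only [hsub, mul_zero] at h1
  have h2 := h1.unique hasSum_zero
  have h3 : L ^ d * inner ℝ (f - g) (f - g) = 0 := by exact_mod_cast h2
  have h4 := (mul_eq_zero.1 h3).resolve_left (pow_pos hL.out d).ne'
  exact sub_eq_zero.1 (inner_self_eq_zero.1 h4)

/-- The eigenvalue of the convolution with `W` on the mode `k`. -/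
def eigen (W : Torus d L → ℝ) (k : Fin d → ℕ) : ℝ := L ^ ((d : ℝ) / 2) * (mode W k / Theta k)

/-- The componentwise absolute value of a frequency. -/
def absFreq (n : Fin d → ℤ) : Fin d → ℕ := fun i => (n i).natAbs

theorem absFreq_natCast (k : Fin d → ℕ) : absFreq (fun i => (k i : ℤ)) = k := by
  funext i; simp [absFreq]

theorem coeff_eq_eigen {g : Torus d L → ℝ} (hg : Integrable g) (heven : CoordEven g)
    (n : Fin d → ℤ) : coeff g n = (eigen g (absFreq n) : ℂ) := by
  rw [coeff_eq_mode hg heven]; rfl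

section Even

variable (heven : CoordEven W)
include heven

theorem coeff_convL' (g : L2 d L) (n : Fin d → ℤ) :
    coeff (convL hW g) n = (eigen W (absFreq n) : ℂ) * coeff g n := by
  rw [coeff_convL hW, coeff_eq_eigen (hW.integrable (by norm_num)) heven]

theorem hasSum_inner_convL (f g : L2 d L) :
    HasSum (fun n => (eigen W (absFreq n) : ℂ) * (conj (coeff f n) * coeff g n))
      ((L ^ d * inner ℝ f (convL hW g) : ℝ) : ℂ) := by
  refine (hasSum_coeff f (convL hW g)).congr_fun fun n => ?_
  rw [coeff_convL' hW heven]; ring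

theorem inner_convL_comm (f g : L2 d L) :
    inner ℝ (convL hW f) g = inner ℝ f (convL hW g) := by
  have h1 := hasSum_inner_convL hW heven f g
  have h2 := hasSum_coeff (convL hW f) g
  have h3 := h1.unique (h2.congr_fun fun n => by
    rw [coeff_convL' hW heven, map_mul, Complex.conj_ofReal]; ring)
  have h4 : L ^ d * inner ℝ f (convL hW g) = L ^ d * inner ℝ (convL hW f) g := by exact_mod_cast h3
  exact (mul_left_cancel₀ (pow_pos hL.out d).ne' h4).symm

/-- Parseval's identity is compared term by term. Only frequencies present in `g` are constrained,
so the bound serves both the whole space and the complement of the top eigenvector. -/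
theorem inner_convL_le {g : L2 d L} {μ : ℝ}
    (hμ : ∀ n, coeff g n ≠ 0 → eigen W (absFreq n) ≤ μ) :
    inner ℝ g (convL hW g) ≤ μ * ‖g‖ ^ 2 := by
  have h1 := (Complex.hasSum_re (hasSum_inner_convL hW heven g g))
  have h2 := (Complex.hasSum_re (hasSum_coeff g g)).mul_left μ
  simp only [Complex.ofReal_re] at h1 h2
  have h3 := hasSum_le (fun n => ?_) h1 h2
  · rw [real_inner_self_eq_norm_sq] at h3
    have hLd := pow_pos hL.out d
    have : L ^ d * inner ℝ g (convL hW g) ≤ L ^ d * (μ * ‖g‖ ^ 2) := by linarith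
    exact le_of_mul_le_mul_left this hLd
  · have h4 : conj (coeff g n) * coeff g n = ((Complex.normSq (coeff g n) : ℝ) : ℂ) :=
      Complex.normSq_eq_conj_mul_self.symm
    rw [h4, ← Complex.ofReal_mul, Complex.ofReal_re, Complex.ofReal_re]
    by_cases hn : coeff g n = 0
    · simp [hn]
    · exact mul_le_mul_of_nonneg_right (hμ n hn) (Complex.normSq_nonneg _)

theorem convL_eq_smul {e : L2 d L} {μ : ℝ}
    (he : ∀ n, coeff e n ≠ 0 → eigen W (absFreq n) = μ) : convL hW e = μ • e := by
  refine eq_of_coeff_eq fun n => ?_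
  have h : coeff (μ • e : L2 d L) n = μ * coeff e n := by
    rw [coeff_congr (Lp.coeFn_smul μ e), coeff, coeff, ← integral_const_mul]
    congr 1; funext x
    simp [mul_assoc]
  rw [h, coeff_convL' hW heven]
  by_cases hn : coeff e n = 0
  · simp [hn]
  · rw [he n hn]

include hW in
-- The coefficients of `W` are square summable, so only finitely many eigenvalues exceed `μ/2`, and
-- a largest one among those different from `μ` exists.
theorem exists_eigen_gap {μ : ℝ} (hμ : 0 < μ) (hle : ∀ k, eigen W k ≤ μ) :
    ∃ μ' < μ, 0 ≤ μ' ∧ ∀ k, eigen W k ≠ μ → eigen W k ≤ μ' := by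
  have hs : Summable fun n => Complex.normSq (coeff (hW.toLp W) n) := by
    have := (Complex.hasSum_re (hasSum_coeff (hW.toLp W) (hW.toLp W))).summable
    refine this.congr fun n => ?_
    rw [← Complex.normSq_eq_conj_mul_self, Complex.ofReal_re]
  have hfin : {n | ¬ Complex.normSq (coeff (hW.toLp W) n) < (μ / 2) ^ 2}.Finite :=
    hs.tendsto_cofinite_zero.eventually (gt_mem_nhds (by positivity))
  have hfin2 : {k : Fin d → ℕ | μ / 2 ≤ eigen W k}.Finite := by
    refine Set.Finite.subset (hfin.image absFreq) fun k hk => ?_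
    refine ⟨fun i => (k i : ℤ), ?_, absFreq_natCast k⟩
    have hk : μ / 2 ≤ eigen W k := hk
    change ¬ _ < _
    rw [coeff_congr hW.coeFn_toLp, coeff_eq_eigen (hW.integrable (by norm_num)) heven,
      absFreq_natCast, Complex.normSq_ofReal]
    nlinarith
  -- Including `μ/2` keeps the set nonempty, makes `μ'` nonnegative and covers all the smaller
  -- eigenvalues.
  have hfin3 : (insert (μ / 2) (eigen W '' {k | μ / 2 ≤ eigen W k ∧ eigen W k ≠ μ})).Finite :=
    ((hfin2.subset fun k hk => hk.1).image _).insert _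
  obtain ⟨μ', hmem, hmax⟩ := Set.exists_max_image _ id hfin3 ⟨_, Set.mem_insert _ _⟩
  refine ⟨μ', ?_, ?_, fun k hk => ?_⟩
  · rcases hmem with rfl | ⟨k, hk, rfl⟩
    · linarith
    · exact lt_of_le_of_ne (hle k) hk.2
  · have := hmax _ (Set.mem_insert _ _)
    simp only [id] at this
    linarith
  · by_cases h2 : μ / 2 ≤ eigen W k
    · exact hmax _ (Set.mem_insert_of_mem _ ⟨k, ⟨h2, hk⟩, rfl⟩)
    · have := hmax _ (Set.mem_insert _ _)
      simp only [id] at this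
      linarith

end Even

end NeuralField

namespace NeuralField

variable {d : ℕ} {L : ℝ} [hL : Fact (0 < L)]

/-! ### Spaces of symmetric functions -/

section Invariant

variable {ι : Type*} {σ : ι → Torus d L → Torus d L}
  (hσ : ∀ i, MeasurePreserving (σ i) volume volume)

/-- The `L²` functions invariant under a family of measure preserving maps. -/
def invariantSubmodule : Submodule ℝ (L2 d L) :=
  ⨅ i, ((Lp.compMeasurePreservingₗᵢ ℝ (E := ℝ) (p := 2) (σ i) (hσ i)).toContinuousLinearMap -
    ContinuousLinearMap.id ℝ (L2 d L)).ker

theorem mem_invariantSubmodule {u : L2 d L} :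
    u ∈ invariantSubmodule hσ ↔ ∀ i, ∀ᵐ x, u (σ i x) = u x := by
  simp only [invariantSubmodule, Submodule.mem_iInf]
  refine forall_congr' fun i => ?_
  have h1 : u ∈ ((Lp.compMeasurePreservingₗᵢ ℝ (E := ℝ) (p := 2) (σ i)
      (hσ i)).toContinuousLinearMap - ContinuousLinearMap.id ℝ (L2 d L)).ker ↔
      Lp.compMeasurePreserving (σ i) (hσ i) u = u := by
    rw [LinearMap.mem_ker]
    exact sub_eq_zero
  rw [h1]
  have h2 := Lp.coeFn_compMeasurePreserving u (hσ i)
  constructor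
  · intro h
    filter_upwards [h2] with x hx
    rw [h] at hx
    exact hx.symm
  · intro h
    refine Lp.ext ?_
    filter_upwards [h2, h] with x hx hx2
    rw [hx, Function.comp, hx2]

theorem isClosed_invariantSubmodule :
    IsClosed (invariantSubmodule hσ : Set (L2 d L)) := by
  have : (invariantSubmodule hσ : Set (L2 d L)) =
      ⋂ i, (((Lp.compMeasurePreservingₗᵢ ℝ (E := ℝ) (p := 2) (σ i) (hσ i)).toContinuousLinearMap -
        ContinuousLinearMap.id ℝ (L2 d L)).ker : Set (L2 d L)) := by
    simp [invariantSubmodule]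
  rw [this]
  exact isClosed_iInter fun i => ContinuousLinearMap.isClosed_ker _

theorem toL2_mem_invariantSubmodule (f : C(Torus d L, ℝ)) (hf : ∀ i x, f (σ i x) = f x) :
    toL2 f ∈ invariantSubmodule hσ := by
  rw [mem_invariantSubmodule]
  intro i
  have h := coeFn_toL2 f
  filter_upwards [h, (hσ i).quasiMeasurePreserving.ae h] with x hx hx2
  rw [hx, hx2, hf]

omit hL in
theorem conv_invariant [Fact (0 < L)] {s : Torus d L → Torus d L}
    (hs : MeasurePreserving s volume volume)
    (hsub : ∀ x y, s (x - y) = s x - s y) {W g : Torus d L → ℝ}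
    (hWm : AEStronglyMeasurable W volume) (hgm : AEStronglyMeasurable g volume)
    (hW : ∀ᵐ x, W (s x) = W x) (hg : ∀ᵐ x, g (s x) = g x) (x : Torus d L) :
    conv W g (s x) = conv W g x := by
  unfold conv
  have hm : AEStronglyMeasurable (fun y => W (s x - y) * g y) volume :=
    (hWm.comp_measurePreserving (Measure.measurePreserving_sub_left volume (s x))).mul hgm
  conv_lhs => rw [← hs.map_eq]
  rw [integral_map hs.measurable.aemeasurable (by rwa [hs.map_eq])]
  refine integral_congr_ae ?_
  filter_upwards [hg, (Measure.measurePreserving_sub_left (volume : Measure (Torus d L))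
    x).quasiMeasurePreserving.ae hW] with y hy hy2
  rw [← hsub, hy, hy2]

/-- Convolution commutes with an additive symmetry that preserves the measure and `W`, and any
pointwise function of an invariant function is invariant. This is what allows the nonlinear problem
to be restricted to a symmetric subspace. -/
theorem convC_mem_invariant {W : Torus d L → ℝ} (hW : MemLp W 2 volume)
    (hsub : ∀ i x y, σ i (x - y) = σ i x - σ i y) (hWσ : ∀ i, ∀ᵐ x, W (σ i x) = W x)
    {u : L2 d L} (hu : u ∈ invariantSubmodule hσ) (ψ : C(ℝ, ℝ)) :
    toL2 (ψ.comp (convC hW u)) ∈ invariantSubmodule hσ := by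
  refine toL2_mem_invariantSubmodule hσ _ fun i x => ?_
  rw [ContinuousMap.comp_apply, ContinuousMap.comp_apply, convC_apply, convC_apply,
    conv_invariant (hσ i) (hsub i) hW.aestronglyMeasurable (Lp.aestronglyMeasurable u) (hWσ i)
    ((mem_invariantSubmodule hσ).1 hu i)]

end Invariant

omit hL in
theorem flip_sub (j : Fin d) (x y : Torus d L) :
    Function.update (x - y) j (-(x - y) j) =
      Function.update x j (-x j) - Function.update y j (-y j) := by
  funext i
  by_cases h : i = j
  · subst h; simp; abel
  · simp [h]

variable (d L) in
/-- `L²_S` as a submodule. -/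
def evenSubmodule : Submodule ℝ (L2 d L) :=
  invariantSubmodule (σ := fun (j : Fin d) (x : Torus d L) => Function.update x j (-x j))
    measurePreserving_flip

theorem coe_evenSubmodule : (evenSubmodule d L : Set (L2 d L)) = L2S d L := by
  ext u
  exact mem_invariantSubmodule _

variable (d L) in
/-- The generating symmetries of `L²_ex`. -/
def exSymmetry : Fin d ⊕ Equiv.Perm (Fin d) → Torus d L → Torus d L
  | .inl j => fun x => Function.update x j (-x j)
  | .inr ζ => fun x => x ∘ ζ

theorem measurePreserving_exSymmetry (i : Fin d ⊕ Equiv.Perm (Fin d)) :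
    MeasurePreserving (exSymmetry d L i) volume volume := by
  rcases i with j | ζ
  · exact measurePreserving_flip j
  · exact measurePreserving_perm ζ

variable (d L) in
/-- `L²_ex` as a submodule. -/
def exSubmodule : Submodule ℝ (L2 d L) :=
  invariantSubmodule (measurePreserving_exSymmetry (d := d) (L := L))

theorem coe_exSubmodule : (exSubmodule d L : Set (L2 d L)) = L2ex d L := by
  ext u
  refine (mem_invariantSubmodule _).trans ?_
  exact ⟨fun h => ⟨fun j => h (.inl j), fun ζ => h (.inr ζ)⟩,
    fun h i => by rcases i with j | ζ; exacts [h.1 j, h.2 ζ]⟩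

/-! ### The modes -/

omit hL in
theorem re_fourier_neg_apply (n : ℤ) (y : AddCircle L) :
    (fourier n (-y)).re = (fourier n y).re := by
  have : (fourier n (-y) : ℂ) = fourier (-n) y := by simp [fourier_apply]
  rw [this, fourier_neg, Complex.conj_re]

omit hL in
theorem omega_flip (k : Fin d → ℕ) (j : Fin d) (x : Torus d L) :
    omega k (Function.update x j (-x j)) = omega k x := by
  unfold omega
  congr 1
  refine Finset.prod_congr rfl fun i _ => ?_
  by_cases h : i = j
  · subst h; rw [Function.update_self, re_fourier_neg_apply]
  · rw [Function.update_of_ne h]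

omit hL in
theorem omega_comp_perm (k : Fin d → ℕ) (ζ : Equiv.Perm (Fin d)) (x : Torus d L) :
    omega k (x ∘ ζ) = omega (k ∘ ζ.symm) x := by
  unfold omega
  rw [Theta_perm]
  congr 1
  rw [← Equiv.prod_comp ζ fun i => (fourier ((k ∘ ζ.symm) i : ℤ) (x i)).re]
  simp

/-- The mode `ω_k` as a continuous map. -/
def omegaC (k : Fin d → ℕ) : C(Torus d L, ℝ) := ⟨omega k, continuous_omega k⟩

theorem integral_re_fourier_mul {a b : ℕ} (hab : a ≠ b) :
    ∫ y : AddCircle L, (fourier (a : ℤ) y).re * (fourier (b : ℤ) y).re = 0 := by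
  have h0 : ∀ n : ℤ, n ≠ 0 → ∫ y : AddCircle L, (fourier n y : ℂ).re = 0 := by
    intro n hn
    have hi : Integrable fun y : AddCircle L => (fourier n y : ℂ) :=
      (fourier n).continuous.integrable_of_hasCompactSupport (HasCompactSupport.of_compactSpace _)
    have := integral_re hi
    simp only [RCLike.re_eq_complex_re] at this
    rw [this, integral_fourier n hn]; rfl
  have hi : ∀ n : ℤ, Integrable fun y : AddCircle L => (fourier n y : ℂ).re := fun n =>
    (Complex.continuous_re.comp (fourier n).continuous).integrable_of_hasCompactSupport
      (HasCompactSupport.of_compactSpace _)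
  have h1 : ∀ y : AddCircle L, (fourier (a : ℤ) y).re * (fourier (b : ℤ) y).re =
      ((fourier ((a : ℤ) + b) y).re + (fourier ((a : ℤ) + -b) y).re) / 2 := by
    intro y
    rw [fourier_add, fourier_add, fourier_neg, Complex.mul_re, Complex.mul_re, Complex.conj_re,
      Complex.conj_im]
    ring
  simp only [h1]
  rw [integral_div, integral_add (hi _) (hi _), h0 _ (by omega), h0 _ (by omega)]
  simp

theorem mode_omega {k j : Fin d → ℕ} (h : k ≠ j) : mode (omega (L := L) k) j = 0 := by
  obtain ⟨i, hi⟩ := Function.ne_iff.mp h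
  have h1 : ∀ x : Torus d L, omega k x * omega j x =
      (Theta k / L ^ ((d : ℝ) / 2) * (Theta j / L ^ ((d : ℝ) / 2))) *
        ∏ i, ((fourier (k i : ℤ) (x i)).re * (fourier (j i : ℤ) (x i)).re) := by
    intro x
    rw [omega, omega, Finset.prod_mul_distrib]; ring
  unfold mode
  simp only [h1]
  rw [integral_const_mul, integral_fintype_prod_volume_eq_prod (fun (i : Fin d) (y : AddCircle L) =>
    (fourier (k i : ℤ) y).re * (fourier (j i : ℤ) y).re),
    Finset.prod_eq_zero (Finset.mem_univ i) (integral_re_fourier_mul hi), mul_zero]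

theorem integrable_omega (k : Fin d → ℕ) : Integrable (omega (L := L) k) :=
  (continuous_omega k).integrable_of_hasCompactSupport (HasCompactSupport.of_compactSpace _)

theorem coeff_omega {k : Fin d → ℕ} {n : Fin d → ℤ} (h : k ≠ absFreq n) :
    coeff (omega (L := L) k) n = 0 := by
  rw [coeff_eq_eigen (integrable_omega k) (fun j => ae_of_all _ (omega_flip k j)), eigen,
    mode_omega h]
  simp

theorem inner_omega (y : L2 d L) (k : Fin d → ℕ) : inner ℝ y (toL2 (omegaC k)) = mode y k := by
  rw [L2.inner_def, mode]
  refine integral_congr_ae ?_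
  filter_upwards [coeFn_toL2 (omegaC (L := L) k)] with x hx
  rw [hx]; simp [omegaC, mul_comm]

omit hL in
theorem omega_zero_pos [Fact (0 < L)] (k : Fin d → ℕ) : 0 < omega (L := L) k 0 := by
  have : omega (L := L) k 0 = Theta k / L ^ ((d : ℝ) / 2) := by simp [omega]
  rw [this]
  exact div_pos (Theta_pos k) (Real.rpow_pos_of_pos (Fact.out : 0 < L) _)

theorem toL2_ne_zero {f : C(Torus d L, ℝ)} (hf : f 0 ≠ 0) : toL2 f ≠ 0 := by
  intro h
  have h0 : toL2 f = toL2 0 := by rw [h, map_zero]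
  have := ContinuousMap.toLp_injective (𝕜 := ℝ) (p := 2) (volume : Measure (Torus d L)) h0
  rw [this] at hf
  exact hf rfl

/-- A space of symmetric functions in which the eigenvalue `μ` of the convolution with `W` is
simple, with the normalised eigenvector `e`, and all other eigenvalues are at most `μ' < μ`. -/
structure IsSimpleTop {W : Torus d L → ℝ} (hW : MemLp W 2 volume) (μ μ' : ℝ)
    (X : Submodule ℝ (L2 d L)) (e : L2 d L) : Prop where
  isClosed : IsClosed (X : Set (L2 d L))
  comp_mem : ∀ u ∈ X, ∀ ψ : C(ℝ, ℝ), toL2 (ψ.comp (convC hW u)) ∈ X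
  mem : e ∈ X
  norm_eq : ‖e‖ = 1
  eigenvector : convL hW e = μ • e
  gap : ∀ y ∈ X, inner ℝ y e = 0 → inner ℝ y (convL hW y) ≤ μ' * ‖y‖ ^ 2

section SimpleTop

variable {W : Torus d L → ℝ} (hW : MemLp W 2 volume) (heven : CoordEven W)

/-- The role of `horth` is that orthogonality to `e` removes from an element of `X` every frequency
with eigenvalue `μ`; all remaining eigenvalues are at most `μ'`. -/
theorem isSimpleTop_of_orthogonal {μ μ' : ℝ}
    (hμ' : ∀ k, eigen W k ≠ μ → eigen W k ≤ μ') (heven : CoordEven W)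
    {X : Submodule ℝ (L2 d L)} (hXc : IsClosed (X : Set (L2 d L)))
    (hX : ∀ u ∈ X, ∀ ψ : C(ℝ, ℝ), toL2 (ψ.comp (convC hW u)) ∈ X)
    (hXe : ∀ u ∈ X, CoordEven u) {e : L2 d L} (heX : e ∈ X) (he0 : e ≠ 0)
    (he : ∀ n, coeff e n ≠ 0 → eigen W (absFreq n) = μ)
    (horth : ∀ y ∈ X, inner ℝ y e = 0 → ∀ k, eigen W k = μ → mode y k = 0) :
    IsSimpleTop hW μ μ' X (‖e‖⁻¹ • e) where
  isClosed := hXc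
  comp_mem := hX
  mem := X.smul_mem _ heX
  norm_eq := by rw [norm_smul, norm_inv, norm_norm, inv_mul_cancel₀ (norm_ne_zero_iff.2 he0)]
  eigenvector := by rw [map_smul, convL_eq_smul hW heven he, smul_comm]
  gap y hy h := by
    have h0 : inner ℝ y e = 0 := by
      rw [inner_smul_right] at h
      exact (mul_eq_zero.1 h).resolve_left (inv_ne_zero (norm_ne_zero_iff.2 he0))
    refine inner_convL_le hW heven fun n hn => hμ' _ fun hc => hn ?_
    rw [coeff_eq_eigen (integrable_of_L2 y) (hXe y hy), eigen, horth y hy h0 _ hc]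
    simp

include heven in
theorem isSimpleTop_even {k : Fin d → ℕ} {μ' : ℝ}
    (hμ' : ∀ j, eigen W j ≠ eigen W k → eigen W j ≤ μ')
    (hk : ∀ j, j ≠ k → eigen W j ≠ eigen W k) :
    ∃ e, IsSimpleTop hW (eigen W k) μ' (evenSubmodule d L) e := by
  refine ⟨_, isSimpleTop_of_orthogonal hW hμ' heven (isClosed_invariantSubmodule _)
    (fun u hu ψ => convC_mem_invariant _ hW flip_sub heven hu ψ)
    (fun u hu => (mem_invariantSubmodule _).1 hu) (e := toL2 (omegaC k))
    (toL2_mem_invariantSubmodule _ _ fun j x => omega_flip k j x)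
    (toL2_ne_zero (omega_zero_pos k).ne') (fun n hn => ?_) fun y _ h j hj => ?_⟩
  · by_contra hc
    refine hn ?_
    rw [coeff_congr (coeFn_toL2 _)]
    exact coeff_omega fun h => hc (by rw [← h])
  · have : j = k := by by_contra hne; exact hk j hne hj
    rw [this, ← inner_omega, h]

include heven in
-- The eigenvector is the sum of `ω_{k∘ζ}` over all permutations. An exchangeable `y` has the same
-- coefficient on each summand, so its inner product with the sum is `d!` times that coefficient,
-- and orthogonality kills them all.
theorem isSimpleTop_ex {k : Fin d → ℕ} {μ' : ℝ} (hex : Exchangeable W)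
    (hμ' : ∀ j, eigen W j ≠ eigen W k → eigen W j ≤ μ')
    (hk : ∀ j, eigen W j = eigen W k → ∃ ζ : Equiv.Perm (Fin d), j = k ∘ ζ) :
    ∃ e, IsSimpleTop hW (eigen W k) μ' (exSubmodule d L) e := by
  have hperm : ∀ ζ : Equiv.Perm (Fin d), eigen W (k ∘ ζ) = eigen W k := by
    intro ζ
    rw [eigen, eigen, mode_perm hW.aestronglyMeasurable hex, Theta_perm]
  have hmem : ∀ u ∈ exSubmodule d L, CoordEven u ∧ Exchangeable u := fun u hu => by
    have : u ∈ (exSubmodule d L : Set (L2 d L)) := hu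
    rwa [coe_exSubmodule] at this
  set f : C(Torus d L, ℝ) := ∑ ζ : Equiv.Perm (Fin d), omegaC (k ∘ ζ) with hf
  have hfa : ∀ x, f x = ∑ ζ : Equiv.Perm (Fin d), omega (k ∘ ζ) x := by
    intro x
    rw [hf, ContinuousMap.sum_apply]; rfl
  refine ⟨_, isSimpleTop_of_orthogonal hW hμ' heven (isClosed_invariantSubmodule _)
    (fun u hu ψ => convC_mem_invariant _ hW ?_ ?_ hu ψ)
    (fun u hu => (hmem u hu).1) (e := toL2 f)
    (toL2_mem_invariantSubmodule _ _ ?_)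
    (toL2_ne_zero ?_) (fun n hn => ?_) fun y hy h j hj => ?_⟩
  · rintro (j | ζ) x y
    · exact flip_sub j x y
    · rfl
  · rintro (j | ζ)
    · exact heven j
    · exact hex ζ
  · rintro (j | ζ) x
    · rw [hfa, hfa]
      exact Finset.sum_congr rfl fun ζ _ => omega_flip _ j x
    · rw [hfa, hfa, ← Equiv.sum_comp (Equiv.mulRight ζ)]
      refine Finset.sum_congr rfl fun ξ _ => ?_
      change omega (k ∘ (ξ * ζ)) (x ∘ ζ) = _
      rw [omega_comp_perm]
      congr 1
      funext i
      simp
  -- The sum is nonzero because every summand is positive at the origin.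
  · rw [hfa]
    exact (Finset.sum_pos (fun ζ _ => omega_zero_pos _) Finset.univ_nonempty).ne'
  · by_contra hc
    refine hn ?_
    rw [coeff_congr (coeFn_toL2 _), coeff]
    have h1 : ∀ x, ((f x : ℝ) : ℂ) * char (-n) x =
        ∑ ζ : Equiv.Perm (Fin d), (omega (k ∘ ζ) x : ℂ) * char (-n) x := by
      intro x; rw [hfa, Complex.ofReal_sum, Finset.sum_mul]
    simp only [h1]
    rw [integral_finsetSum]
    · refine Finset.sum_eq_zero fun ζ _ => coeff_omega fun h => hc ?_
      rw [← h, hperm]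
    · intro ζ _
      exact (integrable_omega (k ∘ ζ)).ofReal.mul_bdd (c := 1)
        (char (-n)).continuous.aestronglyMeasurable (ae_of_all _ fun x => (norm_char _ _).le)
  · obtain ⟨ζ, rfl⟩ := hk j hj
    have hm : ∀ ζ : Equiv.Perm (Fin d), mode y (k ∘ ζ) = mode y k :=
      mode_perm (Lp.aestronglyMeasurable y) (hmem y hy).2 k
    rw [hf, map_sum, inner_sum] at h
    simp only [inner_omega, hm, Finset.sum_const, nsmul_eq_mul] at h
    rw [hm]
    exact (mul_eq_zero.1 h).resolve_left (by simp [Fintype.card_ne_zero])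

end SimpleTop

end NeuralField

namespace NeuralField

/-! ### Superposition operators and parametric integrals -/

section Superposition

variable {K : Type*} [TopologicalSpace K] [CompactSpace K]
  {E F : Type*} [NormedAddCommGroup E] [NormedSpace ℝ E] [NormedAddCommGroup F] [NormedSpace ℝ F]

/-- Pointwise application of a continuous family of linear maps. -/
def pointwiseApply : C(K, E →L[ℝ] F) →L[ℝ] C(K, E) →L[ℝ] C(K, F) :=
  LinearMap.mkContinuous₂
    (LinearMap.mk₂ ℝ (fun (A : C(K, E →L[ℝ] F)) (u : C(K, E)) =>
        (⟨fun x => A x (u x), A.continuous.clm_apply u.continuous⟩ : C(K, F)))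
      (fun A B u => by ext; simp) (fun c A u => by ext; simp)
      (fun A u v => by ext; simp) (fun c A u => by ext; simp)) 1 fun A u => by
    rw [ContinuousMap.norm_le _ (by positivity), one_mul]
    exact fun x => (A x).le_of_opNorm_le_of_le (A.norm_coe_le_norm x) (u.norm_coe_le_norm x)

theorem pointwiseApply_apply (A : C(K, E →L[ℝ] F)) (u : C(K, E)) (x : K) :
    pointwiseApply A u x = A x (u x) := rfl

/-- The superposition operator of a `C¹` function is `C¹` on spaces of continuous functions. -/
theorem contDiff_superposition (f : C(E, F)) (hf : ContDiff ℝ 1 f) :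
    ContDiff ℝ 1 fun u : C(K, E) => f.comp u := by
  obtain ⟨f', hf'c, hf'⟩ := contDiff_one_iff_hasFDerivAt.1 hf
  rw [contDiff_one_iff_hasFDerivAt]
  set df : C(E, E →L[ℝ] F) := ⟨f', hf'c⟩ with hdf
  have hcont : Continuous fun u : C(K, E) => df.comp u := ContinuousMap.continuous_postcomp df
  refine ⟨fun u => pointwiseApply (df.comp u), pointwiseApply.continuous.comp hcont, fun u => ?_⟩
  refine HasFDerivAt.of_isLittleO (Asymptotics.isLittleO_iff.2 fun c hc => ?_)
  obtain ⟨δ, hδ, hu⟩ := (Metric.continuousAt_iff (α := C(K, E)) (β := C(K, E →L[ℝ] F))).1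
    hcont.continuousAt c hc
  filter_upwards [Metric.ball_mem_nhds u hδ] with v hv
  rw [Metric.mem_ball, dist_eq_norm] at hv
  rw [ContinuousMap.norm_le _ (by positivity)]
  intro x
  -- Points of this segment are values of `u + t(v - u)`, which stays in the `δ`-ball; continuity of
  -- `u ↦ f' ∘ u` in the sup norm thus bounds the variation of `f'` uniformly in `x`, and the mean
  -- value inequality applies.
  have hb : ∀ y ∈ segment ℝ (u x) (v x), ‖f' y - f' (u x)‖ ≤ c := by
    intro y hy
    rw [segment_eq_image'] at hy
    obtain ⟨t, ht, rfl⟩ := hy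
    have h1 : dist (u + t • (v - u)) u < δ := by
      rw [dist_eq_norm, add_sub_cancel_left, norm_smul, Real.norm_of_nonneg ht.1]
      exact (mul_le_of_le_one_left (norm_nonneg _) ht.2).trans_lt hv
    rw [← dist_eq_norm]
    exact (ContinuousMap.dist_apply_le_dist (f := df.comp (u + t • (v - u))) (g := df.comp u)
      x).trans (hu h1).le
  have := Convex.norm_image_sub_le_of_norm_hasFDerivWithin_le'
    (fun y _ => (hf' y).hasFDerivWithinAt) hb (convex_segment (u x) (v x))
    (left_mem_segment ℝ _ _) (right_mem_segment ℝ _ _)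
  calc _ ≤ c * ‖v x - u x‖ := by simpa [pointwiseApply_apply, hdf] using this
    _ ≤ c * ‖v - u‖ := mul_le_mul_of_nonneg_left ((v - u).norm_coe_le_norm x) hc.le

end Superposition

theorem contDiff_parametric_integral {E : Type*} [NormedAddCommGroup E] [NormedSpace ℝ E]
    [ProperSpace E] {G : E × ℝ → ℝ} (hG : ContDiff ℝ 1 G) :
    ContDiff ℝ 1 fun p => ∫ t in (0 : ℝ)..1, G (p, t) := by
  obtain ⟨G', hG'c, hG'⟩ := contDiff_one_iff_hasFDerivAt.1 hG
  rw [contDiff_one_iff_hasFDerivAt]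
  have hc : Continuous (Function.uncurry fun (p : E) (t : ℝ) =>
      (G' (p, t)).comp (ContinuousLinearMap.inl ℝ E ℝ)) :=
    (hG'c.comp (continuous_fst.prodMk continuous_snd)).clm_comp continuous_const
  refine ⟨fun p => ∫ t in (0 : ℝ)..1, (G' (p, t)).comp (ContinuousLinearMap.inl ℝ E ℝ),
    intervalIntegral.continuous_parametric_intervalIntegral_of_continuous' hc _ _, fun p => ?_⟩
  obtain ⟨C, hC⟩ := ((isCompact_closedBall p 1).prod
    (isCompact_Icc (a := (0 : ℝ)) (b := 1))).exists_bound_of_continuousOn hc.continuousOn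
  refine intervalIntegral.hasFDerivAt_integral_of_dominated_of_fderiv_le (𝕜 := ℝ)
    (F := fun p t => G (p, t))
    (F' := fun p t => (G' (p, t)).comp (ContinuousLinearMap.inl ℝ E ℝ)) (bound := fun _ => C)
    (Metric.closedBall_mem_nhds p one_pos) ?_ ?_ ?_ ?_ ?_ ?_
  · exact Eventually.of_forall fun q => (hG.continuous.comp
      (continuous_const.prodMk continuous_id)).aestronglyMeasurable
  · exact (hG.continuous.comp (continuous_const.prodMk continuous_id)).intervalIntegrable _ _
  · exact (hc.comp (continuous_const.prodMk continuous_id)).aestronglyMeasurable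
  · refine ae_of_all _ fun t ht q hq => hC (q, t) ⟨hq, ?_⟩
    rw [Set.uIoc_of_le zero_le_one] at ht
    exact ⟨ht.1.le, ht.2⟩
  · exact intervalIntegrable_const
  · refine ae_of_all _ fun t _ q _ => ?_
    have h1 : HasFDerivAt (fun q : E => (q, t)) (ContinuousLinearMap.inl ℝ E ℝ) q :=
      hasFDerivAt_prodMk_left q t
    exact (hG' (q, t)).comp q h1

namespace Model

variable {d : ℕ} {L : ℝ} [hL : Fact (0 < L)] {m : Model d L}

/-- The mean slope of the response between the inputs `W₀ρ̄` and `W₀ρ̄ + b`. -/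
def meanSlope (m : Model d L) (p : ℝ × ℝ) : ℝ :=
  ∫ t in (0 : ℝ)..1, m.responseDeriv (p.1, m.inputAt p.1 + t * p.2)

namespace Admissible

variable (hm : m.Admissible)
include hm

theorem contDiff_meanSlope : ContDiff ℝ 1 m.meanSlope := by
  have hG : ContDiff ℝ 1 fun q : (ℝ × ℝ) × ℝ =>
      m.responseDeriv (q.1.1, m.inputAt q.1.1 + q.2 * q.1.2) := by
    have h1 : ContDiff ℝ 1 fun q : (ℝ × ℝ) × ℝ => m.inputAt q.1.1 :=
      hm.contDiff_inputAt.comp (contDiff_fst.comp contDiff_fst)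
    exact hm.contDiff_responseDeriv.comp
      ((contDiff_fst.comp contDiff_fst).prodMk (h1.add (contDiff_snd.mul
        (contDiff_snd.comp contDiff_fst))))
  exact contDiff_parametric_integral hG

omit hm in
theorem meanSlope_zero (θ : ℝ) : m.meanSlope (θ, 0) = m.gain θ := by
  simp [meanSlope, gain]

/-- This is the fundamental theorem of calculus along the segment from the branch. Extracting the
factor `b` exactly, with a `C¹` quotient, is what makes the division by the amplitude in the blow-up
possible. -/
theorem response_add (θ b : ℝ) :
    m.response (θ, m.inputAt θ + b) = m.branch θ + m.meanSlope (θ, b) * b := by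
  have h : ∀ t ∈ Set.uIcc (0 : ℝ) 1,
      HasDerivAt (fun t => m.response (θ, m.inputAt θ + t * b))
        (m.responseDeriv (θ, m.inputAt θ + t * b) * b) t := by
    intro t _
    have h1 : HasDerivAt (fun t : ℝ => m.inputAt θ + t * b) b t := by
      simpa using ((hasDerivAt_id t).mul_const b).const_add (m.inputAt θ)
    exact HasDerivAt.comp t (hm.hasDerivAt_response θ _) h1
  have h2 := intervalIntegral.integral_eq_sub_of_hasDerivAt h
    (((hm.contDiff_responseDeriv.continuous.comp (by fun_prop)).mul
      continuous_const).intervalIntegrable _ _)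
  rw [intervalIntegral.integral_mul_const] at h2
  simp only [one_mul, zero_mul, add_zero] at h2
  rw [meanSlope, h2, hm.branch_eq]; ring

end Admissible
end Model

end NeuralField

/-! ### Zeros near the homogeneous branch as a fixed point problem. -/

namespace NeuralField

variable {d : ℕ} {L : ℝ} [hL : Fact (0 < L)]

variable (d L) in
/-- Constant functions as elements of `L²`. -/
abbrev constL2 : ℝ →L[ℝ] L2 d L := Lp.constL 2 volume ℝ

theorem constL2_apply (c : ℝ) : constL2 d L c = Lp.const 2 volume c := rfl

theorem coeFn_constL2 (c : ℝ) : constL2 d L c =ᵐ[volume] fun _ => c := Lp.coeFn_const 2 volume c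

theorem convC_const {W : Torus d L → ℝ} (hW : MemLp W 2 volume) (c : ℝ) :
    convC hW (constL2 d L c) = ContinuousMap.const _ ((∫ x, W x) * c) := by
  ext x
  rw [convC_apply, conv_congr W (coeFn_constL2 c), Model.conv_const]; rfl

theorem toL2_const (c : ℝ) : toL2 (ContinuousMap.const (Torus d L) c) = constL2 d L c := by
  refine Lp.ext ?_
  filter_upwards [coeFn_toL2 (ContinuousMap.const (Torus d L) c), coeFn_constL2 c] with x hx hy
  rw [hx, hy]; rfl

theorem convL_const {W : Torus d L → ℝ} (hW : MemLp W 2 volume) (c : ℝ) :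
    convL hW (constL2 d L c) = (∫ x, W x) • constL2 d L c := by
  rw [convL, ContinuousLinearMap.comp_apply, convC_const, toL2_const, ← map_smul, smul_eq_mul]

namespace Model

variable {m : Model d L}

namespace Admissible

variable (hm : m.Admissible)
include hm

/-- The nonlinearity `b ↦ response (W₀ρ̄ + b) - ρ̄`. -/
def slopeC (θ : ℝ) : C(ℝ, ℝ) :=
  ⟨fun b => m.meanSlope (θ, b) * b,
    (hm.contDiff_meanSlope.continuous.comp (by fun_prop)).mul continuous_id⟩

theorem slopeC_apply (θ b : ℝ) : hm.slopeC θ b = m.meanSlope (θ, b) * b := rfl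

variable (hW : MemLp m.W 2 volume)

/-- Perturbations of the homogeneous branch are zeros of `G` exactly if they solve the fixed point
equation for `slopeC`. -/
theorem isZero_iff (h : L2 d L) (θ : ℝ) :
    m.IsZero (constL2 d L (m.branch θ) + h) (Real.exp θ) ↔
      h = toL2 ((hm.slopeC θ).comp (convC hW h)) := by
  have h1 : ∀ᵐ x, m.G (constL2 d L (m.branch θ) + h : L2 d L) (Real.exp θ) x =
      h x - toL2 ((hm.slopeC θ).comp (convC hW h)) x := by
    filter_upwards [Lp.coeFn_add (constL2 d L (m.branch θ)) h, coeFn_constL2 (m.branch θ),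
      coeFn_toL2 ((hm.slopeC θ).comp (convC hW h))] with x hx hy hz
    rw [G, ← response_eq, ← convC_apply hW, map_add, convC_const, hx, hz, Pi.add_apply, hy]
    have : (ContinuousMap.const (Torus d L) ((∫ x, m.W x) * m.branch θ) + convC hW h) x =
        m.inputAt θ + convC hW h x := rfl
    rw [this, hm.response_add, ContinuousMap.comp_apply, slopeC_apply]
    ring
  constructor
  · intro hz
    refine Lp.ext ?_
    filter_upwards [h1, hz] with x hx hy
    rw [hx] at hy
    exact sub_eq_zero.1 hy
  · intro he
    change ∀ᵐ x, _ = _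
    filter_upwards [h1] with x hx
    rw [hx, ← he, sub_self]

/-- Solutions close to the homogeneous branch almost solve the linearised equation. -/
theorem eventually_norm_sub_le (θ₀ : ℝ) {η : ℝ} (hη : 0 < η) :
    ∀ᶠ p : L2 d L × ℝ in 𝓝 (0, θ₀), p.1 = toL2 ((hm.slopeC p.2).comp (convC hW p.1)) →
      ‖p.1 - m.gain θ₀ • convL hW p.1‖ ≤ η * ‖p.1‖ := by
  set A := ‖toL2 (d := d) (L := L)‖ * ‖convC hW‖ with hA
  have hA0 : 0 ≤ A := by positivity
  -- The denominator `A + 1` absorbs the operator norms without requiring `A ≠ 0`.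
  have hη' : 0 < η / (A + 1) := by positivity
  have hc : ContinuousAt m.meanSlope (θ₀, 0) := hm.contDiff_meanSlope.continuous.continuousAt
  obtain ⟨δ, hδ, hslope⟩ := Metric.continuousAt_iff.1 hc _ hη'
  have h1 : ∀ᶠ p : L2 d L × ℝ in 𝓝 (0, θ₀), ‖convC hW p.1‖ < δ := by
    have : Continuous fun p : L2 d L × ℝ => ‖convC hW p.1‖ :=
      ((convC hW).continuous.comp continuous_fst).norm
    refine this.continuousAt.eventually (gt_mem_nhds ?_)
    simpa using hδ
  have h2 : ∀ᶠ p : L2 d L × ℝ in 𝓝 (0, θ₀), dist p.2 θ₀ < δ :=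
    continuous_snd.continuousAt.eventually (Metric.ball_mem_nhds _ hδ)
  filter_upwards [h1, h2] with p hp1 hp2 hp
  have h3 : p.1 - m.gain θ₀ • convL hW p.1 =
      toL2 ((hm.slopeC p.2).comp (convC hW p.1) - m.gain θ₀ • convC hW p.1) := by
    rw [map_sub, map_smul, ← hp]; rfl
  have h4 : ‖(hm.slopeC p.2).comp (convC hW p.1) - m.gain θ₀ • convC hW p.1‖ ≤
      η / (A + 1) * ‖convC hW p.1‖ := by
    rw [ContinuousMap.norm_le _ (by positivity)]
    intro x
    have hx := (convC hW p.1).norm_coe_le_norm x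
    have h5 : dist (p.2, convC hW p.1 x) (θ₀, (0 : ℝ)) < δ := by
      rw [Prod.dist_eq, max_lt_iff]
      exact ⟨hp2, by rw [dist_zero_right]; exact hx.trans_lt hp1⟩
    have h6 := hslope h5
    rw [meanSlope_zero, Real.dist_eq] at h6
    have h7 : ((hm.slopeC p.2).comp (convC hW p.1) - m.gain θ₀ • convC hW p.1) x =
        (m.meanSlope (p.2, convC hW p.1 x) - m.gain θ₀) * convC hW p.1 x := by
      rw [ContinuousMap.sub_apply, ContinuousMap.comp_apply, slopeC_apply,
        ContinuousMap.smul_apply, smul_eq_mul]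
      ring
    rw [h7, norm_mul]
    exact mul_le_mul h6.le hx (norm_nonneg _) hη'.le
  rw [h3]
  calc _ ≤ ‖toL2 (d := d) (L := L)‖ * (η / (A + 1) * (‖convC hW‖ * ‖p.1‖)) := by
        refine (toL2.le_opNorm _).trans (mul_le_mul_of_nonneg_left (h4.trans ?_) (norm_nonneg _))
        exact mul_le_mul_of_nonneg_left ((convC hW).le_opNorm _) hη'.le
    _ = A / (A + 1) * (η * ‖p.1‖) := by rw [hA]; ring
    _ ≤ 1 * (η * ‖p.1‖) := by
        refine mul_le_mul_of_nonneg_right ?_ (by positivity)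
        rw [div_le_one (by positivity)]; linarith
    _ = _ := one_mul _

omit hW in
-- A neighbourhood statement in the coordinates (deviation from the branch at the same `κ`, `log κ`)
-- becomes one in `(q, κ)`, because the branch and the logarithm are continuous.
theorem exists_ball {P : L2 d L × ℝ → Prop} {κ₀ : ℝ} (hκ₀ : 0 < κ₀)
    (hP : ∀ᶠ p in 𝓝 (0, Real.log κ₀), P p) :
    ∃ ε > 0, ∀ q : L2 d L, ∀ κ > 0, ‖q - m.homState κ₀‖ < ε → |κ - κ₀| < ε →
      P (q - m.homState κ, Real.log κ) := by
  have hh : ∀ κ > 0, m.homState κ = constL2 d L (m.branch (Real.log κ)) := by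
    intro κ hκ
    rw [constL2_apply, branch, Real.exp_log hκ]; rfl
  have hc : ContinuousAt (fun p : L2 d L × ℝ =>
      ((p.1 - constL2 d L (m.branch (Real.log p.2)), Real.log p.2) : L2 d L × ℝ))
      (m.homState κ₀, κ₀) := by
    have hlog : ContinuousAt (fun p : L2 d L × ℝ => Real.log p.2) (m.homState κ₀, κ₀) :=
      continuousAt_snd.log hκ₀.ne'
    exact (continuousAt_fst.sub (((constL2 d L).continuous.comp
      hm.contDiff_branch.continuous).continuousAt.comp hlog)).prodMk hlog
  have hlim := hc.tendsto
  rw [← hh κ₀ hκ₀, sub_self] at hlim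
  obtain ⟨ε, hε, h⟩ := Metric.eventually_nhds_iff.1 (hlim.eventually hP)
  refine ⟨ε, hε, fun q κ hκ h1 h2 => ?_⟩
  rw [hh κ hκ]
  refine @h (q, κ) ?_
  rw [Prod.dist_eq, max_lt_iff, dist_eq_norm, Real.dist_eq]
  exact ⟨h1, h2⟩

theorem isZero_iff_sub {q : L2 d L} {κ : ℝ} (hκ : 0 < κ) :
    m.IsZero q κ ↔ q - m.homState κ =
      toL2 ((hm.slopeC (Real.log κ)).comp (convC hW (q - m.homState κ))) := by
  rw [← hm.isZero_iff hW, Real.exp_log hκ]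
  have : constL2 d L (m.branch (Real.log κ)) = m.homState κ := by
    rw [constL2_apply, branch, Real.exp_log hκ]; rfl
  rw [this, add_sub_cancel]

include hW in
/-- Below the first bifurcation value the homogeneous branch is locally isolated. -/
theorem isLocallyHomogeneous {X : Set (L2 d L)} {κ₀ μ : ℝ} (hκ₀ : 0 < κ₀)
    (hμ : ∀ h : L2 d L, inner ℝ h (convL hW h) ≤ μ * ‖h‖ ^ 2)
    (hlt : m.gain (Real.log κ₀) * μ < 1) : m.IsLocallyHomogeneous X κ₀ := by
  set a := m.gain (Real.log κ₀) with ha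
  have ha0 : 0 ≤ a := hm.gain_nonneg _
  -- Pairing the defect with `p` gives `(1 - aμ)‖p‖²` from below; allowing a defect of half the
  -- coercivity constant forces `p = 0`.
  have hη : 0 < (1 - a * μ) / 2 := by linarith
  obtain ⟨ε, hε, h⟩ := hm.exists_ball hκ₀ (hm.eventually_norm_sub_le hW (Real.log κ₀) hη)
  refine ⟨ε, hε, fun q _ κ hκ h1 h2 hz => ?_⟩
  have h3 := h q κ hκ h1 h2 ((hm.isZero_iff_sub hW hκ).1 hz)
  simp only at h3
  set p := q - m.homState κ with hp
  have h4 : inner ℝ p (p - a • convL hW p) = ‖p‖ ^ 2 - a * inner ℝ p (convL hW p) := by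
    rw [inner_sub_right, inner_smul_right, real_inner_self_eq_norm_sq]
  have h5 : inner ℝ p (p - a • convL hW p) ≤ ‖p‖ * ((1 - a * μ) / 2 * ‖p‖) :=
    (real_inner_le_norm _ _).trans (mul_le_mul_of_nonneg_left h3 (norm_nonneg _))
  have h6 := mul_le_mul_of_nonneg_left (hμ p) ha0
  have h7 : ‖p‖ ^ 2 * ((1 - a * μ) / 2) ≤ 0 := by nlinarith
  have h8 : ‖p‖ ^ 2 ≤ 0 := by
    by_contra hc
    exact absurd h7 (not_le.2 (mul_pos (not_le.1 hc) hη))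
  have h9 : ‖p‖ = 0 := by nlinarith [norm_nonneg p]
  exact sub_eq_zero.1 (norm_eq_zero.1 h9)

end Admissible
end Model

/-! ### Quadratic form estimates in a space with simple top eigenvalue. -/

section SimpleTop

variable {W : Torus d L → ℝ} {hW : MemLp W 2 volume} {μ μ' : ℝ} {X : Submodule ℝ (L2 d L)}
  {e : L2 d L}

namespace IsSimpleTop

variable (hX : IsSimpleTop hW μ μ' X e)
include hX

theorem convL_mem {u : L2 d L} (hu : u ∈ X) : convL hW u ∈ X :=
  hX.comp_mem u hu (ContinuousMap.id ℝ)

/-- Constants arise by taking a constant nonlinearity in `comp_mem`. -/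
theorem const_mem (c : ℝ) : constL2 d L c ∈ X := by
  rw [← toL2_const]
  exact hX.comp_mem 0 X.zero_mem (ContinuousMap.const ℝ c)

theorem inner_self : inner ℝ e e = 1 := by
  rw [real_inner_self_eq_norm_sq, hX.norm_eq, one_pow]

theorem orthogonal (w : L2 d L) : inner ℝ (w - inner ℝ w e • e) e = 0 := by
  rw [inner_sub_left, inner_smul_left, hX.inner_self]; simp

theorem norm_sq_sub (w : L2 d L) :
    ‖w - inner ℝ w e • e‖ ^ 2 = ‖w‖ ^ 2 - inner ℝ w e ^ 2 := by
  rw [← real_inner_self_eq_norm_sq, inner_sub_right, inner_smul_right, hX.orthogonal,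
    inner_sub_left, inner_smul_left, real_inner_self_eq_norm_sq, real_inner_comm w e]
  simp; ring

variable (heven : CoordEven W)
include heven

theorem inner_eigenvector (w : L2 d L) : inner ℝ (convL hW w) e = μ * inner ℝ w e := by
  rw [inner_convL_comm hW heven, hX.eigenvector, inner_smul_right]

/-- Splitting `w` along `e` and its orthogonal complement produces no cross terms, since `e` is an
eigenvector of a symmetric operator; the gap applies to the complement. -/
theorem inner_convL_le {w : L2 d L} (hw : w ∈ X) :
    inner ℝ w (convL hW w) ≤ μ * inner ℝ w e ^ 2 + μ' * (‖w‖ ^ 2 - inner ℝ w e ^ 2) := by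
  set s := inner ℝ w e with hs
  have h1 := hX.gap (w - s • e) (X.sub_mem hw (X.smul_mem s hX.mem)) (hX.orthogonal w)
  rw [hX.norm_sq_sub] at h1
  have h2 : inner ℝ (w - s • e) (convL hW (w - s • e)) = inner ℝ w (convL hW w) - μ * s ^ 2 := by
    rw [map_sub, map_smul, hX.eigenvector, inner_sub_right, inner_smul_right, inner_smul_right,
      hX.orthogonal, inner_sub_left, inner_smul_left, real_inner_comm _ e,
      hX.inner_eigenvector heven]
    simp [← hs]; ring
  linarith

/-- The linearised operator, made invertible on the eigenvector. -/
theorem coercive {a : ℝ} (ha : a * μ = 1) (ha0 : 0 ≤ a) (hμ' : 0 ≤ μ') {w : L2 d L} (hw : w ∈ X) :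
    (1 - a * μ') * ‖w‖ ^ 2 ≤ ‖w‖ ^ 2 - a * inner ℝ w (convL hW w) + inner ℝ w e ^ 2 := by
  have h1 := mul_le_mul_of_nonneg_left (hX.inner_convL_le heven hw) ha0
  have h2 : a * (μ * inner ℝ w e ^ 2 + μ' * (‖w‖ ^ 2 - inner ℝ w e ^ 2)) =
    (a * μ) * inner ℝ w e ^ 2 + a * μ' * ‖w‖ ^ 2 - a * μ' * inner ℝ w e ^ 2 := by ring
  rw [h2, ha] at h1
  have := mul_nonneg (mul_nonneg ha0 hμ') (sq_nonneg (inner ℝ w e))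
  linarith

end IsSimpleTop
end SimpleTop

end NeuralField

/-! ### Abstract bifurcation from a simple crossing. -/

namespace NeuralField

section AbstractBifurcation

variable {X : Type*} [NormedAddCommGroup X] [InnerProductSpace ℝ X] [CompleteSpace X]

/-- A coercive perturbation of the identity is invertible. -/
theorem exists_apply_eq_of_coercive (T : X →L[ℝ] X) {c : ℝ} (hc : 0 < c)
    (hT : ∀ w, c * ‖w‖ ^ 2 ≤ inner ℝ w (T w)) (y : X) : ∃ w, T w = y := by
  -- The solution is provided by the Lax–Milgram theorem.
  have hco : IsCoercive ((innerSL ℝ).comp T : X →L[ℝ] X →L[ℝ] ℝ) := by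
    refine ⟨c, hc, fun u => ?_⟩
    have := hT u
    rw [real_inner_comm] at this
    simpa [mul_assoc, sq] using this
  refine ⟨hco.continuousLinearEquivOfBilin.symm y, ?_⟩
  set v := hco.continuousLinearEquivOfBilin.symm y with hv
  refine ext_inner_right ℝ fun w => ?_
  have := hco.continuousLinearEquivOfBilin_apply v w
  rw [hv, ContinuousLinearEquiv.apply_symm_apply, ← hv] at this
  rw [this]; rfl

/-- Local bifurcation from a simple eigenvalue crossing with nonzero speed, for the equation
`w = F (z, (w, θ))` obtained by blowing up a branch of trivial solutions. -/
theorem exists_curve_of_simple_crossing {F : ℝ × (X × ℝ) → X} (hF : ContDiff ℝ 1 F)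
    (A : X →L[ℝ] X) {a : ℝ → ℝ} {a' θ₀ μ c : ℝ} {e : X} (hF0 : ∀ w θ, F (0, (w, θ)) = a θ • A w)
    (ha : HasDerivAt a a' θ₀) (ha' : a' ≠ 0) (he : inner ℝ e e = (1 : ℝ)) (hAe : A e = μ • e)
    (hAs : ∀ w, inner ℝ (A w) e = μ * inner ℝ w e) (haμ : a θ₀ * μ = 1) (hc : 0 < c)
    (hco : ∀ w, c * ‖w‖ ^ 2 ≤ ‖w‖ ^ 2 - a θ₀ * inner ℝ w (A w) + inner ℝ w e ^ 2) :
    ∃ δ > 0, ∃ ψ : ℝ → X × ℝ, ContDiffOn ℝ 1 ψ (Set.Ioo (-δ) δ) ∧ ψ 0 = (e, θ₀) ∧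
      (∀ z ∈ Set.Ioo (-δ) δ, (ψ z).1 = F (z, ψ z) ∧ inner ℝ (ψ z).1 e = 1) ∧
      ∃ ε > 0, ∀ z w θ, |z| < ε → ‖w - e‖ < ε → |θ - θ₀| < ε → w = F (z, (w, θ)) →
        inner ℝ w e = 1 → z ∈ Set.Ioo (-δ) δ ∧ ψ z = (w, θ) := by
  have hμ : μ ≠ 0 := fun h => by simp [h] at haμ
  -- The second component fixes the amplitude of `w` along `e` and balances the extra unknown `θ`;
  -- the solutions sought are those of `H = (0, 1)`.
  set H : ℝ × (X × ℝ) → X × ℝ := fun p => (p.2.1 - F p, inner ℝ e p.2.1) with hH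
  set u : ℝ × (X × ℝ) := (0, (e, θ₀)) with hu
  have hHc : ContDiff ℝ 1 H :=
    ((contDiff_fst.comp contDiff_snd).sub hF).prodMk
      ((innerSL ℝ e).contDiff.comp (contDiff_fst.comp contDiff_snd))
  have hHu : H u = (0, 1) := by
    refine Prod.ext ?_ he
    change e - F (0, (e, θ₀)) = 0
    rw [hF0, hAe, smul_smul, haμ, one_smul, sub_self]
  have hcd : ContDiffAt ℝ 1 H u := hHc.contDiffAt
  -- the partial derivative
  set D : X × ℝ →L[ℝ] X × ℝ :=
    (ContinuousLinearMap.fst ℝ X ℝ - (a θ₀ • A.comp (ContinuousLinearMap.fst ℝ X ℝ) +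
      ((a' • ContinuousLinearMap.snd ℝ X ℝ).smulRight (A e)))).prod
      ((innerSL ℝ e).comp (ContinuousLinearMap.fst ℝ X ℝ)) with hD
  have hder : HasFDerivAt (fun v : X × ℝ => H (0, v)) D (e, θ₀) := by
    have h1 : (fun v : X × ℝ => H (0, v)) =
        fun v => (v.1 - a v.2 • A v.1, inner ℝ e v.1) := by
      ext v <;> simp [hH, hF0]
    rw [h1]
    have h2 : HasFDerivAt (fun v : X × ℝ => a v.2) (a' • ContinuousLinearMap.snd ℝ X ℝ)
        (e, θ₀) :=
      HasDerivAt.comp_hasFDerivAt (x := ((e, θ₀) : X × ℝ)) (h₂ := a) ha hasFDerivAt_snd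
    have h3 : HasFDerivAt (fun v : X × ℝ => A v.1) (A.comp (ContinuousLinearMap.fst ℝ X ℝ))
        (e, θ₀) := (A.comp (ContinuousLinearMap.fst ℝ X ℝ)).hasFDerivAt
    exact (hasFDerivAt_fst.sub (h2.smul h3)).prodMk
      (((innerSL ℝ e).comp (ContinuousLinearMap.fst ℝ X ℝ)).hasFDerivAt)
  have hDeq : fderiv ℝ H u ∘L .inr ℝ ℝ (X × ℝ) = D := by
    have h1 : HasFDerivAt (fun v : X × ℝ => H (0, v)) (fderiv ℝ H u ∘L .inr ℝ ℝ (X × ℝ)) (e, θ₀) :=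
      HasFDerivAt.comp (g := H) (e, θ₀)
        (hcd.differentiableAt one_ne_zero).hasFDerivAt (hasFDerivAt_prodMk_right 0 (e, θ₀))
    exact h1.unique hder
  have hDapp : ∀ w t, D (w, t) = (w - (a θ₀ • A w + (a' * t) • μ • e), inner ℝ e w) := by
    intro w t
    simp [hD, hAe]
  have hinv : (fderiv ℝ H u ∘L .inr ℝ ℝ (X × ℝ)).IsInvertible := by
    rw [hDeq]
    refine ContinuousLinearMap.IsInvertible.of_bijective (f := D) ⟨?_, ?_⟩
    · refine (injective_iff_map_eq_zero D).2 ?_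
      rintro ⟨w, t⟩ h
      rw [hDapp, Prod.mk_eq_zero] at h
      obtain ⟨h1, h2⟩ := h
      rw [real_inner_comm] at h2
      -- Testing with `e` annihilates `w - a θ₀ • A w`, as `a θ₀ μ = 1`, and leaves `a' t μ = 0`, so
      -- `t = 0`; coercivity then gives `w = 0`.
      have h3 : inner ℝ (w - (a θ₀ • A w + (a' * t) • μ • e)) e = (0 : ℝ) := by
        rw [h1, inner_zero_left]
      rw [inner_sub_left, inner_add_left, inner_smul_left, inner_smul_left, inner_smul_left, hAs,
        h2, he] at h3
      have h4 : t = 0 := by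
        have : a' * t * μ = 0 := by simpa using h3
        simpa [ha', hμ] using this
      subst h4
      have h5 : inner ℝ w (w - (a θ₀ • A w + (a' * 0) • μ • e)) = (0 : ℝ) := by
        rw [h1, inner_zero_right]
      rw [mul_zero, zero_smul, add_zero, inner_sub_right, inner_smul_right,
        real_inner_self_eq_norm_sq] at h5
      have h6 := hco w
      rw [h2, h5] at h6
      have h7 : ‖w‖ ^ 2 ≤ 0 := by
        by_contra hn
        nlinarith [mul_pos hc (not_le.1 hn)]
      have h8 : ‖w‖ = 0 := by nlinarith [norm_nonneg w]
      rw [norm_eq_zero.1 h8]; rfl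
    · rintro ⟨x, r⟩
      -- Adding the rank-one projection onto `e` removes the kernel, and `hco` says precisely that
      -- `T` is coercive.
      set T : X →L[ℝ] X := ContinuousLinearMap.id ℝ X - a θ₀ • A + (innerSL ℝ e).smulRight e with hT
      have hTapp : ∀ w, T w = w - a θ₀ • A w + (inner ℝ e w : ℝ) • e := fun w => by simp [hT]
      -- This is the solvability condition: `x + a' t μ e` is orthogonal to `e`.
      set t := -(inner ℝ x e : ℝ) / (a' * μ) with ht
      obtain ⟨w, hw⟩ := exists_apply_eq_of_coercive T hc (fun w => by
        rw [hTapp, inner_add_right, inner_sub_right, inner_smul_right, inner_smul_right,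
          real_inner_self_eq_norm_sq, real_inner_comm w e, ← sq]
        exact hco w) (x + (a' * t * μ + r) • e)
      rw [hTapp] at hw
      have h1 : (inner ℝ w e : ℝ) = r := by
        have := congrArg (fun v => (inner ℝ v e : ℝ)) hw
        simp only [inner_add_left, inner_sub_left, inner_smul_left, hAs, he,
          real_inner_comm w e] at this
        have h2 : a' * t * μ = -inner ℝ x e := by rw [ht]; field_simp
        simp only [RCLike.conj_to_real, ← mul_assoc, haμ, h2] at this
        linarith
      refine ⟨(w, t), ?_⟩
      rw [hDapp]
      rw [real_inner_comm w e, h1] at hw ⊢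
      refine Prod.ext ?_ rfl
      have h3 : w - a θ₀ • A w = x + (a' * t * μ) • e := by
        have := eq_sub_of_add_eq hw
        rw [this, add_smul]; abel
      calc w - (a θ₀ • A w + (a' * t) • μ • e) = (w - a θ₀ • A w) - (a' * t * μ) • e := by
            rw [smul_smul]; abel
        _ = x := by rw [h3]; abel
  have h10 : (1 : WithTop ℕ∞) ≠ 0 := one_ne_zero
  set ψ := hcd.implicitFunction h10 hinv with hψ
  have hψ0 : ψ 0 = (e, θ₀) := hcd.implicitFunction_apply_self h10 hinv
  have hsol : ∀ᶠ z in 𝓝 (0 : ℝ), H (z, ψ z) = (0, 1) := by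
    have := hcd.eventually_apply_implicitFunction h10 hinv
    rwa [hHu] at this
  have hiff : ∀ᶠ v in 𝓝 u, H v = (0, 1) ↔ ψ v.1 = v.2 := by
    have := hcd.eventually_apply_eq_iff_implicitFunction h10 hinv
    rwa [hHu] at this
  have hsm : ∀ᶠ z in 𝓝 (0 : ℝ), ContDiffAt ℝ 1 ψ z :=
    (hcd.contDiffAt_implicitFunction h10 hinv).eventually (by simp)
  obtain ⟨δ, hδ, hball⟩ := Metric.eventually_nhds_iff.1 (hsol.and hsm)
  have hmem : ∀ z ∈ Set.Ioo (-δ) δ, dist z 0 < δ := fun z hz => by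
    rw [Real.dist_eq, sub_zero]; exact abs_lt.2 hz
  obtain ⟨ε, hε, hloc⟩ := Metric.eventually_nhds_iff.1 hiff
  refine ⟨δ, hδ, ψ, fun z hz => (hball (hmem z hz)).2.contDiffWithinAt, hψ0, fun z hz => ?_,
    -- Taking the minimum with `δ` also keeps `z` in the interval on which the curve is defined.
    min ε δ, lt_min hε hδ, fun z w θ hz hw hθ h1 h2 => ?_⟩
  · have := (hball (hmem z hz)).1
    rw [hH, Prod.mk.injEq] at this
    exact ⟨sub_eq_zero.1 this.1, by rw [real_inner_comm]; exact this.2⟩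
  · refine ⟨abs_lt.1 (hz.trans_le (min_le_right _ _)), ?_⟩
    have hd : dist (z, (w, θ)) u < ε := by
      rw [hu, Prod.dist_eq, Prod.dist_eq, max_lt_iff, max_lt_iff, dist_eq_norm, dist_eq_norm,
        Real.dist_eq, sub_zero, Real.norm_eq_abs]
      exact ⟨hz.trans_le (min_le_left _ _), hw.trans_le (min_le_left _ _),
        hθ.trans_le (min_le_left _ _)⟩
    refine (hloc hd).1 ?_
    rw [hH, Prod.mk.injEq]
    exact ⟨sub_eq_zero.2 h1, by rw [real_inner_comm]; exact h2⟩

end AbstractBifurcation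

/-! ### The blown-up equation and local bifurcation in the model. -/

variable {d : ℕ} {L : ℝ} [hL : Fact (0 < L)]

/-- Constants are eigenvectors with eigenvalue `∫ W`, which differs from `μ`, and `W∗` is symmetric.
Pairing with `e` will therefore detect that the bifurcating states are not constant. -/
theorem IsSimpleTop.inner_const {W : Torus d L → ℝ} {hW : MemLp W 2 volume} {μ μ' : ℝ}
    {X : Submodule ℝ (L2 d L)} {e : L2 d L} (hX : IsSimpleTop hW μ μ' X e) (heven : CoordEven W)
    (hne : ∫ x, W x ≠ μ) (c : ℝ) : inner ℝ (constL2 d L c) e = (0 : ℝ) := by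
  have h := hX.inner_eigenvector heven (constL2 d L c)
  rw [convL_const, inner_smul_left] at h
  have h2 : ((∫ x, W x) - μ) * inner ℝ (constL2 d L c) e = 0 := by
    rw [sub_mul, ← h]; simp
  exact (mul_eq_zero.1 h2).resolve_left (sub_ne_zero.2 hne)

namespace Model
namespace Admissible

variable {m : Model d L} (hm : m.Admissible) (hW : MemLp m.W 2 volume)
include hm

/-- The nonlinearity of the blown-up equation, as a function of `(θ, z, b)`. -/
def blowup : C(ℝ × ℝ × ℝ, ℝ) :=
  ⟨fun p => m.meanSlope (p.1, p.2.1 * p.2.2) * p.2.2,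
    (hm.contDiff_meanSlope.continuous.comp (by fun_prop)).mul (by fun_prop)⟩

theorem contDiff_blowup : ContDiff ℝ 1 hm.blowup :=
  (hm.contDiff_meanSlope.comp (contDiff_fst.prodMk
    ((contDiff_fst.comp contDiff_snd).mul (contDiff_snd.comp contDiff_snd)))).mul
    (contDiff_snd.comp contDiff_snd)

omit hm in
/-- The arguments of the nonlinearity of the blown-up equation. -/
def blowupArg (p : ℝ × (L2 d L × ℝ)) : C(Torus d L, ℝ × ℝ × ℝ) :=
  p.2.2 • ContinuousMap.const _ (1, 0, 0) + p.1 • ContinuousMap.const _ (0, 1, 0) +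
    ContinuousLinearMap.compLeftContinuous ℝ (Torus d L)
      ((ContinuousLinearMap.inr ℝ ℝ (ℝ × ℝ)).comp (ContinuousLinearMap.inr ℝ ℝ ℝ)) (convC hW p.2.1)

omit hm in
theorem blowupArg_apply (p : ℝ × (L2 d L × ℝ)) (x : Torus d L) :
    blowupArg hW p x = (p.2.2, p.1, convC hW p.2.1 x) := by
  simp [blowupArg]

omit hm in
theorem contDiff_blowupArg : ContDiff ℝ 1 (blowupArg hW) := by
  refine ContDiff.add (ContDiff.add ?_ ?_) ?_
  · exact (contDiff_snd.comp contDiff_snd).smul contDiff_const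
  · exact contDiff_fst.smul contDiff_const
  · exact (ContinuousLinearMap.contDiff _).comp
      ((convC hW).contDiff.comp (contDiff_fst.comp contDiff_snd))

/-- The right-hand side of the blown-up equation. -/
def blowupMap (p : ℝ × (L2 d L × ℝ)) : L2 d L := toL2 (hm.blowup.comp (blowupArg hW p))

theorem contDiff_blowupMap : ContDiff ℝ 1 (hm.blowupMap hW) :=
  (ContinuousLinearMap.contDiff _).comp
    ((contDiff_superposition hm.blowup hm.contDiff_blowup).comp (contDiff_blowupArg hW))

theorem blowupMap_zero (w : L2 d L) (θ : ℝ) :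
    hm.blowupMap hW (0, (w, θ)) = m.gain θ • convL hW w := by
  rw [blowupMap, convL, ContinuousLinearMap.comp_apply, ← map_smul]
  congr 1
  ext x
  rw [ContinuousMap.comp_apply, blowupArg_apply]
  change m.meanSlope (θ, 0 * convC hW w x) * convC hW w x = m.gain θ * convC hW w x
  rw [zero_mul, meanSlope_zero]

/-- Multiplication by `z` turns the blown-up equation for `w` back into the equation for the
deviation `z • w`. For `z ≠ 0` the two are equivalent. -/
theorem smul_blowupMap (z : ℝ) (w : L2 d L) (θ : ℝ) :
    z • hm.blowupMap hW (z, (w, θ)) = toL2 ((hm.slopeC θ).comp (convC hW (z • w))) := by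
  rw [blowupMap, ← map_smul]
  congr 1
  ext x
  rw [ContinuousMap.smul_apply, ContinuousMap.comp_apply, blowupArg_apply, ContinuousMap.comp_apply,
    slopeC_apply, map_smul]
  change z * (m.meanSlope (θ, z * convC hW w x) * convC hW w x) =
    m.meanSlope (θ, z * convC hW w x) * (z * convC hW w x)
  ring

variable {hW} {μ μ' : ℝ} {X : Submodule ℝ (L2 d L)} {e : L2 d L}

theorem blowupMap_mem (hX : IsSimpleTop hW μ μ' X e) (z : ℝ) {w : L2 d L} (hw : w ∈ X) (θ : ℝ) :
    hm.blowupMap hW (z, (w, θ)) ∈ X := by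
  have : hm.blowup.comp (blowupArg hW (z, (w, θ))) =
      (⟨fun b => hm.blowup (θ, z, b), by fun_prop⟩ : C(ℝ, ℝ)).comp (convC hW w) := by
    ext x
    rw [ContinuousMap.comp_apply, blowupArg_apply]; rfl
  rw [blowupMap, this]
  exact hX.comp_mem w hw _

/-- The curve of solutions of the blown-up equation. -/
theorem exists_blowup_curve (hX : IsSimpleTop hW μ μ' X e) (heven : CoordEven m.W)
    (hμ' : 0 ≤ μ') (hlt : μ' < μ) {θ₀ : ℝ} (hg : m.gain θ₀ * μ = 1) :
    ∃ δ > 0, ∃ ψ : ℝ → L2 d L × ℝ, ContDiffOn ℝ 1 ψ (Set.Ioo (-δ) δ) ∧ ψ 0 = (e, θ₀) ∧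
      (∀ z ∈ Set.Ioo (-δ) δ, (ψ z).1 ∈ X ∧ (ψ z).1 = hm.blowupMap hW (z, ψ z) ∧
        inner ℝ (ψ z).1 e = (1 : ℝ)) ∧
      ∃ ε > 0, ∀ z θ, ∀ w ∈ X, |z| < ε → ‖w - e‖ < ε → |θ - θ₀| < ε →
        w = hm.blowupMap hW (z, (w, θ)) → inner ℝ w e = (1 : ℝ) →
        z ∈ Set.Ioo (-δ) δ ∧ ψ z = (w, θ) := by
  have : CompleteSpace X := hX.isClosed.completeSpace_coe
  set P := X.orthogonalProjectionOnto with hP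
  have hPmem : ∀ {v : L2 d L} (hv : v ∈ X), P v = ⟨v, hv⟩ := fun {v} hv =>
    Submodule.orthogonalProjectionOnto_mem_subspace_eq_self (⟨v, hv⟩ : X)
  -- The projection only serves to give `F` values in the Hilbert space `X`; by `blowupMap_mem` it
  -- acts as the identity on them.
  set F : ℝ × (X × ℝ) → X := fun p => P (hm.blowupMap hW (p.1, ((p.2.1 : L2 d L), p.2.2))) with hF
  have hFc : ContDiff ℝ 1 F := by
    refine P.contDiff.comp ((hm.contDiff_blowupMap hW).comp (contDiff_fst.prodMk
      (ContDiff.prodMk ?_ (contDiff_snd.comp contDiff_snd))))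
    exact X.subtypeL.contDiff.comp (contDiff_fst.comp contDiff_snd)
  have ha0 : 0 ≤ m.gain θ₀ := hm.gain_nonneg _
  have hapos : 0 < m.gain θ₀ := ha0.lt_of_ne fun h => by simp [← h] at hg
  have hder : HasDerivAt m.gain (deriv m.gain θ₀) θ₀ :=
    (hm.contDiff_gain.differentiable one_ne_zero θ₀).hasDerivAt
  obtain ⟨δ, hδ, ψ, h1, h2, h3, ε, hε, h4⟩ := exists_curve_of_simple_crossing hFc
    (P.comp ((convL hW).comp X.subtypeL)) (a := m.gain) (θ₀ := θ₀) (μ := μ)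
    (c := 1 - m.gain θ₀ * μ') (e := (⟨e, hX.mem⟩ : X))
    (fun w θ => by
      change P (hm.blowupMap hW (0, ((w : L2 d L), θ))) = m.gain θ • P (convL hW (w : L2 d L))
      rw [blowupMap_zero, map_smul])
    hder (hm.deriv_gain_pos hapos).ne' hX.inner_self
    (by
      change P (convL hW e) = μ • (⟨e, hX.mem⟩ : X)
      rw [hX.eigenvector, map_smul, hPmem hX.mem])
    (fun w => by
      change inner ℝ (P (convL hW (w : L2 d L))) (⟨e, hX.mem⟩ : X) = μ * inner ℝ (w : L2 d L) e
      rw [hPmem (hX.convL_mem w.2)]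
      exact hX.inner_eigenvector heven _)
    hg
    (by
      have := mul_lt_mul_of_pos_left hlt hapos
      linarith)
    (fun w => by
      have := hX.coercive heven hg ha0 hμ' w.2
      change _ ≤ _ - m.gain θ₀ * inner ℝ w (P (convL hW (w : L2 d L))) + _
      rw [hPmem (hX.convL_mem w.2)]
      exact this)
  refine ⟨δ, hδ, fun z => ((ψ z).1, (ψ z).2), ?_, ?_, fun z hz => ⟨(ψ z).1.2, ?_, (h3 z hz).2⟩,
    ε, hε, fun z θ w hw hz hwe hθ hs he => ?_⟩
  · exact (X.subtypeL.contDiff.comp_contDiffOn (contDiff_fst.comp_contDiffOn h1)).prodMk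
      (contDiff_snd.comp_contDiffOn h1)
  · simp [h2]
  · have := congrArg Subtype.val (h3 z hz).1
    change ((ψ z).1 : L2 d L) = hm.blowupMap hW (z, ((ψ z).1 : L2 d L), (ψ z).2)
    refine this.trans ?_
    change ((P (hm.blowupMap hW (z, ((ψ z).1 : L2 d L), (ψ z).2)) : X) : L2 d L) = _
    rw [hPmem (hm.blowupMap_mem hX z (ψ z).1.2 (ψ z).2)]
  · obtain ⟨h5, h6⟩ := h4 z ⟨w, hw⟩ θ hz hwe hθ (by
      refine Subtype.ext ?_
      change w = P (hm.blowupMap hW (z, (w, θ)))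
      rw [hPmem (hm.blowupMap_mem hX z hw θ)]
      exact hs) he
    exact ⟨h5, by simp only [h6]⟩

omit hm in
-- On the complement of `e` the operator `1 - a W∗` is coercive with constant `1 - aμ'`, while its
-- effect on the `e`-component is orthogonal to that complement. A small defect therefore makes the
-- orthogonal part small relative to `h`.
theorem norm_sub_le_of_almost_solution (hX : IsSimpleTop hW μ μ' X e)
    {a τ : ℝ} (ha : 0 ≤ a) (hlt : a * μ' < 1) {h : L2 d L} (hh : h ∈ X)
    (hτ : ‖h - a • convL hW h‖ ≤ (1 - a * μ') * τ * ‖h‖) :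
    ‖h - (inner ℝ h e : ℝ) • e‖ ≤ τ * ‖h‖ := by
  set s : ℝ := inner ℝ h e with hs
  set y := h - s • e with hy
  have hyX : y ∈ X := X.sub_mem hh (X.smul_mem s hX.mem)
  have hye : inner ℝ y e = (0 : ℝ) := hX.orthogonal h
  have hey : inner ℝ e y = (0 : ℝ) := by rw [real_inner_comm]; exact hye
  have h1 := mul_le_mul_of_nonneg_left (hX.gap y hyX hye) ha
  have h2 : inner ℝ y (h - a • convL hW h) = ‖y‖ ^ 2 - a * inner ℝ y (convL hW y) := by
    have : h = y + s • e := by rw [hy]; abel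
    conv_lhs => rw [this]
    rw [map_add, map_smul, hX.eigenvector, inner_sub_right, inner_smul_right, inner_add_right,
      inner_add_right, inner_smul_right, inner_smul_right, inner_smul_right, hye,
      real_inner_self_eq_norm_sq]
    ring
  have h3 : inner ℝ y (h - a • convL hW h) ≤ ‖y‖ * ((1 - a * μ') * τ * ‖h‖) :=
    (real_inner_le_norm _ _).trans (mul_le_mul_of_nonneg_left hτ (norm_nonneg _))
  have hc : 0 < 1 - a * μ' := by linarith
  rcases (norm_nonneg y).eq_or_lt with h0 | hpos
  · have h5 : 0 ≤ (1 - a * μ') * (τ * ‖h‖) := by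
      rw [← mul_assoc]; exact (norm_nonneg _).trans hτ
    rw [← h0]
    exact nonneg_of_mul_nonneg_right h5 hc
  · have h4 : (‖y‖ * (1 - a * μ')) * ‖y‖ ≤ (‖y‖ * (1 - a * μ')) * (τ * ‖h‖) := by
      nlinarith
    exact le_of_mul_le_mul_left h4 (mul_pos hpos hc)

/-- Local bifurcation at the value where the simple top eigenvalue of the linearisation crosses
zero. -/
theorem isBifurcationPoint (hX : IsSimpleTop hW μ μ' X e) (heven : CoordEven m.W)
    (hμ : 0 < μ) (hμ' : 0 ≤ μ') (hlt : μ' < μ) {κ₀ : ℝ} (hκ₀ : 0 < κ₀)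
    (hg : m.gain (Real.log κ₀) * μ = 1) : m.IsBifurcationPoint X κ₀ := by
  set θ₀ := Real.log κ₀ with hθ₀
  have hhom : ∀ θ, m.homState (Real.exp θ) = constL2 d L (m.branch θ) := fun θ => rfl
  have ha0 : 0 ≤ m.gain θ₀ := hm.gain_nonneg _
  have hapos : 0 < m.gain θ₀ := ha0.lt_of_ne fun h => by simp [← h] at hg
  have haμ' : m.gain θ₀ * μ' < 1 := by
    have := mul_lt_mul_of_pos_left hlt hapos
    linarith
  have hconst : ∀ c, inner ℝ (constL2 d L c) e = (0 : ℝ) :=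
    hX.inner_const heven ((hm.W0_neg.trans hμ).ne)
  obtain ⟨δ, hδ, ψ, h1, h2, h3, ε, hε, h4⟩ := hm.exists_blowup_curve hX heven hμ' hlt hg
  refine ⟨hκ₀, δ, hδ, fun z => constL2 d L (m.branch (ψ z).2) + z • (ψ z).1,
    fun z => Real.exp (ψ z).2, ?_, ?_, ?_, ?_, fun z hz => ⟨?_, Real.exp_pos _, ?_⟩,
    fun z hz hz0 c hc => hz0 ?_, ?_⟩
  · exact ((constL2 d L).contDiff.comp_contDiffOn (hm.contDiff_branch.comp_contDiffOn
      (contDiff_snd.comp_contDiffOn h1))).add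
      (contDiffOn_id.smul (contDiff_fst.comp_contDiffOn h1))
  · exact Real.contDiff_exp.comp_contDiffOn (contDiff_snd.comp_contDiffOn h1)
  · simp only [h2]
    rw [zero_smul, add_zero, ← hhom, hθ₀, Real.exp_log hκ₀]
  · simp only [h2]
    rw [hθ₀, Real.exp_log hκ₀]
  · exact X.add_mem (hX.const_mem _) (X.smul_mem _ (h3 z hz).1)
  · refine (hm.isZero_iff hW _ _).2 ?_
    rw [← smul_blowupMap]
    exact congrArg (z • ·) (h3 z hz).2.1
  -- Pairing with `e` kills both constants and leaves `z = 0`, as `⟨w, e⟩ = 1` along the curve.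
  · rw [← constL2_apply] at hc
    have := congrArg (fun v => (inner ℝ v e : ℝ)) hc
    simp only [inner_add_left, hconst, inner_smul_left, (h3 z hz).2.2] at this
    simpa using this
  -- The bound `1/2` yields `‖p‖ ≤ 2|s|`; then `ε/4` gives `‖p - s e‖ ≤ ε|s|/2`, so that `s⁻¹ p` is
  -- within `ε` of `e` and the uniqueness of the blown-up curve applies with `z = s`.
  · set τ := min (1 / 2) (ε / 4) with hτ
    have hτ0 : 0 < τ := lt_min (by norm_num) (by linarith)
    have hη : 0 < (1 - m.gain θ₀ * μ') * τ := mul_pos (by linarith) hτ0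
    have hev1 : ∀ᶠ p : L2 d L × ℝ in 𝓝 (0, θ₀), ‖p.1‖ < ε := by
      refine (continuous_fst.norm.continuousAt).eventually (gt_mem_nhds ?_)
      simpa using hε
    have hev2 : ∀ᶠ p : L2 d L × ℝ in 𝓝 (0, θ₀), dist p.2 θ₀ < ε :=
      continuous_snd.continuousAt.eventually (Metric.ball_mem_nhds _ hε)
    obtain ⟨ε', hε', h⟩ := hm.exists_ball hκ₀
      ((hm.eventually_norm_sub_le hW θ₀ hη).and (hev1.and hev2))
    refine ⟨ε', hε', fun q hq κ hκ hq1 hq2 hz => ?_⟩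
    have hz' := (hm.isZero_iff_sub hW hκ).1 hz
    obtain ⟨h5, h6, h7⟩ := h q κ hκ hq1 hq2
    have h5 := h5 hz'
    simp only at h5 h6 h7
    have hhomκ : m.homState κ = constL2 d L (m.branch (Real.log κ)) := by
      rw [← hhom, Real.exp_log hκ]
    set p := q - m.homState κ with hp
    have hpX : p ∈ X := X.sub_mem hq (by rw [hhomκ]; exact hX.const_mem _)
    have h8 := norm_sub_le_of_almost_solution hX ha0 haμ' hpX h5
    set s : ℝ := inner ℝ p e with hs
    have h9 : ‖p‖ ≤ ‖p - s • e‖ + |s| := by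
      have := norm_add_le (p - s • e) (s • e)
      rwa [sub_add_cancel, norm_smul, hX.norm_eq, mul_one, Real.norm_eq_abs] at this
    have h10 : ‖p‖ ≤ 2 * |s| := by
      have := mul_le_mul_of_nonneg_right (min_le_left (1 / 2) (ε / 4)) (norm_nonneg p)
      linarith
    by_cases hs0 : s = 0
    · left
      rw [hs0, abs_zero, mul_zero] at h10
      exact sub_eq_zero.1 (norm_le_zero_iff.1 h10)
    · right
      have hs1 : |s| ≤ ‖p‖ := by
        have := abs_real_inner_le_norm p e
        rwa [hX.norm_eq, mul_one] at this
      have hspos : 0 < |s| := abs_pos.2 hs0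
      have h11 : ‖s⁻¹ • p - e‖ < ε := by
        have h12 : s⁻¹ • p - e = s⁻¹ • (p - s • e) := by
          rw [smul_sub _ p, smul_smul, inv_mul_cancel₀ hs0, one_smul]
        rw [h12, norm_smul, norm_inv, Real.norm_eq_abs, inv_mul_lt_iff₀ hspos]
        have h13 := mul_le_mul_of_nonneg_right (min_le_right (1 / 2) (ε / 4)) (norm_nonneg p)
        have h14 := mul_le_mul_of_nonneg_left h10 hε.le
        have h15 := mul_pos hspos hε
        nlinarith
      have h16 : s • s⁻¹ • p = p := by rw [smul_smul, mul_inv_cancel₀ hs0, one_smul]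
      obtain ⟨h17, h18⟩ := h4 s (Real.log κ) (s⁻¹ • p) (X.smul_mem _ hpX) (hs1.trans_lt h6) h11
        (by rw [← Real.dist_eq]; exact h7)
        (by
          refine (smul_right_injective (L2 d L) hs0) ?_
          simp only
          rw [smul_blowupMap, h16]
          exact hz')
        (by rw [inner_smul_left, ← hs]; simp [hs0])
      refine ⟨s, h17, ?_, ?_⟩
      · simp only [h18]
        rw [h16, hp, ← hhomκ, add_sub_cancel]
      · simp only [h18]
        rw [Real.exp_log hκ]

end Admissible
end Model

end NeuralField

namespace NeuralField

/-! ### Measures with a positive density -/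

section PosDensity

variable {α : Type*} [MeasurableSpace α] {μ : Measure α} {θ : α → ℝ}

theorem ae_posDensity_iff (hm : Measurable θ) (hpos : ∀ x, 0 < θ x) {p : α → Prop} :
    (∀ᵐ x ∂μ.withDensity fun x => ENNReal.ofReal (θ x), p x) ↔ ∀ᵐ x ∂μ, p x := by
  constructor
  · intro h
    refine (withDensity_absolutelyContinuous' hm.ennreal_ofReal.aemeasurable
      (ae_of_all _ fun x => ?_)).ae_le h
    simpa using hpos x
  · exact fun h => (withDensity_absolutelyContinuous _ _).ae_le h

theorem aestronglyMeasurable_posDensity_iff (hm : Measurable θ) (hpos : ∀ x, 0 < θ x) {f : α → ℝ} :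
    AEStronglyMeasurable f (μ.withDensity fun x => ENNReal.ofReal (θ x)) ↔
      AEStronglyMeasurable f μ := by
  constructor
  · refine fun h => h.mono_ac (withDensity_absolutelyContinuous' hm.ennreal_ofReal.aemeasurable
      (ae_of_all _ fun x => ?_))
    simpa using hpos x
  · exact fun h => h.mono_ac (withDensity_absolutelyContinuous _ _)

theorem integrable_posDensity_iff (hm : Measurable θ) (hpos : ∀ x, 0 < θ x) {f : α → ℝ} :
    Integrable f (μ.withDensity fun x => ENNReal.ofReal (θ x)) ↔
      Integrable (fun x => θ x * f x) μ := by
  rw [integrable_withDensity_iff_integrable_smul' hm.ennreal_ofReal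
    (ae_of_all _ fun x => ENNReal.ofReal_lt_top)]
  simp only [ENNReal.toReal_ofReal (hpos _).le, smul_eq_mul]

theorem integral_posDensity (hm : Measurable θ) (hpos : ∀ x, 0 < θ x) (f : α → ℝ) :
    ∫ x, f x ∂μ.withDensity (fun x => ENNReal.ofReal (θ x)) = ∫ x, θ x * f x ∂μ := by
  rw [integral_withDensity_eq_integral_toReal_smul hm.ennreal_ofReal
    (ae_of_all _ fun x => ENNReal.ofReal_lt_top)]
  simp only [ENNReal.toReal_ofReal (hpos _).le, smul_eq_mul]

theorem memLp_posDensity_iff (hm : Measurable θ) (hpos : ∀ x, 0 < θ x) {f : α → ℝ} :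
    MemLp f 2 (μ.withDensity fun x => ENNReal.ofReal (θ x)) ↔
      AEStronglyMeasurable f μ ∧ Integrable (fun x => θ x * f x ^ 2) μ := by
  rw [← aestronglyMeasurable_posDensity_iff hm hpos, ← integrable_posDensity_iff hm hpos]
  exact ⟨fun h => ⟨h.1, (memLp_two_iff_integrable_sq h.1).1 h⟩,
    fun h => (memLp_two_iff_integrable_sq h.1).2 h.2⟩

end PosDensity

theorem sq_integral_mul_le {α : Type*} [MeasurableSpace α] {μ : Measure α} {f g : α → ℝ}
    (hf : MemLp f 2 μ) (hg : MemLp g 2 μ) :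
    (∫ x, f x * g x ∂μ) ^ 2 ≤ (∫ x, f x ^ 2 ∂μ) * ∫ x, g x ^ 2 ∂μ := by
  have key : ∀ {u v : α → ℝ} (hu : MemLp u 2 μ) (hv : MemLp v 2 μ),
      inner ℝ (hu.toLp u) (hv.toLp v) = ∫ x, u x * v x ∂μ := by
    intro u v hu hv
    rw [L2.inner_def]
    refine integral_congr_ae ?_
    filter_upwards [hu.coeFn_toLp, hv.coeFn_toLp] with x hx hy
    rw [hx, hy]; simp [mul_comm]
  have h := real_inner_mul_inner_self_le (hf.toLp f) (hg.toLp g)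
  rw [key hf hg, key hf hf, key hg hg] at h
  simpa [sq] using h

/-! ### Primitives of locally integrable functions on the half line -/

/-- Integrability on bounded subintervals of the half line. -/
def IntegrableNear (q : ℝ → ℝ) : Prop := ∀ R, IntegrableOn q (Set.Ioo 0 R)

/-- The primitive `∫₀ˢ q`. -/
def prim (q : ℝ → ℝ) (s : ℝ) : ℝ := ∫ r in Set.Ioo 0 s, q r

namespace IntegrableNear

variable {q : ℝ → ℝ} (hq : IntegrableNear q)
include hq

theorem aestronglyMeasurable : AEStronglyMeasurable q (volume.restrict (Set.Ioi 0)) := by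
  have : Set.Ioi (0 : ℝ) = ⋃ n : ℕ, Set.Ioo 0 (n : ℝ) := by
    ext s
    simp only [Set.mem_Ioi, Set.mem_iUnion, Set.mem_Ioo]
    exact ⟨fun h => (exists_nat_gt s).imp fun n hn => ⟨h, hn⟩, fun ⟨n, h⟩ => h.1⟩
  rw [this, aestronglyMeasurable_iUnion_iff]
  exact fun n => (hq n).aestronglyMeasurable

theorem abs : IntegrableNear fun r => |q r| := fun R => (hq R).abs

theorem monotone_prim (h0 : ∀ r, 0 ≤ q r) : Monotone (prim q) := fun _ t hst =>
  setIntegral_mono_set (hq t) (ae_of_all _ h0)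
    (Set.Ioo_subset_Ioo_right hst).eventuallyLE

theorem prim_eq (s : ℝ) : prim q s = prim (fun r => |q r|) s - prim (fun r => |q r| - q r) s := by
  have h : prim (fun r => |q r| - q r) s = prim (fun r => |q r|) s - prim q s :=
    integral_sub (hq.abs s) (hq s)
  rw [h, sub_sub_cancel]

omit hq in
theorem abs_prim_le (s : ℝ) : |prim q s| ≤ prim (fun r => |q r|) s :=
  abs_integral_le_integral_abs

/-- The primitive is a difference of primitives of nonnegative functions, hence of monotone
functions. -/
theorem locallyIntegrable_prim : LocallyIntegrable (prim q) := by
  have h : prim q = fun s => prim (fun r => |q r|) s - prim (fun r => |q r| - q r) s :=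
    funext hq.prim_eq
  have h2 : IntegrableNear fun r => |q r| - q r := fun R => (hq.abs R).sub (hq R)
  rw [h]
  exact (hq.abs.monotone_prim fun r => abs_nonneg _).locallyIntegrable.sub
    (h2.monotone_prim fun r => sub_nonneg.2 (le_abs_self _)).locallyIntegrable

theorem near_prim : IntegrableNear (prim q) := fun R =>
  (hq.locallyIntegrable_prim.integrableOn_isCompact (isCompact_Icc (a := 0) (b := R))).mono_set
    Set.Ioo_subset_Icc_self

theorem integrableOn_mul {η : ℝ → ℝ} (hη : Continuous η) (hc : HasCompactSupport η) :
    IntegrableOn (fun s => q s * η s) (Set.Ioi 0) := by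
  obtain ⟨R, hR⟩ := hc.isCompact.isBounded.subset_closedBall 0
  obtain ⟨C, hC⟩ := hη.bounded_above_of_compact_support hc
  have h1 : IntegrableOn (fun s => q s * η s) (Set.Ioo 0 (R + 1)) :=
    (hq (R + 1)).mul_bdd hη.aestronglyMeasurable (ae_of_all _ hC)
  refine h1.of_forall_sdiff_eq_zero measurableSet_Ioi fun s hs => ?_
  have : η s = 0 := by
    by_contra hne
    have := hR (subset_tsupport _ hne)
    rw [Metric.mem_closedBall, Real.dist_eq, sub_zero] at this
    exact hs.2 ⟨hs.1, by linarith [le_abs_self s]⟩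
  rw [this, mul_zero]

/-- Fubini's theorem on a triangle. -/
theorem integral_mul_prim {g : ℝ → ℝ} (hg : AEStronglyMeasurable g (volume.restrict (Set.Ioi 0)))
    (hint : IntegrableOn (fun s => g s * prim (fun r => |q r|) s) (Set.Ioi 0)) :
    ∫ s in Set.Ioi 0, g s * prim q s = ∫ r in Set.Ioi 0, q r * ∫ s in Set.Ioi r, g s := by
  set F : ℝ → ℝ → ℝ := fun s r =>
    Set.indicator {p : ℝ × ℝ | p.2 < p.1} (fun p => g p.1 * q p.2) (s, r) with hF
  have hF1 : ∀ s, F s = (Set.Iio s).indicator fun r => g s * q r := by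
    intro s; ext r
    simp only [hF, Set.indicator_apply, Set.mem_ofPred, Set.mem_Iio]
  have hF2 : ∀ r, (fun s => F s r) = (Set.Ioi r).indicator fun s => g s * q r := by
    intro r; ext s
    simp only [hF, Set.indicator_apply, Set.mem_ofPred, Set.mem_Ioi]
  have hset : ∀ s : ℝ, Set.Ioi 0 ∩ Set.Iio s = Set.Ioo 0 s := fun s => rfl
  have hmeas : AEStronglyMeasurable (Function.uncurry F)
      ((volume.restrict (Set.Ioi (0 : ℝ))).prod (volume.restrict (Set.Ioi (0 : ℝ)))) :=
    (hg.comp_fst.mul hq.aestronglyMeasurable.comp_snd).indicator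
      (measurableSet_lt measurable_snd measurable_fst)
  have hFint : Integrable (Function.uncurry F)
      ((volume.restrict (Set.Ioi (0 : ℝ))).prod (volume.restrict (Set.Ioi (0 : ℝ)))) := by
    refine (integrable_prod_iff hmeas).2 ⟨ae_of_all _ fun s => ?_, ?_⟩
    · change Integrable (F s) _
      rw [hF1, integrable_indicator_iff measurableSet_Iio, IntegrableOn,
        Measure.restrict_restrict measurableSet_Iio, Set.inter_comm, hset]
      exact (hq s).const_mul _
    · refine hint.norm.congr (ae_of_all _ fun s => ?_)
      change _ = ∫ r in Set.Ioi 0, ‖F s r‖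
      simp only [hF1, norm_indicator_eq_indicator_norm, norm_mul]
      rw [setIntegral_indicator measurableSet_Iio, hset, integral_const_mul, prim, Real.norm_eq_abs
        (integral _ _), abs_of_nonneg (integral_nonneg fun r => abs_nonneg _)]
      rfl
  have hswap := integral_integral_swap hFint
  have hl : ∀ s, ∫ r in Set.Ioi 0, F s r = g s * prim q s := by
    intro s
    rw [hF1, setIntegral_indicator measurableSet_Iio, hset, integral_const_mul, prim]
  have hr : ∀ r ∈ Set.Ioi (0 : ℝ), ∫ s in Set.Ioi 0, F s r = q r * ∫ s in Set.Ioi r, g s := by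
    intro r hr
    have h0 : Set.Ioi (0 : ℝ) ∩ Set.Ioi r = Set.Ioi r :=
      Set.inter_eq_right.2 (Set.Ioi_subset_Ioi (le_of_lt hr))
    rw [show (fun s => F s r) = _ from hF2 r, setIntegral_indicator measurableSet_Ioi, h0,
      integral_mul_const, mul_comm]
  simp only [hl] at hswap
  rw [hswap]
  exact setIntegral_congr_fun measurableSet_Ioi hr

omit hq in
theorem integral_Ioi_deriv {η : ℝ → ℝ} (hη : ContDiff ℝ (⊤ : ℕ∞) η) (hc : HasCompactSupport η)
    (r : ℝ) : ∫ s in Set.Ioi r, deriv η s = -η r := by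
  have := hc.integral_Ioi_deriv_eq (hη.of_le (by exact_mod_cast le_top)) r
  exact this

/-- The test function need not vanish at the origin, because the primitive does. Fubini on the
triangle replaces integration by parts. -/
theorem integral_prim_mul_deriv {η : ℝ → ℝ} (hη : ContDiff ℝ (⊤ : ℕ∞) η)
    (hc : HasCompactSupport η) :
    ∫ s in Set.Ioi 0, prim q s * deriv η s = -∫ s in Set.Ioi 0, q s * η s := by
  have hd : Continuous (deriv η) := hη.continuous_deriv (by exact_mod_cast le_top)
  have h1 := hq.integral_mul_prim hd.aestronglyMeasurable (by
    refine (hq.abs.near_prim.integrableOn_mul hd hc.deriv).congr_fun (fun s _ => mul_comm _ _)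
      measurableSet_Ioi)
  simp only [integral_Ioi_deriv hη hc, mul_neg, integral_neg] at h1
  rw [← h1]
  exact integral_congr_ae (ae_of_all _ fun s => mul_comm _ _)

end IntegrableNear

/-- Smooth functions of mean zero supported in a compact interval have compactly supported
primitives. -/
theorem exists_antideriv {f : ℝ → ℝ} (hf : ContDiff ℝ (⊤ : ℕ∞) f) {a b : ℝ} (ha : 0 < a)
    (hsupp : Function.support f ⊆ Set.Icc a b) (h0 : ∫ s, f s = 0) :
    ∃ η : ℝ → ℝ, ContDiff ℝ (⊤ : ℕ∞) η ∧ HasCompactSupport η ∧ tsupport η ⊆ Set.Ioi 0 ∧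
      deriv η = f := by
  set η : ℝ → ℝ := fun s => ∫ r in (0 : ℝ)..s, f r with hη
  have hder : ∀ s, HasDerivAt η (f s) s := fun s =>
    (hf.continuous.integral_hasStrictDerivAt 0 s).hasDerivAt
  have hd : deriv η = f := funext fun s => (hder s).deriv
  have hz : ∀ s, s ∉ Set.Icc a b → f s = 0 := fun s hs => by
    by_contra hne; exact hs (hsupp hne)
  have hcs : HasCompactSupport f := HasCompactSupport.of_support_subset_isCompact isCompact_Icc hsupp
  have hint : Integrable f := hf.continuous.integrable_of_hasCompactSupport hcs
  have hηz : ∀ s, s ∉ Set.Icc a b → η s = 0 := by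
    intro s hs
    rw [Set.mem_Icc, not_and_or, not_le, not_le] at hs
    have hleft : ∀ t < a, η t = 0 := by
      intro t ht
      refine (intervalIntegral.integral_congr (g := fun _ => 0) fun r hr => ?_).trans (by simp)
      refine hz r fun h => ?_
      have := hr.2
      have h2 : max 0 t < a := max_lt ha ht
      exact absurd (h.1.trans this) (not_le.2 h2)
    rcases hs with hs | hs
    · exact hleft s hs
    · have h1 : ∫ r in Set.Iic s, f r = ∫ r, f r :=
        setIntegral_eq_integral_of_forall_compl_eq_zero fun r hr =>
          hz r fun h => hr (h.2.trans hs.le)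
      have h2 : ∫ r in Set.Iic (0 : ℝ), f r = 0 :=
        setIntegral_eq_zero_of_forall_eq_zero fun r hr =>
          hz r fun h => absurd (h.1.trans hr) (not_le.2 ha)
      rw [hη]
      simp only
      rw [← intervalIntegral.integral_Iic_sub_Iic hint.integrableOn hint.integrableOn, h1, h2, h0,
        sub_zero]
  have hts : tsupport η ⊆ Set.Icc a b :=
    closure_minimal (fun s hs => by by_contra h; exact hs (hηz s h)) isClosed_Icc
  refine ⟨η, ?_, isCompact_Icc.of_isClosed_subset (isClosed_tsupport _) hts,
    hts.trans fun s hs => ha.trans_le hs.1, hd⟩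
  rw [contDiff_infty_iff_deriv, hd]
  exact ⟨fun s => (hder s).differentiableAt, hf⟩

/-- The lemma of du Bois-Reymond on the half line. -/
theorem exists_ae_eq_const {w : ℝ → ℝ} (hw : IntegrableNear w)
    (h : ∀ η : ℝ → ℝ, ContDiff ℝ (⊤ : ℕ∞) η → HasCompactSupport η → tsupport η ⊆ Set.Ioi 0 →
      ∫ s in Set.Ioi 0, w s * deriv η s = 0) :
    ∃ c, ∀ᵐ s ∂volume.restrict (Set.Ioi (0 : ℝ)), w s = c := by
  -- A normalised bump supported in `[1, 3]`, away from the boundary; testing `w` with it gives the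
  -- constant.
  set bump : ContDiffBump (2 : ℝ) := ⟨1 / 2, 1, by norm_num, by norm_num⟩ with hbump
  set ω : ℝ → ℝ := bump.normed volume with hω
  have hωc : ContDiff ℝ (⊤ : ℕ∞) ω := bump.contDiff_normed
  have hωs : HasCompactSupport ω := bump.hasCompactSupport_normed
  have hω1 : ∫ s, ω s = 1 := bump.integral_normed
  have hωt : tsupport ω = Metric.closedBall 2 1 := bump.tsupport_normed_eq
  set c := ∫ s in Set.Ioi 0, w s * ω s with hc
  refine ⟨c, ?_⟩
  rw [ae_restrict_iff' measurableSet_Ioi]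
  have key : ∀ᵐ s, s ∈ Set.Ioi (0 : ℝ) → w s - c = 0 := by
    refine isOpen_Ioi.ae_eq_zero_of_integral_contDiff_smul_eq_zero ?_ ?_
    · intro s hs
      refine ⟨Set.Ioo 0 (s + 1), ?_, (hw _).sub (by simp)⟩
      exact mem_nhdsWithin_of_mem_nhds (Ioo_mem_nhds hs (by linarith))
    · intro g hg hgc hgt
      have hgint : Integrable g := hg.continuous.integrable_of_hasCompactSupport hgc
      have hωint : Integrable ω := hωc.continuous.integrable_of_hasCompactSupport hωs
      set K := tsupport g ∪ Metric.closedBall 2 1 with hK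
      have hKc : IsCompact K := hgc.isCompact.union (isCompact_closedBall _ _)
      have hKn : K.Nonempty := ⟨2, Or.inr (by simp)⟩
      obtain ⟨a, ha, ha'⟩ := hKc.exists_isLeast hKn
      obtain ⟨b, hb, hb'⟩ := hKc.exists_isGreatest hKn
      have ha0 : 0 < a := by
        rcases ha with h1 | h1
        · exact hgt h1
        · rw [Metric.mem_closedBall, Real.dist_eq, abs_le] at h1; linarith
      -- Subtracting the right multiple of the bump gives mean zero, so `f` is the derivative of an
      -- admissible test function.
      set f : ℝ → ℝ := fun s => g s - (∫ r, g r) * ω s with hf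
      obtain ⟨η, h1, h2, h3, h4⟩ := exists_antideriv (f := f) (a := a) (b := b)
        (hg.sub (contDiff_const.mul hωc)) ha0
        (by
          intro s hs
          have : s ∈ K := by
            by_contra hn
            rw [hK, Set.mem_union, not_or, ← hωt] at hn
            refine hs ?_
            rw [hf]
            simp only
            rw [image_eq_zero_of_notMem_tsupport hn.1, image_eq_zero_of_notMem_tsupport hn.2]
            simp
          exact ⟨ha' this, hb' this⟩)
        (by
          rw [hf, integral_sub hgint (hωint.const_mul _), integral_const_mul, hω1]; ring)
      have h5 := h η h1 h2 h3
      rw [h4] at h5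
      have i1 := hw.integrableOn_mul hg.continuous hgc
      have i2 := hw.integrableOn_mul hωc.continuous hωs
      have h6 : ∫ s in Set.Ioi 0, w s * g s = (∫ r, g r) * c := by
        have : ∀ s, w s * f s = w s * g s - (∫ r, g r) * (w s * ω s) := fun s => by
          simp only [hf]; ring
        simp only [this] at h5
        rw [integral_sub i1 (i2.const_mul _), integral_const_mul] at h5
        linarith
      have h7 : ∀ s, s ∉ Set.Ioi (0 : ℝ) → g s = 0 := fun s hs =>
        image_eq_zero_of_notMem_tsupport fun h => hs (hgt h)
      rw [← setIntegral_eq_integral_of_forall_compl_eq_zero (s := Set.Ioi (0 : ℝ))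
        (fun s hs => by rw [h7 s hs, zero_smul])]
      have h8 : ∫ r in Set.Ioi (0 : ℝ), g r = ∫ r, g r :=
        setIntegral_eq_integral_of_forall_compl_eq_zero h7
      have : ∀ s, g s • (w s - c) = w s * g s - g s * c := fun s => by
        rw [smul_eq_mul]; ring
      simp only [this]
      rw [integral_sub i1 (hgint.integrableOn.mul_const c), h6, integral_mul_const, h8, sub_self]
  filter_upwards [key] with s hs hs0
  exact sub_eq_zero.1 (hs hs0)

end NeuralField

namespace NeuralField

/-! ### Gaussian densities on the half line -/

/-- A multiple of the Gaussian weight. -/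
def gaussDensity (c κ φ s : ℝ) : ℝ := c * gaussWeight κ φ s

/-- The measure with density `1 / gaussDensity` on the half line. -/
def invMeasure (c κ φ : ℝ) : Measure ℝ :=
  (volume.restrict (Set.Ioi 0)).withDensity fun s => ENNReal.ofReal (gaussDensity c κ φ s)⁻¹

section GaussDensity

variable {c κ : ℝ} (hc : 0 < c) (hκ : 0 < κ) (φ : ℝ)

include hc in
theorem gaussDensity_pos (s : ℝ) : 0 < gaussDensity c κ φ s := mul_pos hc (gaussWeight_pos κ φ s)

theorem contDiff_gaussDensity : ContDiff ℝ (⊤ : ℕ∞) (gaussDensity c κ φ) := by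
  unfold gaussDensity gaussWeight; fun_prop

theorem continuous_gaussDensity : Continuous (gaussDensity c κ φ) :=
  (contDiff_gaussDensity φ).continuous

theorem hasDerivAt_gaussDensity (s : ℝ) :
    HasDerivAt (gaussDensity c κ φ) (-κ * (s - φ) * gaussDensity c κ φ s) s :=
  ((hasDerivAt_gaussWeight κ φ s).const_mul c).congr_deriv (by unfold gaussDensity; ring)

theorem measurable_inv_gaussDensity : Measurable fun s => (gaussDensity c κ φ s)⁻¹ :=
  (continuous_gaussDensity φ).measurable.inv

include hc in
theorem inv_gaussDensity_pos (s : ℝ) : 0 < (gaussDensity c κ φ s)⁻¹ :=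
  inv_pos.2 (gaussDensity_pos hc φ s)

include hκ in
theorem integrableOn_gaussDensity : IntegrableOn (gaussDensity c κ φ) (Set.Ioi 0) :=
  (integrableOn_gaussWeight hκ φ).const_mul c

include hκ in
theorem integrableOn_mul_gaussDensity :
    IntegrableOn (fun s => s * gaussDensity c κ φ s) (Set.Ioi 0) := by
  refine IntegrableOn.congr_fun ((integrableOn_mul_gaussWeight hκ φ).const_mul c)
    (fun s _ => ?_) measurableSet_Ioi
  unfold gaussDensity; ring

include hκ in
theorem integrableOn_sq_mul_gaussDensity :
    IntegrableOn (fun s => s ^ 2 * gaussDensity c κ φ s) (Set.Ioi 0) := by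
  refine IntegrableOn.congr_fun ((integrableOn_sq_mul_gaussWeight hκ φ).const_mul c)
    (fun s _ => ?_) measurableSet_Ioi
  unfold gaussDensity; ring

variable {φ}

include hc in
theorem memLp_invMeasure_iff {u : ℝ → ℝ} : MemLp u 2 (invMeasure c κ φ) ↔
    AEStronglyMeasurable u (volume.restrict (Set.Ioi 0)) ∧
      IntegrableOn (fun s => (gaussDensity c κ φ s)⁻¹ * u s ^ 2) (Set.Ioi 0) :=
  memLp_posDensity_iff (measurable_inv_gaussDensity φ) (inv_gaussDensity_pos hc φ)

include hc in
theorem integral_invMeasure (u : ℝ → ℝ) : ∫ s, u s ∂invMeasure c κ φ =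
    ∫ s in Set.Ioi 0, (gaussDensity c κ φ s)⁻¹ * u s :=
  integral_posDensity (measurable_inv_gaussDensity φ) (inv_gaussDensity_pos hc φ) u

include hc in
theorem ae_invMeasure_iff {p : ℝ → Prop} :
    (∀ᵐ s ∂invMeasure c κ φ, p s) ↔ ∀ᵐ s ∂volume.restrict (Set.Ioi (0 : ℝ)), p s :=
  ae_posDensity_iff (measurable_inv_gaussDensity φ) (inv_gaussDensity_pos hc φ)

include hc in
theorem inv_mul_sq_mul (s h : ℝ) : (gaussDensity c κ φ s)⁻¹ * (h * gaussDensity c κ φ s) ^ 2 =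
    h ^ 2 * gaussDensity c κ φ s := by
  have := (gaussDensity_pos hc (κ := κ) φ s).ne'
  field_simp

include hc in
theorem memLp_mul_gaussDensity {h : ℝ → ℝ} (hm : AEStronglyMeasurable h (volume.restrict (Set.Ioi 0)))
    (hi : IntegrableOn (fun s => h s ^ 2 * gaussDensity c κ φ s) (Set.Ioi 0)) :
    MemLp (fun s => h s * gaussDensity c κ φ s) 2 (invMeasure c κ φ) := by
  refine (memLp_invMeasure_iff hc).2
    ⟨hm.mul (continuous_gaussDensity φ).aestronglyMeasurable, ?_⟩
  simpa only [inv_mul_sq_mul hc] using hi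

include hc hκ in
theorem memLp_gaussDensity : MemLp (fun s => 1 * gaussDensity c κ φ s) 2 (invMeasure c κ φ) :=
  memLp_mul_gaussDensity hc aestronglyMeasurable_const (by
    simpa using integrableOn_gaussDensity (c := c) hκ φ)

include hc hκ in
theorem memLp_id_mul_gaussDensity :
    MemLp (fun s => s * gaussDensity c κ φ s) 2 (invMeasure c κ φ) :=
  memLp_mul_gaussDensity hc aestronglyMeasurable_id (integrableOn_sq_mul_gaussDensity hκ φ)

include hc in
theorem memLp_mul_of_hasCompactSupport {h : ℝ → ℝ} (hh : Continuous h) (hs : HasCompactSupport h) :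
    MemLp (fun s => h s * gaussDensity c κ φ s) 2 (invMeasure c κ φ) := by
  refine memLp_mul_gaussDensity hc hh.aestronglyMeasurable ?_
  have h1 : HasCompactSupport fun s => h s ^ 2 * gaussDensity c κ φ s := by
    have : (fun s => h s ^ 2 * gaussDensity c κ φ s) =
      fun s => h s * (h s * gaussDensity c κ φ s) := by ext; ring
    rw [this]; exact hs.mul_right
  exact (((hh.pow 2).mul (continuous_gaussDensity φ)).integrable_of_hasCompactSupport
    h1).integrableOn

include hc in
theorem inv_mul_mul_mul (s u h : ℝ) :
    (gaussDensity c κ φ s)⁻¹ * (u * (h * gaussDensity c κ φ s)) = u * h := by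
  have := (gaussDensity_pos hc (κ := κ) φ s).ne'
  field_simp

include hc in
theorem integral_mul_gaussDensity (u h : ℝ → ℝ) :
    ∫ s, u s * (h s * gaussDensity c κ φ s) ∂invMeasure c κ φ = ∫ s in Set.Ioi 0, u s * h s := by
  rw [integral_invMeasure hc]
  simp only [inv_mul_mul_mul hc]

include hc in
theorem integrableOn_mul_of_memLp {u h : ℝ → ℝ} (hu : MemLp u 2 (invMeasure c κ φ))
    (hh : MemLp (fun s => h s * gaussDensity c κ φ s) 2 (invMeasure c κ φ)) :
    IntegrableOn (fun s => u s * h s) (Set.Ioi 0) := by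
  have h1 := (integrable_posDensity_iff (measurable_inv_gaussDensity φ)
    (inv_gaussDensity_pos hc φ)).1 (hu.integrable_mul hh)
  refine Integrable.congr h1 (ae_of_all _ fun s => inv_mul_mul_mul hc s (u s) (h s))

include hc hκ in
theorem integrableOn_of_memLp {u : ℝ → ℝ} (hu : MemLp u 2 (invMeasure c κ φ)) :
    IntegrableOn u (Set.Ioi 0) := by
  simpa using integrableOn_mul_of_memLp hc hu (h := fun _ => 1) (memLp_gaussDensity hc hκ)

include hc in
theorem near_inv_mul {u : ℝ → ℝ} (hu : IntegrableOn u (Set.Ioi 0)) :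
    IntegrableNear fun s => (gaussDensity c κ φ s)⁻¹ * u s := by
  intro R
  have hcont : Continuous fun s => (gaussDensity c κ φ s)⁻¹ :=
    (continuous_gaussDensity φ).inv₀ fun s => (gaussDensity_pos hc φ s).ne'
  obtain ⟨C, hC⟩ := (isCompact_Icc (a := (0 : ℝ)) (b := R)).exists_bound_of_continuousOn
    hcont.continuousOn
  refine Integrable.bdd_mul (c := C) (hu.mono_set Set.Ioo_subset_Ioi_self)
    hcont.aestronglyMeasurable ?_
  exact (ae_restrict_iff' measurableSet_Ioo).2 (ae_of_all _ fun s hs =>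
    hC s (Set.Ioo_subset_Icc_self hs))

/-! ### Hardy's inequality -/

/-- From `(r + t - φ)² = (r - φ)² + (t - φ)² - φ² + 2rt`, the last term being nonnegative. -/
theorem gaussWeight_add_le {κ φ r t : ℝ} (hκ : 0 < κ) (hr : 0 ≤ r) (ht : 0 ≤ t) :
    gaussWeight κ φ (r + t) ≤ gaussWeight κ φ r * ((gaussWeight κ φ 0)⁻¹ * gaussWeight κ φ t) := by
  unfold gaussWeight
  rw [← Real.exp_neg, ← Real.exp_add, ← Real.exp_add, Real.exp_le_exp]
  nlinarith [mul_nonneg hκ.le (mul_nonneg hr ht)]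

include hκ in
theorem integral_Ioi_gaussWeight_le {r : ℝ} (hr : 0 ≤ r) :
    ∫ s in Set.Ioi r, gaussWeight κ φ s ≤
      gaussWeight κ φ r * ((gaussWeight κ φ 0)⁻¹ * moment0 κ φ) := by
  have h1 : ∫ s in Set.Ioi r, gaussWeight κ φ s = ∫ t in Set.Ioi 0, gaussWeight κ φ (r + t) := by
    have := (measurePreserving_add_left volume r).setIntegral_preimage_emb
      (measurableEmbedding_addLeft r) (gaussWeight κ φ) (Set.Ioi r)
    rw [← this]
    congr 2
    ext t; simp
  have hint := integrableOn_gaussWeight hκ φ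
  rw [h1, ← integral_gaussWeight hκ φ, ← integral_const_mul, ← integral_const_mul]
  refine integral_mono_of_nonneg (ae_of_all _ fun t => (gaussWeight_pos _ _ _).le)
    ((hint.const_mul _).const_mul _) ?_
  exact (ae_restrict_iff' measurableSet_Ioi).2 (ae_of_all _ fun t ht =>
    gaussWeight_add_le hκ hr (le_of_lt ht))

include hκ in
theorem integral_Ioi_mul_gaussWeight (r : ℝ) (hr : 0 ≤ r) :
    ∫ s in Set.Ioi r, s * gaussWeight κ φ s =
      gaussWeight κ φ r / κ + φ * ∫ s in Set.Ioi r, gaussWeight κ φ s := by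
  have hsub := Set.Ioi_subset_Ioi hr
  have i0 := (integrableOn_gaussWeight hκ φ).mono_set hsub
  have i1 := (integrableOn_mul_gaussWeight hκ φ).mono_set hsub
  have h1 : ∀ s, HasDerivAt (fun s => -(gaussWeight κ φ s / κ))
      (s * gaussWeight κ φ s - φ * gaussWeight κ φ s) s := fun s =>
    (((hasDerivAt_gaussWeight κ φ s).div_const κ).neg).congr_deriv (by field_simp)
  have h2 := integral_Ioi_of_hasDerivAt_of_tendsto (a := r) (m := 0)
    (h1 r).continuousAt.continuousWithinAt (fun s _ => h1 s) (i1.sub (i0.const_mul φ))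
    (by simpa using ((tendsto_gaussWeight hκ φ).div_const κ).neg)
  rw [integral_sub i1 (i0.const_mul φ), integral_const_mul] at h2
  linarith

/-- The constant in Hardy's inequality. -/
def hardyConst (κ φ : ℝ) : ℝ := 1 / κ + |φ| * ((gaussWeight κ φ 0)⁻¹ * moment0 κ φ)

include hκ in
theorem hardyConst_pos : 0 < hardyConst κ φ := by
  have h1 := moment0_pos hκ φ
  have h2 := gaussWeight_pos κ φ 0
  unfold hardyConst; positivity

include hc hκ in
-- The first-moment tail is comparable with the density at its left end, by the submultiplicative
-- bound `gaussWeight_add_le`. This is the condition on the weight that the proof of `hardy` needs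
-- after exchanging integrals.
theorem integral_Ioi_mul_gaussDensity_le {r : ℝ} (hr : 0 ≤ r) :
    ∫ s in Set.Ioi r, s * gaussDensity c κ φ s ≤ hardyConst κ φ * gaussDensity c κ φ r := by
  have h1 : ∫ s in Set.Ioi r, s * gaussDensity c κ φ s =
      c * ∫ s in Set.Ioi r, s * gaussWeight κ φ s := by
    rw [← integral_const_mul]
    refine integral_congr_ae (ae_of_all _ fun s => ?_)
    simp only [gaussDensity]; ring
  have h0 : 0 ≤ ∫ s in Set.Ioi r, gaussWeight κ φ s :=
    integral_nonneg fun s => (gaussWeight_pos _ _ _).le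
  rw [h1, integral_Ioi_mul_gaussWeight hκ r hr, gaussDensity, mul_left_comm]
  refine mul_le_mul_of_nonneg_left ?_ hc.le
  have h2 := mul_le_mul_of_nonneg_right (le_abs_self φ) h0
  have h3 := mul_le_mul_of_nonneg_left (integral_Ioi_gaussWeight_le (φ := φ) hκ hr) (abs_nonneg φ)
  unfold hardyConst
  calc _ ≤ gaussWeight κ φ r / κ +
        |φ| * (gaussWeight κ φ r * ((gaussWeight κ φ 0)⁻¹ * moment0 κ φ)) := by linarith
    _ = _ := by ring

theorem lintegral_triangle {a b : ℝ → ENNReal} (ha : AEMeasurable a (volume.restrict (Set.Ioi 0)))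
    (hb : AEMeasurable b (volume.restrict (Set.Ioi 0))) :
    ∫⁻ s in Set.Ioi 0, a s * ∫⁻ r in Set.Ioo 0 s, b r =
      ∫⁻ r in Set.Ioi 0, b r * ∫⁻ s in Set.Ioi r, a s := by
  set F : ℝ → ℝ → ENNReal := fun s r =>
    Set.indicator {p : ℝ × ℝ | p.2 < p.1} (fun p => a p.1 * b p.2) (s, r) with hF
  have hF1 : ∀ s, F s = (Set.Iio s).indicator fun r => a s * b r := by
    intro s; ext r
    simp only [hF, Set.indicator_apply, Set.mem_ofPred, Set.mem_Iio]
  have hF2 : ∀ r, (fun s => F s r) = (Set.Ioi r).indicator fun s => a s * b r := by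
    intro r; ext s
    simp only [hF, Set.indicator_apply, Set.mem_ofPred, Set.mem_Ioi]
  have hset : ∀ s : ℝ, Set.Iio s ∩ Set.Ioi 0 = Set.Ioo 0 s := fun s => Set.inter_comm _ _
  have hmeas : AEMeasurable (Function.uncurry F)
      ((volume.restrict (Set.Ioi (0 : ℝ))).prod (volume.restrict (Set.Ioi (0 : ℝ)))) :=
    (ha.comp_fst.mul hb.comp_snd).indicator (measurableSet_lt measurable_snd measurable_fst)
  have hswap := lintegral_lintegral_swap hmeas
  have hl : ∀ s, ∫⁻ r in Set.Ioi 0, F s r = a s * ∫⁻ r in Set.Ioo 0 s, b r := by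
    intro s
    rw [hF1, lintegral_indicator measurableSet_Iio, Measure.restrict_restrict measurableSet_Iio,
      hset, lintegral_const_mul'' _ (hb.mono_measure
        (Measure.restrict_mono Set.Ioo_subset_Ioi_self le_rfl))]
  have hr : ∀ r ∈ Set.Ioi (0 : ℝ), ∫⁻ s in Set.Ioi 0, F s r = b r * ∫⁻ s in Set.Ioi r, a s := by
    intro r hr
    have h0 : Set.Ioi r ∩ Set.Ioi (0 : ℝ) = Set.Ioi r :=
      Set.inter_eq_left.2 (Set.Ioi_subset_Ioi (le_of_lt hr))
    rw [show (fun s => F s r) = _ from hF2 r, lintegral_indicator measurableSet_Ioi,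
      Measure.restrict_restrict measurableSet_Ioi, h0, lintegral_mul_const'' _ (ha.mono_measure
        (Measure.restrict_mono (Set.Ioi_subset_Ioi (le_of_lt hr)) le_rfl)), mul_comm]
  simp only [hl] at hswap
  rw [hswap]
  exact setLIntegral_congr_fun measurableSet_Ioi hr

/-- The quotient of an element of the weighted space by the density. -/
abbrev quot (c κ φ : ℝ) (J : ℝ → ℝ) (s : ℝ) : ℝ := (gaussDensity c κ φ s)⁻¹ * J s

theorem quot_sq (J : ℝ → ℝ) (s : ℝ) : quot c κ φ J s ^ 2 =
    (gaussDensity c κ φ s)⁻¹ * ((gaussDensity c κ φ s)⁻¹ * J s ^ 2) := by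
  unfold quot; ring

variable {J : ℝ → ℝ}

include hc in
theorem sq_prim_le (hJ : MemLp J 2 (invMeasure c κ φ)) {s : ℝ} (hs : 0 < s) :
    prim (fun r => |quot c κ φ J r|) s ^ 2 ≤ s * ∫ r in Set.Ioo 0 s, quot c κ φ J r ^ 2 := by
  have hJ' := (memLp_invMeasure_iff hc).1 hJ
  have hm : AEStronglyMeasurable (quot c κ φ J) (volume.restrict (Set.Ioo 0 s)) :=
    ((measurable_inv_gaussDensity φ).aestronglyMeasurable.mul hJ'.1).mono_measure
      (Measure.restrict_mono Set.Ioo_subset_Ioi_self le_rfl)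
  have hq : MemLp (fun r => |quot c κ φ J r|) 2 (volume.restrict (Set.Ioo 0 s)) := by
    refine (memLp_two_iff_integrable_sq hm.norm).2 ?_
    refine (near_inv_mul (κ := κ) (φ := φ) hc hJ'.2 s).congr (ae_of_all _ fun r => ?_)
    simp only [Real.norm_eq_abs, sq_abs, quot_sq]
  have h1 : MemLp (fun _ : ℝ => (1 : ℝ)) 2 (volume.restrict (Set.Ioo 0 s)) := memLp_const 1
  have h2 := sq_integral_mul_le h1 hq
  simp only [one_mul, one_pow, sq_abs, integral_const, smul_eq_mul, mul_one] at h2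
  rw [measureReal_restrict_apply_univ, Real.volume_real_Ioo_of_le hs.le, sub_zero] at h2
  exact h2

include hc hκ in
/-- Hardy's inequality for Gaussian weights. -/
theorem hardy (hJ : MemLp J 2 (invMeasure c κ φ)) :
    MemLp (fun s => prim (fun r => |quot c κ φ J r|) s * gaussDensity c κ φ s) 2
      (invMeasure c κ φ) ∧
    ∫ s, (prim (fun r => |quot c κ φ J r|) s * gaussDensity c κ φ s) ^ 2 ∂invMeasure c κ φ ≤
      hardyConst κ φ * ∫ s, J s ^ 2 ∂invMeasure c κ φ := by
  set q := quot c κ φ J with hq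
  set P := prim fun r => |q r| with hP
  have hJ' := (memLp_invMeasure_iff hc).1 hJ
  have hnear : IntegrableNear q := near_inv_mul hc (integrableOn_of_memLp hc hκ hJ)
  have hPm : AEStronglyMeasurable P (volume.restrict (Set.Ioi 0)) :=
    hnear.abs.near_prim.aestronglyMeasurable
  have hqm : AEStronglyMeasurable q (volume.restrict (Set.Ioi 0)) := hnear.aestronglyMeasurable
  have hC := (hardyConst_pos (φ := φ) hκ).le
  have hρ := fun s => (gaussDensity_pos hc (κ := κ) φ s).le
  have hrhs : 0 ≤ hardyConst κ φ * ∫ s, J s ^ 2 ∂invMeasure c κ φ :=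
    mul_nonneg hC (integral_nonneg fun s => sq_nonneg _)
  -- Lower integrals are used because integrability is part of the claim: Cauchy–Schwarz on `(0,
  -- s)`, Tonelli on the triangle, then the tail bound.
  have key : ∫⁻ s in Set.Ioi 0, ENNReal.ofReal (P s ^ 2 * gaussDensity c κ φ s) ≤
      ENNReal.ofReal (hardyConst κ φ * ∫ s, J s ^ 2 ∂invMeasure c κ φ) := by
    calc ∫⁻ s in Set.Ioi 0, ENNReal.ofReal (P s ^ 2 * gaussDensity c κ φ s)
        ≤ ∫⁻ s in Set.Ioi 0, ENNReal.ofReal (s * gaussDensity c κ φ s) *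
            ∫⁻ r in Set.Ioo 0 s, ENNReal.ofReal (q r ^ 2) := by
          refine setLIntegral_mono' measurableSet_Ioi fun s hs => ?_
          have hi : IntegrableOn (fun r => q r ^ 2) (Set.Ioo 0 s) := by
            refine (near_inv_mul (κ := κ) (φ := φ) hc hJ'.2 s).congr (ae_of_all _ fun r => ?_)
            simp only [hq, quot_sq]
          rw [← ofReal_integral_eq_lintegral_ofReal hi (ae_of_all _ fun r => sq_nonneg _),
            ← ENNReal.ofReal_mul (mul_nonneg (le_of_lt hs) (hρ s))]
          refine ENNReal.ofReal_le_ofReal ?_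
          have := mul_le_mul_of_nonneg_right (sq_prim_le hc hJ hs) (hρ s)
          calc _ ≤ _ := this
            _ = _ := by ring
      _ = ∫⁻ r in Set.Ioi 0, ENNReal.ofReal (q r ^ 2) *
            ∫⁻ s in Set.Ioi r, ENNReal.ofReal (s * gaussDensity c κ φ s) :=
          lintegral_triangle
            (measurable_id.mul (continuous_gaussDensity φ).measurable).ennreal_ofReal.aemeasurable
            (hqm.aemeasurable.pow_const 2).ennreal_ofReal
      _ ≤ ∫⁻ r in Set.Ioi 0, ENNReal.ofReal
            (hardyConst κ φ * ((gaussDensity c κ φ r)⁻¹ * J r ^ 2)) := by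
          refine setLIntegral_mono' measurableSet_Ioi fun r hr => ?_
          have hr0 : (0 : ℝ) ≤ r := le_of_lt hr
          rw [← ofReal_integral_eq_lintegral_ofReal
            ((integrableOn_mul_gaussDensity hκ φ).mono_set (Set.Ioi_subset_Ioi hr0))
            ((ae_restrict_iff' measurableSet_Ioi).2 (ae_of_all _ fun s hs =>
              mul_nonneg (hr0.trans (le_of_lt hs)) (hρ s))),
            ← ENNReal.ofReal_mul (sq_nonneg _)]
          refine ENNReal.ofReal_le_ofReal ?_
          have := mul_le_mul_of_nonneg_left (integral_Ioi_mul_gaussDensity_le (φ := φ) hc hκ hr0)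
            (sq_nonneg (q r))
          refine this.trans_eq ?_
          have h0 := (gaussDensity_pos hc (κ := κ) φ r).ne'
          rw [hq, quot_sq]
          field_simp
      _ = _ := by
          rw [← ofReal_integral_eq_lintegral_ofReal (hJ'.2.const_mul _) (ae_of_all _ fun r =>
            mul_nonneg hC (mul_nonneg (inv_gaussDensity_pos hc φ r).le (sq_nonneg _))),
            integral_const_mul, integral_invMeasure hc]
  have hmm : AEStronglyMeasurable (fun s => P s ^ 2 * gaussDensity c κ φ s)
      (volume.restrict (Set.Ioi 0)) :=
    (hPm.pow 2).mul (continuous_gaussDensity φ).aestronglyMeasurable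
  have hnn : ∀ s, 0 ≤ P s ^ 2 * gaussDensity c κ φ s := fun s => mul_nonneg (sq_nonneg _) (hρ s)
  have hi : IntegrableOn (fun s => P s ^ 2 * gaussDensity c κ φ s) (Set.Ioi 0) :=
    ⟨hmm, (hasFiniteIntegral_iff_ofReal (ae_of_all _ hnn)).2
      (key.trans_lt ENNReal.ofReal_lt_top)⟩
  refine ⟨memLp_mul_gaussDensity hc hPm hi, ?_⟩
  rw [integral_invMeasure hc]
  simp only [inv_mul_sq_mul hc]
  rw [← ofReal_integral_eq_lintegral_ofReal hi (ae_of_all _ hnn)] at key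
  exact (ENNReal.ofReal_le_ofReal_iff hrhs).1 key

end GaussDensity

end NeuralField

/-! ### Energy and dissipation of a single mode on the half line. -/

namespace NeuralField

section Dissipation

variable {c κ φ τ b : ℝ} (hc : 0 < c) (hκ : 0 < κ) {v f J : ℝ → ℝ}

theorem prim_one {s : ℝ} (hs : 0 < s) : prim (fun _ => 1) s = s := by
  unfold prim
  rw [setIntegral_const, Real.volume_real_Ioo_of_le hs.le]
  simp

/-- A function whose weak derivative is `f`, including the no-flux condition at the origin, is a
primitive of `f`. -/
theorem ae_eq_prim (hf : IntegrableNear f) (hJ : IntegrableNear J)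
    (h : ∀ η : ℝ → ℝ, ContDiff ℝ (⊤ : ℕ∞) η → HasCompactSupport η →
      τ * ∫ s in Set.Ioi 0, f s * η s = ∫ s in Set.Ioi 0, J s * deriv η s) :
    ∀ᵐ s ∂volume.restrict (Set.Ioi (0 : ℝ)), J s = -τ * prim f s := by
  have hw : IntegrableNear fun s => J s + τ * prim f s := fun R =>
    (hJ R).add ((hf.near_prim R).const_mul τ)
  have hzero : ∀ η : ℝ → ℝ, ContDiff ℝ (⊤ : ℕ∞) η → HasCompactSupport η →
      ∫ s in Set.Ioi 0, (J s + τ * prim f s) * deriv η s = 0 := by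
    intro η hη hηc
    have hd : Continuous (deriv η) := hη.continuous_deriv (by exact_mod_cast le_top)
    have h1 : ∀ s, (J s + τ * prim f s) * deriv η s = J s * deriv η s + τ * (prim f s * deriv η s) :=
      fun s => by ring
    simp only [h1]
    rw [integral_add (hJ.integrableOn_mul hd hηc.deriv)
      ((hf.near_prim.integrableOn_mul hd hηc.deriv).const_mul τ), integral_const_mul,
      hf.integral_prim_mul_deriv hη hηc, ← h η hη hηc]
    ring
  obtain ⟨k, hk⟩ := exists_ae_eq_const hw fun η h1 h2 _ => hzero η h1 h2
  -- A test function equal to `1` at the origin sees the boundary value, so the no-flux condition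
  -- forces the constant `k` to vanish.
  set bump : ContDiffBump (0 : ℝ) := ⟨1, 2, by norm_num, by norm_num⟩
  have hb1 : ContDiff ℝ (⊤ : ℕ∞) bump := bump.contDiff
  have hb0 : bump 0 = 1 := bump.one_of_mem_closedBall (by simp [bump])
  have h2 := hzero bump hb1 bump.hasCompactSupport
  have h3 : ∫ s in Set.Ioi 0, (J s + τ * prim f s) * deriv bump s =
      ∫ s in Set.Ioi 0, k * deriv bump s := by
    refine integral_congr_ae ?_
    filter_upwards [hk] with s hs
    rw [hs]
  rw [h3, integral_const_mul, IntegrableNear.integral_Ioi_deriv hb1 bump.hasCompactSupport, hb0] at h2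
  have hk0 : k = 0 := by linarith
  filter_upwards [hk] with s hs
  linarith

include hc hκ in
/-- The chemical potential `v / ρ - b s` is a primitive of `-κ J / ρ` up to a constant. -/
theorem exists_potential_eq (hv : MemLp v 2 (invMeasure c κ φ)) (hJ : MemLp J 2 (invMeasure c κ φ))
    (h : ∀ η : ℝ → ℝ, ContDiff ℝ (⊤ : ℕ∞) η → HasCompactSupport η → tsupport η ⊆ Set.Ioi 0 →
      ∫ s in Set.Ioi 0, v s * deriv η s = -(κ * (∫ s in Set.Ioi 0, v s * ((φ - s) * η s)) +
        b * (∫ s in Set.Ioi 0, gaussDensity c κ φ s * η s) -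
        κ * ∫ s in Set.Ioi 0, J s * η s)) :
    ∃ k, ∀ᵐ s ∂volume.restrict (Set.Ioi (0 : ℝ)),
      quot c κ φ v s - b * s = k - κ * prim (quot c κ φ J) s := by
  have hvi := integrableOn_of_memLp hc hκ hv
  have hJi := integrableOn_of_memLp hc hκ hJ
  have nv : IntegrableNear (quot c κ φ v) := near_inv_mul hc hvi
  have nJ : IntegrableNear (quot c κ φ J) := near_inv_mul hc hJi
  have n1 : IntegrableNear fun s => s := fun R =>
    (continuous_id.integrableOn_Icc (a := 0) (b := R)).mono_set Set.Ioo_subset_Icc_self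
  have none : IntegrableNear fun _ : ℝ => (1 : ℝ) := fun R => by simp
  have hw : IntegrableNear fun s => quot c κ φ v s - b * s + κ * prim (quot c κ φ J) s := fun R =>
    ((nv R).sub ((n1 R).const_mul b)).add ((nJ.near_prim R).const_mul κ)
  have hvn : IntegrableNear v := fun R => hvi.mono_set Set.Ioo_subset_Ioi_self
  obtain ⟨k, hk⟩ := exists_ae_eq_const hw fun ζ hζ hζc hζt => by
    have hζd : Continuous (deriv ζ) := hζ.continuous_deriv (by exact_mod_cast le_top)
    have hρ0 := fun s => (gaussDensity_pos hc (κ := κ) φ s).ne'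
    -- The hypothesis is the weak form of `v' = κ(φ - s)v + bρ - κJ`. Testing with `ζ/ρ` and using
    -- `ρ' = κ(φ - s)ρ` turns it into `(v/ρ)' = b - κJ/ρ`.
    set η : ℝ → ℝ := fun s => (gaussDensity c κ φ s)⁻¹ * ζ s with hη
    have hη1 : ContDiff ℝ (⊤ : ℕ∞) η := ((contDiff_gaussDensity φ).inv hρ0).mul hζ
    have hη2 : HasCompactSupport η := hζc.mul_left
    have hη3 : tsupport η ⊆ Set.Ioi 0 := (tsupport_mul_subset_right).trans hζt
    have hder : ∀ s, deriv η s =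
        (gaussDensity c κ φ s)⁻¹ * deriv ζ s - (φ - s) * κ * η s := by
      intro s
      have h1 := ((hasDerivAt_gaussDensity (c := c) (κ := κ) φ s).inv (hρ0 s)).mul
        ((hζ.differentiable (by simp)) s).hasDerivAt
      refine h1.deriv.trans ?_
      rw [hη]
      have := hρ0 s
      simp only [Pi.inv_apply]
      field_simp
      ring
    have e1 := h η hη1 hη2 hη3
    have i1 : IntegrableOn (fun s => quot c κ φ v s * deriv ζ s) (Set.Ioi 0) :=
      nv.integrableOn_mul hζd hζc.deriv
    have i2 : IntegrableOn (fun s => v s * ((φ - s) * η s)) (Set.Ioi 0) :=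
      hvn.integrableOn_mul (((continuous_const.sub continuous_id)).mul hη1.continuous) hη2.mul_left
    have e2 : ∫ s in Set.Ioi 0, v s * deriv η s =
        (∫ s in Set.Ioi 0, quot c κ φ v s * deriv ζ s) -
          κ * ∫ s in Set.Ioi 0, v s * ((φ - s) * η s) := by
      rw [← integral_const_mul, ← integral_sub i1 (i2.const_mul κ)]
      refine integral_congr_ae (ae_of_all _ fun s => ?_)
      simp only [hder, quot]; ring
    have e3 : ∫ s in Set.Ioi 0, gaussDensity c κ φ s * η s = ∫ s in Set.Ioi 0, ζ s := by
      refine integral_congr_ae (ae_of_all _ fun s => ?_)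
      simp only [hη]
      rw [mul_inv_cancel_left₀ (hρ0 s)]
    have e4 : ∫ s in Set.Ioi 0, J s * η s = ∫ s in Set.Ioi 0, quot c κ φ J s * ζ s := by
      refine integral_congr_ae (ae_of_all _ fun s => ?_)
      simp only [hη, quot]; ring
    have e5 : ∫ s in Set.Ioi 0, s * deriv ζ s = -∫ s in Set.Ioi 0, ζ s := by
      have := none.integral_prim_mul_deriv hζ hζc
      simp only [one_mul] at this
      rw [← this]
      refine setIntegral_congr_fun measurableSet_Ioi fun s hs => ?_
      simp only [prim_one hs]
    have e6 := nJ.integral_prim_mul_deriv hζ hζc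
    have i3 := n1.integrableOn_mul hζd hζc.deriv
    have i4 := nJ.near_prim.integrableOn_mul hζd hζc.deriv
    have e7 : ∀ s, (quot c κ φ v s - b * s + κ * prim (quot c κ φ J) s) * deriv ζ s =
        quot c κ φ v s * deriv ζ s - b * (s * deriv ζ s) +
          κ * (prim (quot c κ φ J) s * deriv ζ s) := fun s => by ring
    simp only [e7]
    have i5 : IntegrableOn (fun s => quot c κ φ v s * deriv ζ s - b * (s * deriv ζ s))
      (Set.Ioi 0) := i1.sub (i3.const_mul b)
    rw [integral_add i5 (i4.const_mul κ), integral_sub i1 (i3.const_mul b),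
      integral_const_mul, integral_const_mul, e5, e6]
    rw [e2, e3, e4] at e1
    linarith
  refine ⟨k, ?_⟩
  filter_upwards [hk] with s hs
  linarith

include hc in
-- The energy form becomes a pairing with the chemical potential `v/ρ - b s`. Its additive constant
-- `k` then drops out against functions of zero mass.
theorem integral_mul_sub (hv : MemLp v 2 (invMeasure c κ φ)) (hf : MemLp f 2 (invMeasure c κ φ))
    (hκ : 0 < κ) :
    (∫ s, f s * v s ∂invMeasure c κ φ) - b * ∫ s in Set.Ioi 0, s * f s =
      ∫ s in Set.Ioi 0, f s * (quot c κ φ v s - b * s) := by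
  have i1 : IntegrableOn (fun s => f s * quot c κ φ v s) (Set.Ioi 0) := by
    refine integrableOn_mul_of_memLp hc hf (hv.ae_eq (ae_of_all _ fun s => ?_))
    have := (gaussDensity_pos hc (κ := κ) φ s).ne'
    simp only [quot]
    field_simp
  have i2 : IntegrableOn (fun s => s * f s) (Set.Ioi 0) :=
    (integrableOn_mul_of_memLp hc hf (memLp_id_mul_gaussDensity hc hκ)).congr
      (ae_of_all _ fun s => mul_comm _ _)
  have e : ∀ s, f s * (quot c κ φ v s - b * s) = f s * quot c κ φ v s - b * (s * f s) :=
    fun s => by ring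
  simp only [e]
  rw [integral_sub i1 (i2.const_mul b), integral_const_mul, integral_invMeasure hc]
  congr 1
  refine integral_congr_ae (ae_of_all _ fun s => ?_)
  simp only [quot]; ring

include hc hκ in
theorem memLp_prim_mul (hJ : MemLp J 2 (invMeasure c κ φ)) :
    MemLp (fun s => prim (quot c κ φ J) s * gaussDensity c κ φ s) 2 (invMeasure c κ φ) := by
  have nJ : IntegrableNear (quot c κ φ J) := near_inv_mul hc (integrableOn_of_memLp hc hκ hJ)
  refine (hardy hc hκ hJ).1.mono ?_ (ae_of_all _ fun s => ?_)
  · refine (aestronglyMeasurable_posDensity_iff (measurable_inv_gaussDensity φ)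
      (inv_gaussDensity_pos hc φ)).2 ?_
    exact nJ.near_prim.aestronglyMeasurable.mul (continuous_gaussDensity φ).aestronglyMeasurable
  · rw [norm_mul, norm_mul]
    refine mul_le_mul_of_nonneg_right ?_ (norm_nonneg _)
    exact (IntegrableNear.abs_prim_le s).trans (le_abs_self _)

include hc hκ in
/-- The dissipation identity. -/
theorem dissipation_identity (hτ : τ ≠ 0) (hv : MemLp v 2 (invMeasure c κ φ))
    (hf : MemLp f 2 (invMeasure c κ φ)) (hJ : MemLp J 2 (invMeasure c κ φ))
    (h0 : ∫ s in Set.Ioi 0, f s = 0)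
    (hJf : ∀ᵐ s ∂volume.restrict (Set.Ioi (0 : ℝ)), J s = -τ * prim f s) {k : ℝ}
    (hk : ∀ᵐ s ∂volume.restrict (Set.Ioi (0 : ℝ)),
      quot c κ φ v s - b * s = k - κ * prim (quot c κ φ J) s) :
    (∫ s, f s * v s ∂invMeasure c κ φ) - b * ∫ s in Set.Ioi 0, s * f s =
      -(κ / τ) * ∫ s, J s ^ 2 ∂invMeasure c κ φ := by
  have hfi := integrableOn_of_memLp hc hκ hf
  have nJ : IntegrableNear (quot c κ φ J) := near_inv_mul hc (integrableOn_of_memLp hc hκ hJ)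
  have i1 := integrableOn_mul_of_memLp hc hf (memLp_prim_mul hc hκ hJ)
  rw [integral_mul_sub hc hv hf hκ]
  have e1 : ∫ s in Set.Ioi 0, f s * (quot c κ φ v s - b * s) =
      ∫ s in Set.Ioi 0, (k * f s - κ * (f s * prim (quot c κ φ J) s)) := by
    refine integral_congr_ae ?_
    filter_upwards [hk] with s hs
    rw [hs]; ring
  rw [e1, integral_sub (hfi.const_mul k) (i1.const_mul κ), integral_const_mul, integral_const_mul,
    h0, nJ.integral_mul_prim hfi.aestronglyMeasurable
      (integrableOn_mul_of_memLp hc hf (hardy hc hκ hJ).1)]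
  have e2 : ∫ r in Set.Ioi 0, quot c κ φ J r * ∫ s in Set.Ioi r, f s =
      ∫ r in Set.Ioi 0, τ⁻¹ * ((gaussDensity c κ φ r)⁻¹ * J r ^ 2) := by
    refine integral_congr_ae ?_
    filter_upwards [hJf, ae_restrict_mem measurableSet_Ioi] with r hr hr0
    -- Zero mass turns the tail of `f` into minus its primitive, and the flux equation identifies
    -- this with `J/τ`.
    have h1 : ∫ s in Set.Ioi r, f s = -prim f r := by
      have hsplit : Set.Ioi (0 : ℝ) = Set.Ioc 0 r ∪ Set.Ioi r :=
        (Set.Ioc_union_Ioi_eq_Ioi (le_of_lt hr0)).symm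
      rw [hsplit, setIntegral_union (Set.Ioc_disjoint_Ioi le_rfl) measurableSet_Ioi
        (hfi.mono_set Set.Ioc_subset_Ioi_self)
        (hfi.mono_set (Set.Ioi_subset_Ioi (le_of_lt hr0))), integral_Ioc_eq_integral_Ioo] at h0
      unfold prim
      linarith
    have h2 : prim f r = -(τ⁻¹ * J r) := by rw [hr]; field_simp
    rw [h1, h2, quot]; ring
  rw [e2, integral_const_mul, ← integral_invMeasure hc]
  field_simp
  ring

include hc hκ in
/-- The energy is controlled by the dissipation. -/
theorem sq_energy_le (hv : MemLp v 2 (invMeasure c κ φ)) (hJ : MemLp J 2 (invMeasure c κ φ))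
    (h0 : ∫ s in Set.Ioi 0, v s = 0) {k : ℝ}
    (hk : ∀ᵐ s ∂volume.restrict (Set.Ioi (0 : ℝ)),
      quot c κ φ v s - b * s = k - κ * prim (quot c κ φ J) s) :
    ((∫ s, v s * v s ∂invMeasure c κ φ) - b * ∫ s in Set.Ioi 0, s * v s) ^ 2 ≤
      κ ^ 2 * hardyConst κ φ * (∫ s, v s ^ 2 ∂invMeasure c κ φ) *
        ∫ s, J s ^ 2 ∂invMeasure c κ φ := by
  have hvi := integrableOn_of_memLp hc hκ hv
  have hP := memLp_prim_mul hc hκ hJ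
  have i1 := integrableOn_mul_of_memLp hc hv hP
  rw [integral_mul_sub hc hv hv hκ]
  have e1 : ∫ s in Set.Ioi 0, v s * (quot c κ φ v s - b * s) =
      ∫ s in Set.Ioi 0, (k * v s - κ * (v s * prim (quot c κ φ J) s)) := by
    refine integral_congr_ae ?_
    filter_upwards [hk] with s hs
    rw [hs]; ring
  rw [e1, integral_sub (hvi.const_mul k) (i1.const_mul κ), integral_const_mul, integral_const_mul,
    h0, ← integral_mul_gaussDensity (κ := κ) (φ := φ) hc v (prim (quot c κ φ J))]
  have h1 := sq_integral_mul_le hv hP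
  have h2 : ∫ s, (prim (quot c κ φ J) s * gaussDensity c κ φ s) ^ 2 ∂invMeasure c κ φ ≤
      hardyConst κ φ * ∫ s, J s ^ 2 ∂invMeasure c κ φ := by
    obtain ⟨hH1, hH2⟩ := hardy hc hκ hJ
    refine (integral_mono hP.integrable_sq hH1.integrable_sq fun s => ?_).trans hH2
    simp only [mul_pow]
    refine mul_le_mul_of_nonneg_right ?_ (sq_nonneg _)
    exact sq_le_sq.2 ((IntegrableNear.abs_prim_le s).trans (le_abs_self _))
  have h3 := mul_le_mul_of_nonneg_left h2 (integral_nonneg (μ := invMeasure c κ φ)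
    fun s => sq_nonneg (v s))
  have h4 := mul_le_mul_of_nonneg_left (h1.trans h3) (sq_nonneg κ)
  calc _ = κ ^ 2 * (∫ s, v s * (prim (quot c κ φ J) s * gaussDensity c κ φ s)
        ∂invMeasure c κ φ) ^ 2 := by ring
    _ ≤ _ := h4
    _ = _ := by ring

end Dissipation

end NeuralField

namespace NeuralField

theorem norm_sq_eq_integral {α : Type*} [MeasurableSpace α] {μ : Measure α} (w : Lp ℝ 2 μ) :
    ‖w‖ ^ 2 = ∫ x, w x ^ 2 ∂μ := by
  rw [← real_inner_self_eq_norm_sq, L2.inner_def]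
  refine integral_congr_ae (ae_of_all _ fun x => ?_)
  simp [sq]

theorem inner_eq_integral {α : Type*} [MeasurableSpace α] {μ : Measure α} (v w : Lp ℝ 2 μ) :
    inner ℝ v w = ∫ x, v x * w x ∂μ := by
  rw [L2.inner_def]
  refine integral_congr_ae (ae_of_all _ fun x => ?_)
  simp [mul_comm]

variable {d : ℕ} {L : ℝ} [hL : Fact (0 < L)]

/-! ### Partial Fourier coefficients on products -/

section Partial

variable {ν : Measure ℝ} [SFinite ν]

theorem ae_memLp_slice {u : Torus d L × ℝ → ℝ}
    (hu : MemLp u 2 ((volume : Measure (Torus d L)).prod ν)) :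
    ∀ᵐ s ∂ν, MemLp (fun x => u (x, s)) 2 volume := by
  filter_upwards [hu.1.prod_swap.prodMk_left, hu.integrable_sq.prod_left_ae] with s h1 h2
  exact (memLp_two_iff_integrable_sq h1).2 h2

/-- The partial pairing `∫ χ(x) u(x,s) dx`. -/
def partialPairing (χ : C(Torus d L, ℝ)) (u : Torus d L × ℝ → ℝ) (s : ℝ) : ℝ :=
  ∫ x, χ x * u (x, s)

theorem memLp_continuousMap (χ : C(Torus d L, ℝ)) : MemLp χ 2 (volume : Measure (Torus d L)) :=
  (memLp_top_of_bound χ.continuous.aestronglyMeasurable ‖χ‖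
    (ae_of_all _ χ.norm_coe_le_norm)).mono_exponent le_top

variable (χ : C(Torus d L, ℝ)) {u : Torus d L × ℝ → ℝ}
  (hu : MemLp u 2 ((volume : Measure (Torus d L)).prod ν))

include hu in
theorem ae_sq_partialPairing_le :
    ∀ᵐ s ∂ν, partialPairing χ u s ^ 2 ≤ (∫ x, χ x ^ 2) * ∫ x, u (x, s) ^ 2 := by
  filter_upwards [ae_memLp_slice hu] with s hs
  exact sq_integral_mul_le (memLp_continuousMap χ) hs

include hu in
theorem memLp_partialPairing : MemLp (partialPairing χ u) 2 ν := by
  have hm : AEStronglyMeasurable (partialPairing χ u) ν := by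
    have h1 : AEStronglyMeasurable (fun q : Torus d L × ℝ => χ q.1 * u q)
        ((volume : Measure (Torus d L)).prod ν) :=
      (χ.continuous.comp continuous_fst).aestronglyMeasurable.mul hu.1
    exact h1.prod_swap.integral_prod_right'
  refine (memLp_two_iff_integrable_sq hm).2 ?_
  refine Integrable.mono' (hu.integrable_sq.integral_prod_right.const_mul (∫ x, χ x ^ 2))
    (hm.pow 2) ?_
  filter_upwards [ae_sq_partialPairing_le χ hu] with s hs
  rwa [Real.norm_eq_abs, abs_of_nonneg (sq_nonneg _)]

include hu in
theorem integral_sq_partialPairing_le :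
    ∫ s, partialPairing χ u s ^ 2 ∂ν ≤
      (∫ x, χ x ^ 2) * ∫ q, u q ^ 2 ∂((volume : Measure (Torus d L)).prod ν) := by
  rw [integral_prod_symm _ hu.integrable_sq, ← integral_const_mul]
  exact integral_mono_ae (memLp_partialPairing χ hu).integrable_sq
    (hu.integrable_sq.integral_prod_right.const_mul _) (ae_sq_partialPairing_le χ hu)

omit [SFinite ν] in
theorem memLp_tensor {h : ℝ → ℝ} (hh : MemLp h 2 ν) :
    MemLp (fun q : Torus d L × ℝ => χ q.1 * h q.2) 2 ((volume : Measure (Torus d L)).prod ν) := by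
  refine (memLp_two_iff_integrable_sq
    ((χ.continuous.comp continuous_fst).aestronglyMeasurable.mul hh.1.comp_snd)).2 ?_
  refine ((memLp_continuousMap χ).integrable_sq.mul_prod hh.integrable_sq).congr
    (ae_of_all _ fun q => ?_)
  exact (mul_pow _ _ _).symm

include hu in
theorem integral_partialPairing_mul {h : ℝ → ℝ} (hh : MemLp h 2 ν) :
    ∫ s, partialPairing χ u s * h s ∂ν =
      ∫ q, u q * (χ q.1 * h q.2) ∂((volume : Measure (Torus d L)).prod ν) := by
  have hi := hu.integrable_mul (memLp_tensor χ hh)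
  refine Eq.trans ?_ (integral_prod_symm _ hi).symm
  refine integral_congr_ae (ae_of_all _ fun s => ?_)
  simp only [partialPairing]
  rw [← integral_mul_const]
  refine integral_congr_ae (ae_of_all _ fun x => ?_)
  simp only [Pi.mul_apply]; ring

theorem partialPairing_congr {u w : Torus d L × ℝ → ℝ}
    (h : u =ᵐ[(volume : Measure (Torus d L)).prod ν] w) :
    partialPairing χ u =ᵐ[ν] partialPairing χ w := by
  have h1 := Measure.ae_ae_of_ae_prod (Measure.measurePreserving_swap
    (μ := ν) (ν := (volume : Measure (Torus d L))) |>.quasiMeasurePreserving.ae h)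
  filter_upwards [h1] with s hs
  refine integral_congr_ae ?_
  filter_upwards [hs] with x hx
  exact congrArg (χ x * ·) hx

end Partial

section PartialOperator

variable {ν : Measure ℝ} [SFinite ν] {P : Measure (Torus d L × ℝ)}
  (hP : P = (volume : Measure (Torus d L)).prod ν) (χ : C(Torus d L, ℝ))

omit [SFinite ν] in
include hP in
-- The measure `P` is equal to a product only propositionally, and the type `Lp ℝ 2 P` depends on
-- it; facts about representatives are therefore transported along `hP`.
theorem memLp_coe (w : Lp ℝ 2 P) :
    MemLp (w : Torus d L × ℝ → ℝ) 2 ((volume : Measure (Torus d L)).prod ν) :=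
  (congrArg (fun Q => MemLp (w : Torus d L × ℝ → ℝ) 2 Q) hP).mp (Lp.memLp w)

omit [SFinite ν] in
include hP in
theorem ae_eq_of_eq {f g : Torus d L × ℝ → ℝ} (h : f =ᵐ[P] g) :
    f =ᵐ[(volume : Measure (Torus d L)).prod ν] g := hP ▸ h

include hP in
theorem partialPairing_add (u w : Lp ℝ 2 P) :
    partialPairing χ (u + w : Lp ℝ 2 P) =ᵐ[ν] partialPairing χ u + partialPairing χ w := by
  have h := ae_eq_of_eq hP (Lp.coeFn_add u w)
  refine (partialPairing_congr χ h).trans ?_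
  filter_upwards [ae_memLp_slice (memLp_coe hP u), ae_memLp_slice (memLp_coe hP w)] with s h1 h2
  have i1 : Integrable fun x => χ x * u (x, s) := (memLp_continuousMap χ).integrable_mul h1
  have i2 : Integrable fun x => χ x * w (x, s) := (memLp_continuousMap χ).integrable_mul h2
  simp only [partialPairing, Pi.add_apply, mul_add]
  exact integral_add i1 i2

include hP in
theorem partialPairing_smul (a : ℝ) (u : Lp ℝ 2 P) :
    partialPairing χ (a • u : Lp ℝ 2 P) =ᵐ[ν] a • partialPairing χ u := by
  have h := ae_eq_of_eq hP (Lp.coeFn_smul a u)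
  refine (partialPairing_congr χ h).trans (ae_of_all _ fun s => ?_)
  simp only [partialPairing, Pi.smul_apply, smul_eq_mul]
  rw [← integral_const_mul]
  refine integral_congr_ae (ae_of_all _ fun x => ?_)
  simp only; ring

include hP in
theorem norm_toLp_partialPairing_le (u : Lp ℝ 2 P) :
    ‖(memLp_partialPairing χ (memLp_coe hP u)).toLp _‖ ≤ √(∫ x, χ x ^ 2) * ‖u‖ := by
  refine le_of_sq_le_sq ?_ (by positivity)
  rw [mul_pow, Real.sq_sqrt (integral_nonneg fun x => sq_nonneg _), norm_sq_eq_integral,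
    norm_sq_eq_integral]
  refine le_trans (le_of_eq ?_) ((integral_sq_partialPairing_le χ (memLp_coe hP u)).trans_eq ?_)
  · refine integral_congr_ae ?_
    filter_upwards [(memLp_partialPairing χ (memLp_coe hP u)).coeFn_toLp] with s hs
    exact congrArg (· ^ 2) hs
  · exact congrArg (fun Q => (∫ x, χ x ^ 2) * ∫ q, u q ^ 2 ∂Q) hP.symm

/-- The partial pairing as an operator. -/
def partialL : Lp ℝ 2 P →L[ℝ] Lp ℝ 2 ν :=
  LinearMap.mkContinuous
    { toFun := fun u => (memLp_partialPairing χ (memLp_coe hP u)).toLp _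
      map_add' := fun u w => by
        rw [← MemLp.toLp_add]
        exact MemLp.toLp_congr _ _ (partialPairing_add hP χ u w)
      map_smul' := fun a u => by
        rw [← MemLp.toLp_const_smul]
        exact MemLp.toLp_congr _ _ (partialPairing_smul hP χ a u) }
    (√(∫ x, χ x ^ 2)) fun u => norm_toLp_partialPairing_le hP χ u

theorem coeFn_partialL (w : Lp ℝ 2 P) : partialL hP χ w =ᵐ[ν] partialPairing χ w :=
  (memLp_partialPairing χ (memLp_coe hP w)).coeFn_toLp

end PartialOperator

/-! ### Parseval's identity for partial Fourier coefficients -/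

/-- The real part of a character. -/
def reChar (n : Fin d → ℤ) : C(Torus d L, ℝ) :=
  ⟨fun x => (char (-n) x).re, Complex.continuous_re.comp (char (-n)).continuous⟩

/-- The imaginary part of a character. -/
def imChar (n : Fin d → ℤ) : C(Torus d L, ℝ) :=
  ⟨fun x => (char (-n) x).im, Complex.continuous_im.comp (char (-n)).continuous⟩

section RealParts

theorem integrable_mul_char {g : Torus d L → ℝ} (hg : Integrable g) (n : Fin d → ℤ) :
    Integrable fun x => (g x : ℂ) * char n x :=
  hg.ofReal.mul_bdd (c := 1) (char n).continuous.aestronglyMeasurable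
    (ae_of_all _ fun x => (norm_char n x).le)

theorem integral_reChar {g : Torus d L → ℝ} (hg : Integrable g) (n : Fin d → ℤ) :
    ∫ x, reChar n x * g x = (coeff g n).re := by
  have h := integral_re (𝕜 := ℂ) (integrable_mul_char hg (-n))
  refine Eq.trans (integral_congr_ae (ae_of_all _ fun x => ?_)) h
  simp [reChar, mul_comm]

theorem integral_imChar {g : Torus d L → ℝ} (hg : Integrable g) (n : Fin d → ℤ) :
    ∫ x, imChar n x * g x = (coeff g n).im := by
  have h := integral_im (𝕜 := ℂ) (integrable_mul_char hg (-n))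
  refine Eq.trans (integral_congr_ae (ae_of_all _ fun x => ?_)) h
  simp [imChar, mul_comm]

theorem tsum_sq_integral {g : Torus d L → ℝ} (hg : MemLp g 2 volume) :
    ∑' n, (ENNReal.ofReal ((∫ x, reChar n x * g x) ^ 2) +
      ENNReal.ofReal ((∫ x, imChar n x * g x) ^ 2)) = ENNReal.ofReal (L ^ d * ∫ x, g x ^ 2) := by
  have hi : Integrable g := hg.integrable (by norm_num)
  have h1 := Complex.hasSum_re (hasSum_coeff (hg.toLp g) (hg.toLp g))
  rw [Complex.ofReal_re, real_inner_self_eq_norm_sq, norm_sq_eq_integral] at h1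
  have h2 : ∫ x, hg.toLp g x ^ 2 = ∫ x, g x ^ 2 := by
    refine integral_congr_ae ?_
    filter_upwards [hg.coeFn_toLp] with x hx
    rw [hx]
  have h3 : HasSum (fun n => (∫ x, reChar n x * g x) ^ 2 + (∫ x, imChar n x * g x) ^ 2)
      (L ^ d * ∫ x, g x ^ 2) := by
    rw [← h2]
    refine h1.congr_fun fun n => ?_
    rw [integral_reChar hi, integral_imChar hi, coeff_congr hg.coeFn_toLp]
    simp [sq]
  rw [← h3.tsum_eq, ENNReal.ofReal_tsum_of_nonneg (fun n => by positivity) h3.summable]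
  exact tsum_congr fun n => (ENNReal.ofReal_add (sq_nonneg _) (sq_nonneg _)).symm

end RealParts

section Parseval

variable {ν : Measure ℝ} [SFinite ν] {P : Measure (Torus d L × ℝ)}
  (hP : P = (volume : Measure (Torus d L)).prod ν)

theorem ofReal_norm_sq {α : Type*} [MeasurableSpace α] {μ : Measure α} (w : Lp ℝ 2 μ) :
    ENNReal.ofReal (‖w‖ ^ 2) = ∫⁻ x, ENNReal.ofReal (w x ^ 2) ∂μ := by
  rw [norm_sq_eq_integral]
  exact ofReal_integral_eq_lintegral_ofReal (Lp.memLp w).integrable_sq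
    (ae_of_all _ fun x => sq_nonneg _)

/-- Parseval's identity in `x` holds for almost every `s` and is integrated over `s`. Working in
`ENNReal` makes the exchange of sum and integral free. -/
theorem tsum_norm_sq_partialL (u : Lp ℝ 2 P) :
    ∑' n, (ENNReal.ofReal (‖partialL hP (reChar n) u‖ ^ 2) +
      ENNReal.ofReal (‖partialL hP (imChar n) u‖ ^ 2)) = ENNReal.ofReal (L ^ d * ‖u‖ ^ 2) := by
  have hm : ∀ χ : C(Torus d L, ℝ), AEMeasurable
      (fun s => ENNReal.ofReal (partialL hP χ u s ^ 2)) ν := fun χ =>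
    ((Lp.aestronglyMeasurable _).aemeasurable.pow_const 2).ennreal_ofReal
  have hLd : 0 ≤ L ^ d := (pow_pos hL.out d).le
  simp only [ofReal_norm_sq]
  have h1 : ∀ n : Fin d → ℤ, (∫⁻ s, ENNReal.ofReal (partialL hP (reChar n) u s ^ 2) ∂ν) +
      ∫⁻ s, ENNReal.ofReal (partialL hP (imChar n) u s ^ 2) ∂ν =
      ∫⁻ s, (ENNReal.ofReal (partialL hP (reChar n) u s ^ 2) +
        ENNReal.ofReal (partialL hP (imChar n) u s ^ 2)) ∂ν := fun n =>
    (lintegral_add_left' (hm _) _).symm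
  simp only [h1]
  rw [← lintegral_tsum (f := fun n s => ENNReal.ofReal (partialL hP (reChar n) u s ^ 2) +
    ENNReal.ofReal (partialL hP (imChar n) u s ^ 2)) fun n => (hm _).add (hm _)]
  have hu := memLp_coe hP u
  have h2 : ∀ᵐ s ∂ν, ∀ n : Fin d → ℤ, partialL hP (reChar n) u s = partialPairing (reChar n) u s ∧
      partialL hP (imChar n) u s = partialPairing (imChar n) u s :=
    ae_all_iff.2 fun n => (coeFn_partialL hP (reChar n) u).and (coeFn_partialL hP (imChar n) u)
  have h3 : ∫⁻ s, ∑' n : Fin d → ℤ, (ENNReal.ofReal (partialL hP (reChar n) u s ^ 2) +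
        ENNReal.ofReal (partialL hP (imChar n) u s ^ 2)) ∂ν =
      ∫⁻ s, ENNReal.ofReal (L ^ d * ∫ x, u (x, s) ^ 2) ∂ν := by
    refine lintegral_congr_ae ?_
    filter_upwards [ae_memLp_slice hu, h2] with s hs hs2
    rw [← tsum_sq_integral hs]
    refine tsum_congr fun n => ?_
    rw [(hs2 n).1, (hs2 n).2]; rfl
  rw [h3, ← ofReal_integral_eq_lintegral_ofReal
    (hu.integrable_sq.integral_prod_right.const_mul _)
    (ae_of_all _ fun s => mul_nonneg hLd (integral_nonneg fun x => sq_nonneg _)),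
    integral_const_mul, norm_sq_eq_integral]
  have h4 : ∫ q, u q ^ 2 ∂P = ∫ q, u q ^ 2 ∂((volume : Measure (Torus d L)).prod ν) :=
    congrArg (fun Q => ∫ q, u q ^ 2 ∂Q) hP
  rw [h4, integral_prod_symm _ hu.integrable_sq]

end Parseval

end NeuralField

/-! ### Fourier modes of perturbations in the weighted space. -/

namespace NeuralField

instance (c κ φ : ℝ) : SFinite (invMeasure c κ φ) := by unfold invMeasure; infer_instance

variable {d : ℕ} {L : ℝ} [hL : Fact (0 < L)]

section SlicePairing

variable {ν : Measure ℝ} [SFinite ν] {u : Torus d L × ℝ → ℝ}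
  (hu : MemLp u 2 ((volume : Measure (Torus d L)).prod ν)) {k : ℝ → ℝ} (hk : MemLp k 2 ν)

include hu hk in
theorem memLp_slicePairing : MemLp (fun x => ∫ s, u (x, s) * k s ∂ν) 2 (volume : Measure (Torus d L)) := by
  have hm : AEStronglyMeasurable (fun x => ∫ s, u (x, s) * k s ∂ν)
      (volume : Measure (Torus d L)) :=
    (hu.1.mul hk.1.comp_snd).integral_prod_right'
  refine (memLp_two_iff_integrable_sq hm).2 ?_
  refine Integrable.mono' (hu.integrable_sq.integral_prod_left.mul_const (∫ s, k s ^ 2 ∂ν))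
    (hm.pow 2) ?_
  filter_upwards [hu.1.prodMk_left, hu.integrable_sq.prod_right_ae] with x h1 h2
  rw [Real.norm_eq_abs, abs_of_nonneg (sq_nonneg _)]
  exact sq_integral_mul_le ((memLp_two_iff_integrable_sq h1).2 h2) hk

include hu hk in
theorem integral_mul_slicePairing (χ : C(Torus d L, ℝ)) :
    ∫ x, χ x * ∫ s, u (x, s) * k s ∂ν = ∫ s, partialPairing χ u s * k s ∂ν := by
  rw [integral_partialPairing_mul χ hu hk]
  have hi := hu.integrable_mul (memLp_tensor χ hk)
  refine Eq.trans ?_ (integral_prod _ hi).symm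
  refine integral_congr_ae (ae_of_all _ fun x => ?_)
  simp only
  rw [← integral_const_mul]
  refine integral_congr_ae (ae_of_all _ fun s => ?_)
  simp only [Pi.mul_apply]; ring

end SlicePairing

namespace Model

variable (m : Model d L)

/-- The normalisation constant of the homogeneous stationary density. -/
def rhoConst (κ : ℝ) : ℝ :=
  (L ^ d * ∫ s in Set.Ioi (0 : ℝ), gaussWeight κ (m.Phi0 κ) s)⁻¹

theorem rhoInf_eq (κ : ℝ) : m.rhoInf κ = gaussDensity (m.rhoConst κ) κ (m.Phi0 κ) :=
  funext fun _ => div_eq_inv_mul _ _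

theorem rhoConst_eq {κ : ℝ} (hκ : 0 < κ) : m.rhoConst κ = (L ^ d * moment0 κ (m.Phi0 κ))⁻¹ := by
  rw [rhoConst, integral_gaussWeight hκ]

theorem rhoConst_pos {κ : ℝ} (hκ : 0 < κ) : 0 < m.rhoConst κ := by
  rw [rhoConst_eq m hκ]
  exact inv_pos.2 (mul_pos (pow_pos hL.out d) (moment0_pos hκ _))

/-- The weighted measure on the half line associated with the stationary density. -/
abbrev halfMeasure (κ : ℝ) : Measure ℝ := invMeasure (m.rhoConst κ) κ (m.Phi0 κ)

theorem phaseMeasure_eq : phaseMeasure d L =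
    (volume : Measure (Torus d L)).prod (volume.restrict (Set.Ioi 0)) := by
  have h := Measure.prod_restrict (μ := (volume : Measure (Torus d L)))
    (ν := (volume : Measure ℝ)) Set.univ (Set.Ioi 0)
  rw [Measure.restrict_univ] at h
  rw [h]; rfl

theorem weightMeasure_eq (κ : ℝ) :
    m.weightMeasure κ = (volume : Measure (Torus d L)).prod (m.halfMeasure κ) := by
  rw [weightMeasure, phaseMeasure_eq, halfMeasure, invMeasure, prod_withDensity_right
    (measurable_inv_gaussDensity _).ennreal_ofReal, rhoInf_eq]

section Pairing

variable {m} {κ : ℝ} (hκ : 0 < κ) {u : Torus d L × ℝ → ℝ}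
  (hu : MemLp u 2 ((volume : Measure (Torus d L)).prod (m.halfMeasure κ)))
  (χ : C(Torus d L, ℝ)) {h : ℝ → ℝ}
  (hh : MemLp (fun s => h s * gaussDensity (m.rhoConst κ) κ (m.Phi0 κ) s) 2 (m.halfMeasure κ))

theorem inv_rhoInf_measurable :
    Measurable fun q : Torus d L × ℝ => (m.rhoInf κ q.2)⁻¹ := by
  rw [rhoInf_eq]
  exact (measurable_inv_gaussDensity _).comp measurable_snd

include hκ in
theorem inv_rhoInf_pos (q : Torus d L × ℝ) : 0 < (m.rhoInf κ q.2)⁻¹ := by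
  rw [rhoInf_eq]
  exact inv_gaussDensity_pos (m.rhoConst_pos hκ) _ _

include hκ in
theorem ae_phaseMeasure_iff {p : Torus d L × ℝ → Prop} :
    (∀ᵐ q ∂(volume : Measure (Torus d L)).prod (m.halfMeasure κ), p q) ↔
      ∀ᵐ q ∂phaseMeasure d L, p q := by
  rw [← weightMeasure_eq]
  exact ae_posDensity_iff inv_rhoInf_measurable (inv_rhoInf_pos hκ)

include hκ in
theorem weight_cancel (q : Torus d L × ℝ) (a b : ℝ) : (m.rhoInf κ q.2)⁻¹ *
    (a * (b * (h q.2 * gaussDensity (m.rhoConst κ) κ (m.Phi0 κ) q.2))) = a * (b * h q.2) := by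
  rw [rhoInf_eq]
  have := (gaussDensity_pos (m.rhoConst_pos hκ) (κ := κ) (m.Phi0 κ) q.2).ne'
  field_simp

include hκ hu hh in
theorem integrable_phase_mul :
    Integrable (fun q => u q * (χ q.1 * h q.2)) (phaseMeasure d L) := by
  have h1 := hu.integrable_mul (memLp_tensor χ hh)
  rw [← weightMeasure_eq] at h1
  have h2 := (integrable_posDensity_iff inv_rhoInf_measurable (inv_rhoInf_pos hκ)).1 h1
  exact h2.congr (ae_of_all _ fun q => weight_cancel hκ q _ _)

include hκ hu hh in
theorem integral_phase_mul : ∫ q, u q * (χ q.1 * h q.2) ∂phaseMeasure d L =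
    ∫ s in Set.Ioi 0, partialPairing χ u s * h s := by
  rw [← integral_mul_gaussDensity (κ := κ) (φ := m.Phi0 κ) (m.rhoConst_pos hκ),
    integral_partialPairing_mul χ hu hh, ← weightMeasure_eq, weightMeasure,
    integral_posDensity inv_rhoInf_measurable (inv_rhoInf_pos hκ)]
  exact integral_congr_ae (ae_of_all _ fun q => (weight_cancel hκ q _ _).symm)

include hκ in
theorem activity_eq (u : Torus d L × ℝ → ℝ) (x : Torus d L) : activity u x =
    ∫ s, u (x, s) * (s * gaussDensity (m.rhoConst κ) κ (m.Phi0 κ) s) ∂m.halfMeasure κ := by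
  rw [integral_mul_gaussDensity (m.rhoConst_pos hκ)]
  exact integral_congr_ae (ae_of_all _ fun s => mul_comm _ _)

include hκ hu in
theorem memLp_activity : MemLp (activity u) 2 (volume : Measure (Torus d L)) := by
  have := memLp_slicePairing hu (memLp_id_mul_gaussDensity (m.rhoConst_pos hκ) hκ)
  simp only [← activity_eq hκ] at this
  exact this

include hκ hu in
theorem integral_mul_activity :
    ∫ x, χ x * activity u x = ∫ s in Set.Ioi 0, s * partialPairing χ u s := by
  simp only [activity_eq (m := m) hκ]
  rw [integral_mul_slicePairing hu (memLp_id_mul_gaussDensity (m.rhoConst_pos hκ) hκ),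
    integral_mul_gaussDensity (m.rhoConst_pos hκ)]
  exact integral_congr_ae (ae_of_all _ fun s => mul_comm _ _)

include hκ hu in
theorem integral_partialPairing_eq_zero
    (h0 : ∀ᵐ x : Torus d L, ∫ s in Set.Ioi (0 : ℝ), u (x, s) = 0) :
    ∫ s in Set.Ioi 0, partialPairing χ u s = 0 := by
  have h1 := integral_mul_slicePairing hu (memLp_gaussDensity (m.rhoConst_pos hκ) hκ) χ
  simp only [integral_mul_gaussDensity (h := fun _ => 1) (m.rhoConst_pos hκ) , mul_one] at h1
  rw [← h1]
  refine (integral_congr_ae (g := fun _ => 0) ?_).trans (by simp)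
  filter_upwards [h0] with x hx
  simp [hx]

end Pairing

/-! ### The variance of the stationary density -/

/-- The mean of the stationary density, as a probability density. -/
def meanS (κ : ℝ) : ℝ := L ^ d * m.rhoBar κ

/-- The variance of the stationary density, up to the factor `L ^ d`. -/
def varS (κ : ℝ) : ℝ := ∫ s in Set.Ioi 0, (s - m.meanS κ) ^ 2 * m.rhoInf κ s

variable {m}

theorem Admissible.meanS_eq (hm : m.Admissible) {κ : ℝ} (hκ : 0 < κ) :
    m.meanS κ = moment1 κ (m.Phi0 κ) / moment0 κ (m.Phi0 κ) := by
  have h1 := hm.branch_eq (Real.log κ)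
  have h2 : m.branch (Real.log κ) = m.rhoBar κ := by rw [branch, Real.exp_log hκ]
  rw [response_eq, Real.exp_log hκ, gaussMean_eq hκ, ← moment1_div_moment0 hκ, inputAt, h2] at h1
  exact (congrArg (L ^ d * ·) h1).trans (mul_div_cancel₀ _ (pow_pos hL.out d).ne')

theorem integral_rhoInf {κ : ℝ} (hκ : 0 < κ) : ∫ s in Set.Ioi 0, m.rhoInf κ s = 1 / L ^ d := by
  rw [rhoInf_eq]
  unfold gaussDensity
  rw [integral_const_mul, integral_gaussWeight hκ, rhoConst_eq m hκ]
  have := (moment0_pos hκ (m.Phi0 κ)).ne'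
  have := (pow_pos hL.out d).ne'
  field_simp

theorem integral_mul_rhoInf {κ : ℝ} (hκ : 0 < κ) : ∫ s in Set.Ioi 0, s * m.rhoInf κ s =
    moment1 κ (m.Phi0 κ) / moment0 κ (m.Phi0 κ) / L ^ d := by
  rw [rhoInf_eq]
  simp only [gaussDensity, mul_left_comm _ (m.rhoConst κ)]
  rw [integral_const_mul, integral_mul_gaussWeight hκ, rhoConst_eq m hκ]
  field_simp

theorem integral_sq_mul_rhoInf {κ : ℝ} (hκ : 0 < κ) : ∫ s in Set.Ioi 0, s ^ 2 * m.rhoInf κ s =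
    moment2 κ (m.Phi0 κ) / moment0 κ (m.Phi0 κ) / L ^ d := by
  rw [rhoInf_eq]
  simp only [gaussDensity, mul_left_comm _ (m.rhoConst κ)]
  rw [integral_const_mul, integral_sq_mul_gaussWeight hκ, rhoConst_eq m hκ]
  field_simp

/-- Fluctuation–response: shifting `φ` changes the mean of the truncated Gaussian at the rate `κ`
times its variance. It links the scalar gain with the Cauchy–Schwarz bound on the activity. -/
theorem Admissible.varS_eq (hm : m.Admissible) {κ : ℝ} (hκ : 0 < κ) :
    κ * m.dPhi0 κ * m.varS κ = m.gain (Real.log κ) := by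
  have hi0 : IntegrableOn (m.rhoInf κ) (Set.Ioi 0) := by
    rw [rhoInf_eq]; exact integrableOn_gaussDensity hκ _
  have hi1 : IntegrableOn (fun s => s * m.rhoInf κ s) (Set.Ioi 0) := by
    rw [rhoInf_eq]; exact integrableOn_mul_gaussDensity hκ _
  have hi2 : IntegrableOn (fun s => s ^ 2 * m.rhoInf κ s) (Set.Ioi 0) := by
    rw [rhoInf_eq]; exact integrableOn_sq_mul_gaussDensity hκ _
  have hLd := (pow_pos hL.out d).ne'
  have h0 := (moment0_pos hκ (m.Phi0 κ)).ne'
  have hM := hm.meanS_eq hκ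
  have hv : m.varS κ = (1 / κ - m.meanS κ * (m.meanS κ - m.Phi0 κ)) / L ^ d := by
    have e : ∀ s, (s - m.meanS κ) ^ 2 * m.rhoInf κ s = s ^ 2 * m.rhoInf κ s -
      2 * m.meanS κ * (s * m.rhoInf κ s) + m.meanS κ ^ 2 * m.rhoInf κ s := fun s => by ring
    have hi3 : IntegrableOn (fun s => s ^ 2 * m.rhoInf κ s - 2 * m.meanS κ * (s * m.rhoInf κ s))
      (Set.Ioi 0) := hi2.sub (hi1.const_mul _)
    unfold varS
    simp only [e]
    rw [integral_add hi3 (hi0.const_mul _), integral_sub hi2 (hi1.const_mul _),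
      integral_const_mul, integral_const_mul, integral_rhoInf hκ, integral_mul_rhoInf hκ,
      integral_sq_mul_rhoInf hκ, ← hM]
    have : moment2 κ (m.Phi0 κ) / moment0 κ (m.Phi0 κ) = 1 / κ + m.Phi0 κ * m.meanS κ := by
      rw [hM, moment2]; field_simp
    rw [this]; ring
  rw [hm.gain_eq_bifurcation, Real.exp_log hκ, hv, meanS]
  field_simp

end Model

end NeuralField

/-! ### Energy decay and the one-dimensional equation for a mode. -/

namespace NeuralField

/-- Exponential decay from an energy inequality, for an energy that is a rank-one perturbation of
the squared norm. -/
theorem norm_sq_le_of_energy {H : Type*} [NormedAddCommGroup H] [InnerProductSpace ℝ H] {v : ℝ → H}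
    {r : H} {β c₀ C₁ A γ : ℝ} (hc₀ : 0 < c₀) (hA : 0 < A) (hγ : 0 < γ)
    (hcont : ContinuousOn v (Set.Ici 0))
    (hlow : ∀ t ≥ 0, c₀ * ‖v t‖ ^ 2 ≤ ‖v t‖ ^ 2 - β * inner ℝ r (v t) ^ 2)
    (hup : ‖v 0‖ ^ 2 - β * inner ℝ r (v 0) ^ 2 ≤ C₁ * ‖v 0‖ ^ 2)
    (hev : ∀ t > 0, ∃ g : H, ∃ D : ℝ, 0 ≤ D ∧ HasDerivAt v g t ∧
      inner ℝ g (v t) - β * inner ℝ r (v t) * inner ℝ r g = -γ * D ∧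
      (‖v t‖ ^ 2 - β * inner ℝ r (v t) ^ 2) ^ 2 ≤ A * ‖v t‖ ^ 2 * D) {t : ℝ} (ht : 0 ≤ t) :
    ‖v t‖ ^ 2 ≤ C₁ / c₀ * Real.exp (-(2 * γ * c₀ / A * t)) * ‖v 0‖ ^ 2 := by
  set N : ℝ → ℝ := fun t => ‖v t‖ ^ 2 - β * inner ℝ r (v t) ^ 2 with hN
  set ω := 2 * γ * c₀ / A with hω
  have hNc : ContinuousOn N (Set.Ici 0) :=
    (hcont.norm.pow 2).sub (continuousOn_const.mul ((continuousOn_const.inner hcont).pow 2))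
  have hder : ∀ t > 0, ∃ N', HasDerivAt N N' t ∧ N' ≤ -ω * N t := by
    intro t ht
    obtain ⟨g, D, hD, hg, h1, h2⟩ := hev t ht
    have hr : HasDerivAt (fun t => inner ℝ r (v t)) (inner ℝ r g) t :=
      (innerSL ℝ r).hasFDerivAt.comp_hasDerivAt t hg
    refine ⟨_, hg.norm_sq.sub ((hr.pow 2).const_mul β), ?_⟩
    have h3 : 2 * inner ℝ (v t) g - β * (((2 : ℕ) : ℝ) * inner ℝ r (v t) ^ (2 - 1) * inner ℝ r g) =
        2 * (-γ * D) := by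
      rw [← h1, real_inner_comm g (v t)]; push_cast; ring
    rw [h3]
    have hN0 : 0 ≤ N t := (mul_nonneg hc₀.le (sq_nonneg _)).trans (hlow t ht.le)
    -- Combining `N² ≤ A‖v‖²D` with `c₀‖v‖² ≤ N` gives `c₀N² ≤ N·A·D`, and `N` is cancelled when it
    -- is positive.
    have h4 : c₀ * N t ≤ A * D := by
      rcases hN0.eq_or_lt with h0 | hpos
      · rw [← h0, mul_zero]; positivity
      · have h5 := mul_le_mul_of_nonneg_right (hlow t ht.le) (mul_nonneg hA.le hD)
        have h6 : c₀ * N t * N t ≤ A * D * N t := by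
          calc c₀ * N t * N t = c₀ * N t ^ 2 := by ring
            _ ≤ c₀ * (A * ‖v t‖ ^ 2 * D) := mul_le_mul_of_nonneg_left h2 hc₀.le
            _ = c₀ * ‖v t‖ ^ 2 * (A * D) := by ring
            _ ≤ N t * (A * D) := h5
            _ = _ := by ring
        exact le_of_mul_le_mul_right h6 hpos
    have h7 : ω * N t ≤ 2 * γ * D := by
      rw [hω, div_mul_eq_mul_div, div_le_iff₀ hA]
      have := mul_le_mul_of_nonneg_left h4 (mul_nonneg zero_le_two hγ.le)
      linarith
    linarith
  have hanti : AntitoneOn (fun t => Real.exp (ω * t) * N t) (Set.Ici 0) := by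
    refine antitoneOn_of_deriv_nonpos (convex_Ici 0) ?_ ?_ ?_
    · exact (by fun_prop : Continuous fun t => Real.exp (ω * t)).continuousOn.mul hNc
    · rw [interior_Ici]
      intro t ht
      obtain ⟨N', h1, -⟩ := hder t ht
      exact ((by fun_prop : DifferentiableAt ℝ (fun t => Real.exp (ω * t)) t).mul
        h1.differentiableAt).differentiableWithinAt
    · rw [interior_Ici]
      intro t ht
      obtain ⟨N', h1, h2⟩ := hder t ht
      have h3 : HasDerivAt (fun t => Real.exp (ω * t)) (Real.exp (ω * t) * ω) t := by
        simpa using ((hasDerivAt_id t).const_mul ω).exp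
      have h4 : deriv (fun t => Real.exp (ω * t) * N t) t = _ := (h3.mul h1).deriv
      rw [h4]
      have := mul_le_mul_of_nonneg_left h2 (Real.exp_pos (ω * t)).le
      linarith
  have h1 := hanti Set.self_mem_Ici ht ht
  simp only [mul_zero, Real.exp_zero, one_mul] at h1
  have h2 := h1.trans hup
  have h3 : Real.exp (ω * t) * (c₀ * ‖v t‖ ^ 2) ≤ C₁ * ‖v 0‖ ^ 2 :=
    (mul_le_mul_of_nonneg_left (hlow t ht) (Real.exp_pos _).le).trans h2
  rw [Real.exp_neg]
  have he := Real.exp_pos (ω * t)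
  have : C₁ / c₀ * (Real.exp (ω * t))⁻¹ * ‖v 0‖ ^ 2 =
      (C₁ * ‖v 0‖ ^ 2) / (Real.exp (ω * t) * c₀) := by field_simp
  rw [this, le_div_iff₀ (mul_pos he hc₀)]
  linarith

variable {d : ℕ} {L : ℝ} [hL : Fact (0 < L)]

/-- `χ` is an eigenfunction, with eigenvalue `lam`, of the transpose of the convolution. -/
def IsEigenTest (W : Torus d L → ℝ) (χ : C(Torus d L, ℝ)) (lam : ℝ) : Prop :=
  ∀ g : L2 d L, ∫ x, χ x * conv W g x = lam * ∫ x, χ x * g x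

section EigenTest

variable {W : Torus d L → ℝ} (hW : MemLp W 2 volume) (heven : CoordEven W)
include hW heven

theorem isEigenTest_reChar (n : Fin d → ℤ) : IsEigenTest W (reChar n) (eigen W (absFreq n)) := by
  intro g
  have h1 : ∫ x, reChar n x * conv W g x = ∫ x, reChar n x * convL hW g x :=
    integral_congr_ae (by filter_upwards [coeFn_convL hW g] with x hx; rw [hx])
  rw [h1, integral_reChar (integrable_of_L2 _), integral_reChar (integrable_of_L2 _),
    coeff_convL' hW heven, Complex.re_ofReal_mul]

theorem isEigenTest_imChar (n : Fin d → ℤ) : IsEigenTest W (imChar n) (eigen W (absFreq n)) := by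
  intro g
  have h1 : ∫ x, imChar n x * conv W g x = ∫ x, imChar n x * convL hW g x :=
    integral_congr_ae (by filter_upwards [coeFn_convL hW g] with x hx; rw [hx])
  rw [h1, integral_imChar (integrable_of_L2 _), integral_imChar (integrable_of_L2 _),
    coeff_convL' hW heven, Complex.im_ofReal_mul]

/-- Eigenvalues may be very negative compared with the maximum; this bound, independent of the mode,
controls the initial energy from above. -/
theorem abs_eigen_le (n : Fin d → ℤ) : |eigen W (absFreq n)| ≤ ∫ x, |W x| := by
  have hi : Integrable W := hW.integrable (by norm_num)
  have h1 := coeff_eq_eigen hi heven n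
  have h2 : ‖coeff W n‖ ≤ ∫ x, ‖(W x : ℂ) * char (-n) x‖ := norm_integral_le_integral_norm _
  rw [h1, Complex.norm_real] at h2
  refine h2.trans_eq (integral_congr_ae (ae_of_all _ fun x => ?_))
  simp [norm_char]

end EigenTest

namespace Model

variable {m : Model d L} {κ : ℝ} {χ : C(Torus d L, ℝ)} {lam : ℝ}

/-- The partial pairing of a perturbation with a function on the torus. -/
abbrev modeL (m : Model d L) (κ : ℝ) (χ : C(Torus d L, ℝ)) :
    m.Pert κ →L[ℝ] Lp ℝ 2 (m.halfMeasure κ) := partialL (m.weightMeasure_eq κ) χ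

/-- The function `s ρ_∞(s)`, which represents the activity. -/
def activityVec (m : Model d L) (hκ : 0 < κ) : Lp ℝ 2 (m.halfMeasure κ) :=
  (memLp_id_mul_gaussDensity (φ := m.Phi0 κ) (m.rhoConst_pos hκ) hκ).toLp _

/-- The function `ρ_∞(s)`, which represents the mass. -/
def massVec (m : Model d L) (hκ : 0 < κ) : Lp ℝ 2 (m.halfMeasure κ) :=
  (memLp_gaussDensity (φ := m.Phi0 κ) (m.rhoConst_pos hκ) hκ).toLp _

theorem inner_activityVec (hκ : 0 < κ) (w : Lp ℝ 2 (m.halfMeasure κ)) :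
    inner ℝ (m.activityVec hκ) w = ∫ s in Set.Ioi 0, s * w s := by
  rw [inner_eq_integral, ← integral_congr_ae (ae_of_all _ fun s => mul_comm (w s) s),
    ← integral_mul_gaussDensity (κ := κ) (φ := m.Phi0 κ) (m.rhoConst_pos hκ)]
  refine integral_congr_ae ?_
  filter_upwards [(memLp_id_mul_gaussDensity (φ := m.Phi0 κ)
    (m.rhoConst_pos hκ) hκ).coeFn_toLp] with s hs
  rw [activityVec, hs, mul_comm]

theorem inner_massVec (hκ : 0 < κ) (w : Lp ℝ 2 (m.halfMeasure κ)) :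
    inner ℝ (m.massVec hκ) w = ∫ s in Set.Ioi 0, w s := by
  rw [inner_eq_integral, ← integral_congr_ae (ae_of_all _ fun s => mul_one (w s)),
    ← integral_mul_gaussDensity (κ := κ) (φ := m.Phi0 κ) (m.rhoConst_pos hκ)]
  refine integral_congr_ae ?_
  filter_upwards [(memLp_gaussDensity (φ := m.Phi0 κ)
    (m.rhoConst_pos hκ) hκ).coeFn_toLp] with s hs
  rw [massVec, hs, mul_comm]

theorem coeFn_modeL (hκ : 0 < κ) (u : m.Pert κ) :
    ∀ᵐ s ∂volume.restrict (Set.Ioi (0 : ℝ)), modeL m κ χ u s = partialPairing χ u s :=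
  (ae_invMeasure_iff (m.rhoConst_pos hκ)).1 (coeFn_partialL (m.weightMeasure_eq κ) χ u)

theorem inner_massVec_modeL (hκ : 0 < κ) {u : m.Pert κ}
    (h0 : ∀ᵐ x : Torus d L, ∫ s in Set.Ioi (0 : ℝ), u (x, s) = 0) :
    inner ℝ (m.massVec hκ) (modeL m κ χ u) = 0 := by
  rw [inner_massVec]
  exact (integral_congr_ae (coeFn_modeL hκ u)).trans
    (integral_partialPairing_eq_zero hκ (memLp_coe (m.weightMeasure_eq κ) u) χ h0)

/-- The variance bounds the activity of perturbations of zero mass. -/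
theorem sq_inner_activityVec_le (hκ : 0 < κ) {w : Lp ℝ 2 (m.halfMeasure κ)}
    (h0 : inner ℝ (m.massVec hκ) w = 0) :
    inner ℝ (m.activityVec hκ) w ^ 2 ≤ m.varS κ * ‖w‖ ^ 2 := by
  set M := m.meanS κ
  -- On functions of zero mass `s` may be replaced by `s - M`, and `(s - M)ρ_∞` has squared weighted
  -- norm equal to the variance.
  have h1 : inner ℝ (m.activityVec hκ) w = inner ℝ (m.activityVec hκ - M • m.massVec hκ) w := by
    rw [inner_sub_left, inner_smul_left, h0]; simp
  have h2 : ‖m.activityVec hκ - M • m.massVec hκ‖ ^ 2 = m.varS κ := by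
    rw [norm_sq_eq_integral, varS, rhoInf_eq]
    have e : ∀ᵐ s ∂m.halfMeasure κ, (m.activityVec hκ - M • m.massVec hκ : Lp ℝ 2 _) s ^ 2 =
        ((s - M) * gaussDensity (m.rhoConst κ) κ (m.Phi0 κ) s) ^ 2 := by
      filter_upwards [Lp.coeFn_sub (m.activityVec hκ) (M • m.massVec hκ),
        Lp.coeFn_smul M (m.massVec hκ),
        (memLp_id_mul_gaussDensity (φ := m.Phi0 κ) (m.rhoConst_pos hκ) hκ).coeFn_toLp,
        (memLp_gaussDensity (φ := m.Phi0 κ) (m.rhoConst_pos hκ) hκ).coeFn_toLp] with s a1 a2 a3 a4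
      rw [a1, Pi.sub_apply, a2, Pi.smul_apply, activityVec, massVec, a3, a4, smul_eq_mul]
      ring
    rw [integral_congr_ae e, integral_invMeasure (m.rhoConst_pos hκ)]
    simp only [inv_mul_sq_mul (m.rhoConst_pos hκ)]
    rfl
  rw [h1, ← h2, ← mul_pow]
  exact sq_le_sq.2 ((abs_real_inner_le_norm _ _).trans (le_abs_self _))

/-- The linearised equation for a single mode: the flux `J` of the mode satisfies the weak
equations in one dimension. -/
theorem exists_mode_flux (hκ : 0 < κ) (hχ : IsEigenTest m.W χ lam) (hW : MemLp m.W 2 volume)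
    {u f : m.Pert κ} (him : m.IsLinearImage κ u f) :
    ∃ J : ℝ → ℝ, MemLp J 2 (m.halfMeasure κ) ∧
      (∀ η : ℝ → ℝ, ContDiff ℝ (⊤ : ℕ∞) η → HasCompactSupport η →
        m.τ * ∫ s in Set.Ioi 0, modeL m κ χ f s * η s = ∫ s in Set.Ioi 0, J s * deriv η s) ∧
      ∀ η : ℝ → ℝ, ContDiff ℝ (⊤ : ℕ∞) η → HasCompactSupport η → tsupport η ⊆ Set.Ioi 0 →
        ∫ s in Set.Ioi 0, modeL m κ χ u s * deriv η s =
          -(κ * (∫ s in Set.Ioi 0, modeL m κ χ u s * ((m.Phi0 κ - s) * η s)) +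
          κ * m.dPhi0 κ * lam * inner ℝ (m.activityVec hκ) (modeL m κ χ u) *
            (∫ s in Set.Ioi 0, gaussDensity (m.rhoConst κ) κ (m.Phi0 κ) s * η s) -
          κ * ∫ s in Set.Ioi 0, J s * η s) := by
  obtain ⟨p, hp, hJ, heq⟩ := him
  have hc := m.rhoConst_pos hκ
  have hu := memLp_coe (m.weightMeasure_eq κ) u
  have hf := memLp_coe (m.weightMeasure_eq κ) f
  have hJ := (congrArg (fun Q => MemLp (m.linFlux κ u p) 2 Q) (m.weightMeasure_eq κ)).mp hJ
  set J := m.linFlux κ u p with hJdef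
  have hmu : ∀ h : ℝ → ℝ, ∫ s in Set.Ioi 0, modeL m κ χ u s * h s =
      ∫ s in Set.Ioi 0, partialPairing χ u s * h s := fun h =>
    integral_congr_ae (by filter_upwards [coeFn_modeL hκ u] with s hs; rw [hs])
  have hmf : ∀ h : ℝ → ℝ, ∫ s in Set.Ioi 0, modeL m κ χ f s * h s =
      ∫ s in Set.Ioi 0, partialPairing χ f s * h s := fun h =>
    integral_congr_ae (by filter_upwards [coeFn_modeL hκ f] with s hs; rw [hs])
  refine ⟨partialPairing χ J, memLp_partialPairing χ hJ, fun η hη hηc => ?_, fun η hη hηc hηt => ?_⟩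
  · have hd : Continuous (deriv η) := hη.continuous_deriv (by exact_mod_cast le_top)
    rw [hmf, ← integral_phase_mul hκ hf χ (memLp_mul_of_hasCompactSupport hc hη.continuous hηc),
      ← integral_phase_mul hκ hJ χ (memLp_mul_of_hasCompactSupport hc hd hηc.deriv)]
    exact heq χ η hη hηc
  · have hd : Continuous (deriv η) := hη.continuous_deriv (by exact_mod_cast le_top)
    have mη := memLp_mul_of_hasCompactSupport (κ := κ) (φ := m.Phi0 κ) hc hη.continuous hηc
    have mφη := memLp_mul_of_hasCompactSupport (κ := κ) (φ := m.Phi0 κ) hc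
      (h := fun s => (m.Phi0 κ - s) * η s)
      ((continuous_const.sub continuous_id).mul hη.continuous) hηc.mul_left
    have hweak := hp χ η hη hηc hηt
    rw [integral_phase_mul hκ hu χ (memLp_mul_of_hasCompactSupport hc hd hηc.deriv)] at hweak
    rw [hmu, hmu, hweak]
    congr 1
    set g : L2 d L := (memLp_activity hκ hu).toLp (activity u) with hg
    have hconv : ∀ x, conv m.W (activity u) x = convC hW g x := fun x => by
      rw [convC_apply]; exact conv_congr m.W (memLp_activity hκ hu).coeFn_toLp.symm x
    have i1 := integrable_phase_mul hκ hu χ mφη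
    have i3 := integrable_phase_mul hκ hJ χ mη
    have i2 : Integrable (fun q : Torus d L × ℝ => (χ q.1 * convC hW g q.1) *
        (gaussDensity (m.rhoConst κ) κ (m.Phi0 κ) q.2 * η q.2)) (phaseMeasure d L) := by
      rw [phaseMeasure_eq]
      refine Integrable.mul_prod (f := fun x => χ x * convC hW g x)
        (g := fun s => gaussDensity (m.rhoConst κ) κ (m.Phi0 κ) s * η s) ?_ ?_
      · exact (memLp_continuousMap χ).integrable_mul (memLp_continuousMap (convC hW g))
      · exact (((continuous_gaussDensity _).mul hη.continuous).integrable_of_hasCompactSupport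
          hηc.mul_left).integrableOn
    -- The definition of the flux is solved for the weak derivative `p`.
    have e : ∀ q : Torus d L × ℝ, p q * (χ q.1 * η q.2) =
        κ * (u q * (χ q.1 * ((m.Phi0 κ - q.2) * η q.2))) +
        κ * m.dPhi0 κ * ((χ q.1 * convC hW g q.1) *
          (gaussDensity (m.rhoConst κ) κ (m.Phi0 κ) q.2 * η q.2)) -
        κ * (J q * (χ q.1 * η q.2)) := by
      intro q
      rw [hJdef, linFlux, hconv, rhoInf_eq]
      field_simp
      ring
    have i12 : Integrable (fun q : Torus d L × ℝ =>
        κ * (u q * (χ q.1 * ((m.Phi0 κ - q.2) * η q.2))) +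
        κ * m.dPhi0 κ * ((χ q.1 * convC hW g q.1) *
          (gaussDensity (m.rhoConst κ) κ (m.Phi0 κ) q.2 * η q.2))) (phaseMeasure d L) :=
      (i1.const_mul κ).add (i2.const_mul _)
    simp only [e]
    rw [integral_sub i12 (i3.const_mul κ), integral_add (i1.const_mul κ) (i2.const_mul _),
      integral_const_mul, integral_const_mul, integral_const_mul, integral_phase_mul hκ hu χ mφη,
      integral_phase_mul hκ hJ χ mη]
    congr 2
    rw [phaseMeasure_eq, integral_prod_mul (fun x => χ x * convC hW g x)
      fun s => gaussDensity (m.rhoConst κ) κ (m.Phi0 κ) s * η s]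
    -- The nonlocal term closes on the mode: `χ` is an eigenfunction, so `W∗ū` contributes `lam`
    -- times the activity of the mode itself.
    have h1 : ∫ x, χ x * convC hW g x = lam * inner ℝ (m.activityVec hκ) (modeL m κ χ u) := by
      simp only [convC_apply]
      rw [hχ g, inner_activityVec]
      have h2 : ∫ x, χ x * g x = ∫ x, χ x * activity u x :=
        integral_congr_ae (by
          filter_upwards [(memLp_activity hκ hu).coeFn_toLp] with x hx; rw [hg, hx])
      rw [h2, integral_mul_activity hκ hu χ]
      congr 1
      exact integral_congr_ae (by filter_upwards [coeFn_modeL hκ u] with s hs; rw [hs])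
    rw [h1]; ring

/-- The energy identity and the energy bound for a single mode. -/
theorem mode_dissipation (hκ : 0 < κ) (hτ : 0 < m.τ) (hχ : IsEigenTest m.W χ lam)
    (hW : MemLp m.W 2 volume) {u f : m.Pert κ} (him : m.IsLinearImage κ u f)
    (hu0 : inner ℝ (m.massVec hκ) (modeL m κ χ u) = 0)
    (hf0 : inner ℝ (m.massVec hκ) (modeL m κ χ f) = 0) :
    ∃ D : ℝ, 0 ≤ D ∧
      inner ℝ (modeL m κ χ f) (modeL m κ χ u) - κ * m.dPhi0 κ * lam *
        inner ℝ (m.activityVec hκ) (modeL m κ χ u) *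
        inner ℝ (m.activityVec hκ) (modeL m κ χ f) = -(κ / m.τ) * D ∧
      (‖modeL m κ χ u‖ ^ 2 - κ * m.dPhi0 κ * lam *
        inner ℝ (m.activityVec hκ) (modeL m κ χ u) ^ 2) ^ 2 ≤
        κ ^ 2 * hardyConst κ (m.Phi0 κ) * ‖modeL m κ χ u‖ ^ 2 * D := by
  obtain ⟨J, hJ, h1, h2⟩ := exists_mode_flux hκ hχ hW him
  have hc := m.rhoConst_pos hκ
  set v := modeL m κ χ u
  set g := modeL m κ χ f
  have hv : MemLp v 2 (m.halfMeasure κ) := Lp.memLp v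
  have hg : MemLp g 2 (m.halfMeasure κ) := Lp.memLp g
  have nearJ : ∀ {w : ℝ → ℝ}, MemLp w 2 (m.halfMeasure κ) → IntegrableNear w := fun hw R =>
    (integrableOn_of_memLp hc hκ hw).mono_set Set.Ioo_subset_Ioi_self
  rw [inner_massVec] at hu0 hf0
  have hprim := ae_eq_prim (τ := m.τ) (nearJ hg) (nearJ hJ) h1
  -- The slope `b` of the potential is `κ Φ₀' lam` times the activity of the mode.
  obtain ⟨k, hk⟩ := exists_potential_eq hc hκ hv hJ h2
  refine ⟨∫ s, J s ^ 2 ∂m.halfMeasure κ, integral_nonneg fun s => sq_nonneg _, ?_, ?_⟩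
  · have := dissipation_identity hc hκ hτ.ne' hv hg hJ hf0 hprim hk
    rw [← inner_eq_integral, ← inner_activityVec hκ g] at this
    exact this
  · have := sq_energy_le hc hκ hv hJ hu0 hk
    rw [← inner_eq_integral, real_inner_self_eq_norm_sq, ← inner_activityVec hκ v,
      ← norm_sq_eq_integral] at this
    rwa [mul_assoc _ (inner ℝ (m.activityVec hκ) v) (inner ℝ (m.activityVec hκ) v), ← sq] at this

end Model

end NeuralField

/-! ### Linear stability below the crossing. -/

namespace NeuralField

variable {d : ℕ} {L : ℝ} [hL : Fact (0 < L)]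

namespace Model

variable {m : Model d L} {κ : ℝ}

/-- The decay rate of perturbations when all eigenvalues of the convolution are at most `μ`. -/
def decayRate (m : Model d L) (κ μ : ℝ) : ℝ :=
  2 * (κ / m.τ) * (1 - m.gain (Real.log κ) * μ) / (κ ^ 2 * hardyConst κ (m.Phi0 κ))

/-- The constant in the decay estimate. -/
def decayConst (m : Model d L) (κ μ : ℝ) : ℝ :=
  (1 + m.gain (Real.log κ) * ∫ x, |m.W x|) / (1 - m.gain (Real.log κ) * μ)

/-- Solutions have derivatives of zero mass. -/
theorem IsLinearSolution.inner_massVec_deriv (hκ : 0 < κ) {u : ℝ → m.Pert κ}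
    (hu : m.IsLinearSolution κ u) {t : ℝ} (ht : 0 < t) {f : m.Pert κ} (hf : HasDerivAt u f t)
    (χ : C(Torus d L, ℝ)) : inner ℝ (m.massVec hκ) (modeL m κ χ f) = 0 := by
  have h1 : HasDerivAt (fun s => inner ℝ (m.massVec hκ) (modeL m κ χ (u s)))
      (inner ℝ (m.massVec hκ) (modeL m κ χ f)) t :=
    ((innerSL ℝ (m.massVec hκ)).comp (modeL m κ χ)).hasFDerivAt.comp_hasDerivAt t hf
  have h2 : (fun s => inner ℝ (m.massVec hκ) (modeL m κ χ (u s))) =ᶠ[𝓝 t] fun _ => (0 : ℝ) := by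
    filter_upwards [Ioi_mem_nhds ht] with s hs
    exact inner_massVec_modeL hκ (hu.mass_zero s (le_of_lt hs))
  exact h1.unique ((hasDerivAt_const t (0 : ℝ)).congr_of_eventuallyEq h2)

section Decay

variable (hm : m.Admissible) (hW : MemLp m.W 2 volume) (hκ : 0 < κ) (hτ : 0 < m.τ) {μ : ℝ}
  (hμ : 0 ≤ μ) (hlt : m.gain (Real.log κ) * μ < 1) {u : ℝ → m.Pert κ}
  (hu : m.IsLinearSolution κ u)

include hm hW hκ hτ hμ hlt hu

/-- By the variance bound, `κ Φ₀' (∫ s v)² ≤ gain · ‖v‖²`. So the energy lies between `(1 - gain ·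
μ)‖v‖²` and `(1 + gain · ∫|W|)‖v‖²`, whichever sign `lam` has, and the abstract decay lemma applies
with constants independent of the mode. -/
theorem IsLinearSolution.norm_sq_modeL_le {χ : C(Torus d L, ℝ)} {lam : ℝ}
    (hχ : IsEigenTest m.W χ lam) (hlam : lam ≤ μ) (habs : |lam| ≤ ∫ x, |m.W x|) {t : ℝ}
    (ht : 0 ≤ t) : ‖modeL m κ χ (u t)‖ ^ 2 ≤
      m.decayConst κ μ * Real.exp (-(m.decayRate κ μ * t)) * ‖modeL m κ χ (u 0)‖ ^ 2 := by
  have hb : 0 ≤ κ * m.dPhi0 κ := mul_nonneg hκ.le (hm.deriv_nonneg _)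
  have hv0 : ∀ s ≥ 0, inner ℝ (m.massVec hκ) (modeL m κ χ (u s)) = 0 := fun s hs =>
    inner_massVec_modeL hκ (hu.mass_zero s hs)
  have hr : ∀ s ≥ 0, κ * m.dPhi0 κ * inner ℝ (m.activityVec hκ) (modeL m κ χ (u s)) ^ 2 ≤
      m.gain (Real.log κ) * ‖modeL m κ χ (u s)‖ ^ 2 := fun s hs => by
    rw [← hm.varS_eq hκ, mul_assoc _ (m.varS κ)]
    exact mul_le_mul_of_nonneg_left (sq_inner_activityVec_le hκ (hv0 s hs)) hb
  have hnn : ∀ s, 0 ≤ κ * m.dPhi0 κ * inner ℝ (m.activityVec hκ) (modeL m κ χ (u s)) ^ 2 :=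
    fun s => mul_nonneg hb (sq_nonneg _)
  refine norm_sq_le_of_energy (v := fun t => modeL m κ χ (u t)) (r := m.activityVec hκ)
    (β := κ * m.dPhi0 κ * lam) (sub_pos.2 hlt)
    (mul_pos (pow_pos hκ 2) (hardyConst_pos hκ)) (div_pos hκ hτ)
    ((modeL m κ χ).continuous.comp_continuousOn hu.continuousOn) (fun s hs => ?_) ?_
    (fun s hs => ?_) ht
  · have h1 := mul_le_mul_of_nonneg_right hlam (hnn s)
    have h2 := mul_le_mul_of_nonneg_left (hr s hs) hμ
    linarith
  · have h1 := mul_le_mul_of_nonneg_right ((neg_le_abs lam).trans habs) (hnn 0)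
    have h2 := mul_le_mul_of_nonneg_left (hr 0 le_rfl)
      (integral_nonneg (μ := volume) fun x => abs_nonneg (m.W x))
    linarith
  · obtain ⟨f, hf, him⟩ := hu.evolution s hs
    obtain ⟨D, hD, h1, h2⟩ := mode_dissipation hκ hτ hχ hW him (hv0 s (le_of_lt hs))
      (hu.inner_massVec_deriv hκ hs hf χ)
    exact ⟨_, D, hD, (modeL m κ χ).hasFDerivAt.comp_hasDerivAt s hf, h1, h2⟩

theorem IsLinearSolution.norm_sq_le (heven : CoordEven m.W) (hle : ∀ k, eigen m.W k ≤ μ) {t : ℝ}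
    (ht : 0 ≤ t) :
    ‖u t‖ ^ 2 ≤ m.decayConst κ μ * Real.exp (-(m.decayRate κ μ * t)) * ‖u 0‖ ^ 2 := by
  have hK : 0 ≤ m.decayConst κ μ * Real.exp (-(m.decayRate κ μ * t)) :=
    mul_nonneg (div_nonneg (add_nonneg zero_le_one (mul_nonneg (hm.gain_nonneg _)
      (integral_nonneg fun x => abs_nonneg _))) (sub_pos.2 hlt).le) (Real.exp_pos _).le
  set K := m.decayConst κ μ * Real.exp (-(m.decayRate κ μ * t)) with hKdef
  have hmode : ∀ χ : C(Torus d L, ℝ), ∀ n, IsEigenTest m.W χ (eigen m.W (absFreq n)) →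
      ENNReal.ofReal (‖modeL m κ χ (u t)‖ ^ 2) ≤
        ENNReal.ofReal K * ENNReal.ofReal (‖modeL m κ χ (u 0)‖ ^ 2) := fun χ n hχ => by
    rw [← ENNReal.ofReal_mul hK]
    exact ENNReal.ofReal_le_ofReal (hu.norm_sq_modeL_le hm hW hκ hτ hμ hlt hχ (hle _)
      (abs_eigen_le hW heven n) ht)
  have hsum : ENNReal.ofReal (L ^ d * ‖u t‖ ^ 2) ≤ ENNReal.ofReal (K * (L ^ d * ‖u 0‖ ^ 2)) := by
    rw [ENNReal.ofReal_mul hK, ← tsum_norm_sq_partialL (m.weightMeasure_eq κ),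
      ← tsum_norm_sq_partialL (m.weightMeasure_eq κ), ← ENNReal.tsum_mul_left]
    refine ENNReal.tsum_le_tsum fun n => ?_
    rw [mul_add]
    exact add_le_add (hmode _ n (isEigenTest_reChar hW heven n))
      (hmode _ n (isEigenTest_imChar hW heven n))
  have hLd := pow_pos hL.out d
  rw [ENNReal.ofReal_le_ofReal_iff (mul_nonneg hK (mul_nonneg hLd.le (sq_nonneg _)))] at hsum
  refine le_of_mul_le_mul_left ?_ hLd
  linarith

end Decay

/-- The homogeneous state is stable if the gain times the largest eigenvalue is less than one. -/
theorem Admissible.isLinearlyAsymptoticallyStable (hm : m.Admissible) (hW : MemLp m.W 2 volume)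
    (heven : CoordEven m.W) (hκ : 0 < κ) (hτ : 0 < m.τ) {μ : ℝ} (hμ : 0 ≤ μ)
    (hle : ∀ k, eigen m.W k ≤ μ) (hlt : m.gain (Real.log κ) * μ < 1) :
    m.IsLinearlyAsymptoticallyStable κ := by
  have hω : 0 < m.decayRate κ μ := div_pos (mul_pos (mul_pos two_pos (div_pos hκ hτ))
    (sub_pos.2 hlt)) (mul_pos (pow_pos hκ 2) (hardyConst_pos hκ))
  have hC : 0 ≤ m.decayConst κ μ := div_nonneg (add_nonneg zero_le_one
    (mul_nonneg (hm.gain_nonneg _) (integral_nonneg fun x => abs_nonneg _))) (sub_pos.2 hlt).le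
  refine ⟨⟨√(m.decayConst κ μ), fun u hu t ht => ?_⟩, fun u hu => ?_⟩
  · have h := hu.norm_sq_le hm hW hκ hτ hμ hlt heven hle ht
    have he : Real.exp (-(m.decayRate κ μ * t)) ≤ 1 :=
      Real.exp_le_one_iff.2 (neg_nonpos.2 (mul_nonneg hω.le ht))
    refine (sq_le_sq₀ (norm_nonneg _) (mul_nonneg (Real.sqrt_nonneg _) (norm_nonneg _))).1 ?_
    rw [mul_pow, Real.sq_sqrt hC]
    refine h.trans (mul_le_mul_of_nonneg_right ?_ (sq_nonneg _))
    exact mul_le_of_le_one_right hC he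
  · have h0 : Tendsto (fun t => m.decayConst κ μ * Real.exp (-(m.decayRate κ μ * t)) * ‖u 0‖ ^ 2)
        atTop (𝓝 (m.decayConst κ μ * 0 * ‖u 0‖ ^ 2)) :=
      (((Real.tendsto_exp_neg_atTop_nhds_zero.comp
        (tendsto_id.const_mul_atTop hω)).const_mul _).mul_const _)
    rw [mul_zero, zero_mul] at h0
    have h1 : Tendsto (fun t => ‖u t‖ ^ 2) atTop (𝓝 0) :=
      tendsto_of_tendsto_of_tendsto_of_le_of_le' tendsto_const_nhds h0
        (Eventually.of_forall fun t => sq_nonneg _) (by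
          filter_upwards [eventually_ge_atTop 0] with t ht
          exact hu.norm_sq_le hm hW hκ hτ hμ hlt heven hle ht)
    have h2 := h1.sqrt
    simp only [Real.sqrt_sq (norm_nonneg _), Real.sqrt_zero] at h2
    exact tendsto_zero_iff_norm_tendsto_zero.2 h2

end Model

end NeuralField

/-! ### The neutral mode at the crossing. -/

namespace NeuralField

variable {d : ℕ} {L : ℝ} [hL : Fact (0 < L)]

theorem setIntegral_mul_deriv_eq {h h' η : ℝ → ℝ} (hh : ∀ s, HasDerivAt h (h' s) s)
    (hh' : Continuous h') (hη : ContDiff ℝ (⊤ : ℕ∞) η) (hηc : HasCompactSupport η)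
    (hηt : tsupport η ⊆ Set.Ioi 0) :
    ∫ s in Set.Ioi 0, h s * deriv η s = -∫ s in Set.Ioi 0, h' s * η s := by
  have hc : Continuous h := continuous_iff_continuousAt.2 fun s => (hh s).continuousAt
  have hd : Continuous (deriv η) := hη.continuous_deriv (by exact_mod_cast le_top)
  have h0 : ∀ s ∉ Set.Ioi (0 : ℝ), η s = 0 := fun s hs =>
    image_eq_zero_of_notMem_tsupport fun h => hs (hηt h)
  have h1 : ∀ s ∉ Set.Ioi (0 : ℝ), deriv η s = 0 := fun s hs =>
    image_eq_zero_of_notMem_tsupport fun h => hs (hηt (tsupport_deriv_subset h))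
  rw [setIntegral_eq_integral_of_forall_compl_eq_zero fun s hs => by rw [h1 s hs, mul_zero],
    setIntegral_eq_integral_of_forall_compl_eq_zero fun s hs => by rw [h0 s hs, mul_zero]]
  exact integral_mul_deriv_eq_deriv_mul_of_integrable (fun s _ => hh s)
    (fun s _ => (hη.differentiable (by simp) s).hasDerivAt)
    ((hc.mul hd).integrable_of_hasCompactSupport hηc.deriv.mul_left)
    ((hh'.mul hη.continuous).integrable_of_hasCompactSupport hηc.mul_left)
    ((hc.mul hη.continuous).integrable_of_hasCompactSupport hηc.mul_left)

/-- Continuous functions embed injectively in `L²`, so the eigenvector equation holds at every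
point. -/
theorem convC_toL2_eq {W : Torus d L → ℝ} (hW : MemLp W 2 volume) {e : C(Torus d L, ℝ)} {μ : ℝ}
    (he : convL hW (toL2 e) = μ • toL2 e) : convC hW (toL2 e) = μ • e := by
  refine ContinuousMap.toLp_injective (𝕜 := ℝ) (p := 2) (volume : Measure (Torus d L)) ?_
  rw [map_smul]
  exact he

namespace Model

variable {m : Model d L} {κ : ℝ}

/-- The profile `(s - M) ρ_∞(s)` of the neutral mode, with `M` the mean. -/
def neutralProfile (m : Model d L) (κ s : ℝ) : ℝ := (s - m.meanS κ) * m.rhoInf κ s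

/-- The derivative of the profile of the neutral mode. -/
def neutralDeriv (m : Model d L) (κ s : ℝ) : ℝ :=
  m.rhoInf κ s - κ * (s - m.Phi0 κ) * m.neutralProfile κ s

theorem hasDerivAt_neutralProfile (s : ℝ) :
    HasDerivAt (m.neutralProfile κ) (m.neutralDeriv κ s) s := by
  unfold neutralProfile neutralDeriv
  rw [rhoInf_eq]
  refine (((hasDerivAt_id s).sub_const (m.meanS κ)).mul
    (hasDerivAt_gaussDensity (m.Phi0 κ) s)).congr_deriv ?_
  simp only [id, neutralProfile, rhoInf_eq]
  ring

theorem continuous_rhoInf : Continuous (m.rhoInf κ) := by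
  rw [rhoInf_eq]; exact continuous_gaussDensity _

theorem continuous_neutralDeriv : Continuous (m.neutralDeriv κ) := by
  have := continuous_rhoInf (m := m) (κ := κ)
  unfold neutralDeriv neutralProfile
  fun_prop

section Integrals

variable (hm : m.Admissible) (hκ : 0 < κ)
include hm hκ

theorem Admissible.integral_neutralProfile : ∫ s in Set.Ioi 0, m.neutralProfile κ s = 0 := by
  have hi0 : IntegrableOn (m.rhoInf κ) (Set.Ioi 0) := by
    rw [rhoInf_eq]; exact integrableOn_gaussDensity hκ _
  have hi1 : IntegrableOn (fun s => s * m.rhoInf κ s) (Set.Ioi 0) := by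
    rw [rhoInf_eq]; exact integrableOn_mul_gaussDensity hκ _
  simp only [neutralProfile, sub_mul]
  rw [integral_sub hi1 (hi0.const_mul _), integral_const_mul, integral_rhoInf hκ,
    integral_mul_rhoInf hκ, ← hm.meanS_eq hκ]
  ring

omit hm in
theorem integrableOn_mul_neutralProfile :
    IntegrableOn (fun s => s * m.neutralProfile κ s) (Set.Ioi 0) := by
  have hi1 : IntegrableOn (fun s => s * m.rhoInf κ s) (Set.Ioi 0) := by
    rw [rhoInf_eq]; exact integrableOn_mul_gaussDensity hκ _
  have hi2 : IntegrableOn (fun s => s ^ 2 * m.rhoInf κ s) (Set.Ioi 0) := by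
    rw [rhoInf_eq]; exact integrableOn_sq_mul_gaussDensity hκ _
  refine (hi2.sub (hi1.const_mul (m.meanS κ))).congr (ae_of_all _ fun s => ?_)
  simp only [neutralProfile, Pi.sub_apply]; ring

theorem Admissible.integral_mul_neutralProfile :
    ∫ s in Set.Ioi 0, s * m.neutralProfile κ s = m.varS κ := by
  have hi0 : IntegrableOn (m.rhoInf κ) (Set.Ioi 0) := by
    rw [rhoInf_eq]; exact integrableOn_gaussDensity hκ _
  have hi1 : IntegrableOn (fun s => s * m.rhoInf κ s) (Set.Ioi 0) := by
    rw [rhoInf_eq]; exact integrableOn_mul_gaussDensity hκ _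
  have hi : IntegrableOn (m.neutralProfile κ) (Set.Ioi 0) := by
    refine (hi1.sub (hi0.const_mul (m.meanS κ))).congr (ae_of_all _ fun s => ?_)
    simp only [neutralProfile, Pi.sub_apply]; ring
  have e : ∀ s, (s - m.meanS κ) ^ 2 * m.rhoInf κ s =
      s * m.neutralProfile κ s - m.meanS κ * m.neutralProfile κ s := fun s => by
    unfold neutralProfile; ring
  unfold varS
  simp only [e]
  rw [integral_sub (integrableOn_mul_neutralProfile hκ) (hi.const_mul _), integral_const_mul,
    hm.integral_neutralProfile hκ, mul_zero, sub_zero]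

omit hm in
theorem memLp_neutralProfile : MemLp (m.neutralProfile κ) 2 (m.halfMeasure κ) := by
  have h := (memLp_id_mul_gaussDensity (φ := m.Phi0 κ) (m.rhoConst_pos hκ) hκ).sub
    ((memLp_gaussDensity (φ := m.Phi0 κ) (m.rhoConst_pos hκ) hκ).const_mul (m.meanS κ))
  refine h.ae_eq (ae_of_all _ fun s => ?_)
  simp only [neutralProfile, rhoInf_eq, Pi.sub_apply]; ring

end Integrals

/-- The homogeneous state is not asymptotically stable if the gain times some eigenvalue is one:
there is a neutral mode. -/
theorem Admissible.not_isLinearlyAsymptoticallyStable (hm : m.Admissible)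
    (hW : MemLp m.W 2 volume) (hκ : 0 < κ) {e : C(Torus d L, ℝ)} (he0 : toL2 e ≠ 0) {μ : ℝ}
    (he : convL hW (toL2 e) = μ • toL2 e) (hg : m.gain (Real.log κ) * μ = 1) :
    ¬ m.IsLinearlyAsymptoticallyStable κ := by
  rintro ⟨-, hstab⟩
  have hV : κ * m.dPhi0 κ * m.varS κ * μ = 1 := by rw [hm.varS_eq hκ, hg]
  have hV0 : m.varS κ ≠ 0 := fun h => by rw [h] at hV; simp at hV
  set U : Torus d L × ℝ → ℝ := fun q => e q.1 * m.neutralProfile κ q.2 with hU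
  have hUL : MemLp U 2 (m.weightMeasure κ) := by
    rw [weightMeasure_eq]; exact memLp_tensor e (memLp_neutralProfile hκ)
  set u : m.Pert κ := hUL.toLp U with hu
  have toPhase : ∀ {p : Torus d L × ℝ → Prop}, (∀ᵐ q ∂m.weightMeasure κ, p q) →
      ∀ᵐ q ∂phaseMeasure d L, p q := fun h => by
    rw [weightMeasure_eq] at h
    exact (ae_phaseMeasure_iff hκ).1 h
  have hue : u =ᵐ[phaseMeasure d L] U := toPhase hUL.coeFn_toLp
  have slice : ∀ {f g : Torus d L × ℝ → ℝ}, f =ᵐ[phaseMeasure d L] g → ∀ᵐ x : Torus d L,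
      ∀ᵐ s ∂volume.restrict (Set.Ioi (0 : ℝ)), f (x, s) = g (x, s) := fun h => by
    rw [phaseMeasure_eq] at h
    exact Measure.ae_ae_of_ae_prod h
  have hact : activity u =ᵐ[volume] (m.varS κ • toL2 e : L2 d L) := by
    filter_upwards [slice hue, Lp.coeFn_smul (m.varS κ) (toL2 e), coeFn_toL2 e] with x h1 h2 h3
    rw [h2, Pi.smul_apply, h3, smul_eq_mul, ← hm.integral_mul_neutralProfile hκ, activity,
      ← integral_mul_const]
    refine integral_congr_ae ?_
    filter_upwards [h1] with s hs
    rw [hs, hU]; ring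
  have hconv : ∀ x, conv m.W (activity u) x = m.varS κ * (μ * e x) := fun x => by
    rw [conv_congr m.W hact, ← convC_apply hW, map_smul, convC_toL2_eq hW he]
    simp
  set p : Torus d L × ℝ → ℝ := fun q => e q.1 * m.neutralDeriv κ q.2 with hp
  -- The drift and diffusion terms leave `-(1/κ) e ρ_∞`, and the nonlocal term compensates this
  -- exactly because `κ Φ₀' varS μ = 1`.
  have hflux : ∀ q, u q = U q → m.linFlux κ u p q = 0 := fun q hq => by
    have h1 : m.dPhi0 κ * (m.varS κ * (μ * e q.1)) = 1 / κ * e q.1 := by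
      rw [eq_comm, one_div, inv_mul_eq_iff_eq_mul₀ hκ.ne']
      linear_combination (-e q.1) * hV
    rw [linFlux, hconv, h1, hq]
    simp only [hU, hp, neutralDeriv]
    field_simp
    ring
  have hsol : m.IsLinearSolution κ fun _ => u := by
    refine ⟨continuousOn_const, fun t _ => ?_, fun t _ => ⟨0, hasDerivAt_const t u, p, ?_, ?_, ?_⟩⟩
    · filter_upwards [slice hue] with x hx
      rw [integral_congr_ae hx]
      simp only [hU]
      rw [integral_const_mul, hm.integral_neutralProfile hκ, mul_zero]
    · intro χ η hη hηc hηt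
      have e1 : ∫ q, u q * (χ q.1 * deriv η q.2) ∂phaseMeasure d L =
          (∫ x, χ x * e x) * ∫ s in Set.Ioi 0, m.neutralProfile κ s * deriv η s := by
        rw [← integral_prod_mul, ← phaseMeasure_eq]
        refine integral_congr_ae ?_
        filter_upwards [hue] with q hq
        rw [hq, hU]; ring
      have e2 : ∫ q, p q * (χ q.1 * η q.2) ∂phaseMeasure d L =
          (∫ x, χ x * e x) * ∫ s in Set.Ioi 0, m.neutralDeriv κ s * η s := by
        rw [← integral_prod_mul, ← phaseMeasure_eq]
        refine integral_congr_ae (ae_of_all _ fun q => ?_)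
        simp only [hp]; ring
      rw [e1, e2, setIntegral_mul_deriv_eq hasDerivAt_neutralProfile continuous_neutralDeriv
        hη hηc hηt, mul_neg]
    · have h0 : (0 : Torus d L × ℝ → ℝ) =ᵐ[m.weightMeasure κ] m.linFlux κ u p := by
        filter_upwards [hUL.coeFn_toLp] with q hq
        exact (hflux q hq).symm
      exact MemLp.zero.ae_eq h0
    · intro χ η hη hηc
      have e1 : ∫ q, (0 : m.Pert κ) q * (χ q.1 * η q.2) ∂phaseMeasure d L = 0 := by
        refine integral_eq_zero_of_ae ?_
        filter_upwards [toPhase (Lp.coeFn_zero ℝ 2 (m.weightMeasure κ))] with q hq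
        rw [hq]; simp
      have e2 : ∫ q, m.linFlux κ u p q * (χ q.1 * deriv η q.2) ∂phaseMeasure d L = 0 := by
        refine integral_eq_zero_of_ae ?_
        filter_upwards [hue] with q hq
        rw [hflux q hq]; simp
      rw [e1, e2, mul_zero]
  -- The constant-in-time solution can tend to zero only if it is zero, but its activity `varS • e`
  -- is not.
  have hu0 : u = 0 := tendsto_nhds_unique tendsto_const_nhds (hstab _ hsol)
  have h0 : activity u =ᵐ[volume] (0 : Torus d L → ℝ) := by
    have h1 : u =ᵐ[phaseMeasure d L] (0 : Torus d L × ℝ → ℝ) := by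
      rw [hu0]; exact toPhase (Lp.coeFn_zero ℝ 2 (m.weightMeasure κ))
    filter_upwards [slice h1] with x hx
    rw [activity]
    refine integral_eq_zero_of_ae ?_
    filter_upwards [hx] with s hs
    rw [hs]; simp
  have h2 : m.varS κ • toL2 e = 0 := (Lp.eq_zero_iff_ae_eq_zero).2 (hact.symm.trans h0)
  exact (smul_ne_zero hV0 he0) h2

end Model

end NeuralField

/-! ### From the bifurcation equation to the gain, and the conclusion. -/

namespace NeuralField

variable {d : ℕ} {L : ℝ} [hL : Fact (0 < L)]

theorem eigen_ne_iff {W : Torus d L → ℝ} {j k : Fin d → ℕ} :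
    eigen W j ≠ eigen W k ↔ mode W j / Theta j ≠ mode W k / Theta k :=
  (mul_right_injective₀ (Real.rpow_pos_of_pos hL.out _).ne').ne_iff

theorem eigen_le_iff {W : Torus d L → ℝ} {j k : Fin d → ℕ} :
    eigen W j ≤ eigen W k ↔ mode W j / Theta j ≤ mode W k / Theta k :=
  mul_le_mul_iff_right₀ (Real.rpow_pos_of_pos hL.out _)

/-- Every Fourier coefficient is an eigenvalue of the convolution with a continuous
eigenfunction. -/
theorem convL_omegaC {W : Torus d L → ℝ} (hW : MemLp W 2 volume) (heven : CoordEven W)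
    (k : Fin d → ℕ) : convL hW (toL2 (omegaC k)) = eigen W k • toL2 (omegaC k) := by
  refine convL_eq_smul hW heven fun n hn => ?_
  by_contra hc
  refine hn ?_
  rw [coeff_congr (coeFn_toL2 _)]
  exact coeff_omega fun h => hc (by rw [← h])

namespace Model

variable {m : Model d L}

theorem Admissible.bifurcationEq_iff (hm : m.Admissible) {k : Fin d → ℕ} (hk : 0 < eigen m.W k)
    {κ : ℝ} (hκ : 0 < κ) : m.BifurcationEq k κ ↔ m.gain (Real.log κ) * eigen m.W k = 1 := by
  have hg := hm.gain_eq_bifurcation (Real.log κ)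
  rw [Real.exp_log hκ] at hg
  have hs := Real.rpow_pos_of_pos hL.out ((d : ℝ) / 2)
  rw [BifurcationEq, mul_assoc (L ^ ((d : ℝ) / 2)), ← hg]
  have hr : mode m.W k / Theta k ≠ 0 := fun h => by rw [eigen, h, mul_zero] at hk; exact hk.false
  -- With zero gain the right-hand side is `1 / 0 = 0`, which the positive mode excludes.
  by_cases h0 : m.gain (Real.log κ) = 0
  · rw [h0]
    simpa using hr
  · rw [eq_div_iff (mul_ne_zero hs.ne' h0), eigen]
    constructor <;> intro h <;> linarith

/-- As `L^{d/2} · L^{d/2} = L^d`, the threshold hypothesis says that `1/eigen W k` lies below the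
limit of the gain, and it is attained by continuity. -/
theorem Admissible.exists_gain_mul_eq_one (hm : m.Admissible) {k : Fin d → ℕ}
    (hk : L ^ ((d : ℝ) / 2) / deriv m.Φ (m.W0 * m.rhoStar + m.B) < mode m.W k / Theta k) :
    0 < eigen m.W k ∧ ∃ κ > 0, m.gain (Real.log κ) * eigen m.W k = 1 := by
  have hs := Real.rpow_pos_of_pos hL.out ((d : ℝ) / 2)
  have hΦ := hm.deriv_pos hm.inputStar_pos
  have hLd : L ^ ((d : ℝ) / 2) * L ^ ((d : ℝ) / 2) = L ^ d := by
    rw [← Real.rpow_add hL.out, add_halves, Real.rpow_natCast]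
  have hpos : 0 < eigen m.W k := mul_pos hs ((div_pos hs hΦ).trans hk)
  have hlt : (eigen m.W k)⁻¹ < deriv m.Φ (m.W0 * m.rhoStar + m.B) / L ^ d := by
    rw [inv_lt_iff_one_lt_mul₀ hpos, ← hLd, eigen, div_mul_eq_mul_div, lt_div_iff₀ (mul_pos hs hs)]
    rw [div_lt_iff₀ hΦ] at hk
    have := mul_lt_mul_of_pos_left hk hs
    linarith
  obtain ⟨θ, hθ⟩ := hm.exists_gain_eq (inv_pos.2 hpos).le hlt
  refine ⟨hpos, Real.exp θ, Real.exp_pos θ, ?_⟩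
  rw [Real.log_exp, hθ, inv_mul_cancel₀ hpos.ne']

end Model

end NeuralField

end

open NeuralField in
theorem corollary3p13 {d : ℕ} {L : ℝ} [Fact (0 < L)] (m : NeuralField.Model d L) (hτ : 0 < m.τ)
    (hW : MemLp m.W 2 volume) (hWeven : NeuralField.CoordEven m.W)
    (hΦ : ContDiff ℝ 2 m.Φ) (hΦ'' : ∀ x, 0 ≤ deriv (deriv m.Φ) x)
    (hΦmono : StrictMonoOn m.Φ (Set.Ici 0)) (hΦzero : ∀ x ≤ 0, m.Φ x = 0)
    (hB : 0 < m.B) (hW0 : m.W0 < 0)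
    (kstar : Fin d → ℕ)
    (hmax : ∀ k : Fin d → ℕ, NeuralField.mode m.W k / NeuralField.Theta k ≤
      NeuralField.mode m.W kstar / NeuralField.Theta kstar)
    (hlarge : NeuralField.mode m.W kstar / NeuralField.Theta kstar >
      L ^ ((d : ℝ) / 2) / deriv m.Φ (m.W0 * m.rhoStar + m.B))
    (hsimple : ∀ k : Fin d → ℕ, k ≠ kstar →
      NeuralField.mode m.W kstar / NeuralField.Theta kstar ≠
          NeuralField.mode m.W k / NeuralField.Theta k ∨
        (NeuralField.Exchangeable m.W ∧ ∃ ζ : Equiv.Perm (Fin d), k = kstar ∘ ζ)) :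
    -- the homogeneous branch and its limit are well defined
    (∀ κ > 0, ∃! y : ℝ, m.IsHomMean κ y) ∧
    Tendsto m.rhoBar atTop (𝓝 m.rhoStar) ∧
    ∃ κstar > 0,
      -- the unique solution of the bifurcation equation
      m.BifurcationEq kstar κstar ∧
      (∀ κ > 0, m.BifurcationEq kstar κ → κ = κstar) ∧
      -- a bifurcation occurs there
      ((∀ k : Fin d → ℕ, k ≠ kstar → NeuralField.mode m.W kstar / NeuralField.Theta kstar ≠
          NeuralField.mode m.W k / NeuralField.Theta k) →
        m.IsBifurcationPoint (NeuralField.L2S d L) κstar) ∧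
      (NeuralField.Exchangeable m.W → m.IsBifurcationPoint (NeuralField.L2ex d L) κstar) ∧
      -- and not before
      (∀ κ > 0, κ < κstar → m.IsLocallyHomogeneous (NeuralField.L2S d L) κ) ∧
      -- and this is where linear stability is lost
      IsLeast {κ : ℝ | 0 < κ ∧ ¬ m.IsLinearlyAsymptoticallyStable κ} κstar := by
  have hm : m.Admissible := ⟨hΦ, hΦ'', hΦmono, hΦzero, hB, hW0⟩
  obtain ⟨hμ, κs, hκs, hgain⟩ := hm.exists_gain_mul_eq_one hlarge
  have hle : ∀ k, eigen m.W k ≤ eigen m.W kstar := fun k => eigen_le_iff.2 (hmax k)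
  obtain ⟨μ', hμ'lt, hμ'0, hμ'⟩ := exists_eigen_gap hW hWeven hμ hle
  have hpos : ∀ {κ}, m.gain (Real.log κ) * eigen m.W kstar = 1 → 0 < m.gain (Real.log κ) :=
    fun h => (hm.gain_nonneg _).lt_of_ne fun h0 => by rw [← h0, zero_mul] at h; exact zero_ne_one h
  have hlt : ∀ κ > 0, κ < κs → m.gain (Real.log κ) * eigen m.W kstar < 1 := fun κ hκ h =>
    (mul_lt_mul_of_pos_right (hm.gain_lt (Real.log_lt_log hκ h) (hpos hgain)) hμ).trans_eq hgain
  refine ⟨fun κ hκ => hm.existsUnique_isHomMean hκ, hm.tendsto_rhoBar, κs, hκs,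
    (hm.bifurcationEq_iff hμ hκs).2 hgain, fun κ hκ h => ?_, fun hs => ?_, fun hex => ?_,
    fun κ hκ h => ?_, ⟨hκs, ?_⟩, fun κ ⟨hκ, h⟩ => ?_⟩
  · have h1 := (hm.bifurcationEq_iff hμ hκ).1 h
    rcases lt_trichotomy κ κs with h2 | h2 | h2
    · exact absurd h1 (hlt κ hκ h2).ne
    · exact h2
    -- Strict monotonicity is available because a second solution also has positive gain.
    · have h3 := mul_lt_mul_of_pos_right (hm.gain_lt (Real.log_lt_log hκs h2) (hpos h1)) hμ
      rw [hgain, h1] at h3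
      exact absurd h3 (lt_irrefl _)
  · obtain ⟨e, he⟩ := isSimpleTop_even hW hWeven hμ' fun j hj => eigen_ne_iff.2 (hs j hj).symm
    rw [← coe_evenSubmodule]
    exact hm.isBifurcationPoint he hWeven hμ hμ'0 hμ'lt hκs hgain
  · obtain ⟨e, he⟩ := isSimpleTop_ex hW hWeven hex hμ' fun j hj => by
      by_cases hjk : j = kstar
      -- The hypothesis speaks only of `k ≠ k*`; for `k*` itself the identity permutation serves.
      · exact ⟨1, hjk⟩
      · exact ((hsimple j hjk).resolve_left fun h => eigen_ne_iff.2 h.symm hj).2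
    rw [← coe_exSubmodule]
    exact hm.isBifurcationPoint he hWeven hμ hμ'0 hμ'lt hκs hgain
  · exact hm.isLocallyHomogeneous hW hκ
      (fun g => inner_convL_le hW hWeven fun n _ => hle _) (hlt κ hκ h)
  · exact hm.not_isLinearlyAsymptoticallyStable hW hκs (toL2_ne_zero (omega_zero_pos kstar).ne')
      (convL_omegaC hW hWeven kstar) hgain
  · by_contra! hc
    exact h (hm.isLinearlyAsymptoticallyStable hW hWeven hκ hτ hμ.le hle (hlt κ hκ hc))
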